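/- Let $G=SL_2(\mathbb{R})$, let $\mathbb{RP}^1$ be the real projective line with the induced $G$-action, and let $d_{\mathbb{RP}^1}(\overline{x},\overline{y})=\frac1\pi\left|\arcsin\sqrt{1-\left(\frac{\langle x,y\rangle}{\|x\|\|y\|}\right)^2}\right|$ be its rotation-invariant metric. Let $d$ be the distance of a left-invariant Riemannian metric on $G$, and let $\mathcal{D}^G_1,\mathcal{D}^G_2,\ldots$ be partitions of $G$ into Borel sets such that for some constant $M$ and all $n\ge 1$: (i) $\mathcal{D}^G_{n+1}$ refines $\mathcal{D}^G_n$; (ii) every $D\in\mathcal{D}^G_n$ contains at most $M$ elements of $\mathcal{D}^G_{n+1}$; (iii) every $D\in\mathcal{D}^G_n$ contains a $d$-ball of radius $\frac1M 2^{-n}$ and is contained in a $d$-ball of radius $M2^{-n}$. Let $\mu$ be a finitely supported probability measure on $G$ such that the group $G_\mu$ generated by $\operatorname{supp}\mu$ is unbounded and totally irreducible (it preserves no nonempty finite subset of $\mathbb{RP}^1$), and let $\nu$ be the stationary probability measure of $\mu$ on $\mathbb{RP}^1$, i.e. the push-forward of $\mu\times\nu$ under $(A,x)\mapsto Ax$ equals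 $\nu$. Then there is $\chi>0$ (the Lyapunov exponent of $\mu$) such that $\frac1n\log_2\|X_n\cdots X_1\|\to\chi$ almost surely for i.i.d. $X_1,X_2,\ldots$ with law $\mu$; there is $\alpha=\dim\nu$ such that $\nu$ is exact dimensional with dimension $\alpha$, i.e. $\nu(B_r(x))=r^{\alpha+o(1)}$ as $r\to0$ for $\nu$-a.e. $x$; and \[ \lim_{n\to\infty}\frac{1}{2\chi n}H(\mu^{\star n},\mathcal{D}^G_1)=\alpha , \] where $\mu^{\star n}$ is the $n$-fold convolution of $\mu$ in $G$ and $H(\eta,\mathcal{A})=-\sum_{A\in\mathcal{A}}\eta(A)\log_2\eta(A)$. -/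

import Mathlib

open MeasureTheory Filter Topology
open scoped Matrix

noncomputable section

namespace FurstenbergMeasure

/-- The group `G = SL₂(ℝ)`. -/
abbrev SL2R : Type := Matrix.SpecialLinearGroup (Fin 2) ℝ

/-- `G` carries the Borel σ-algebra of its usual topology. -/
instance instMeasurableSpaceSL2R : MeasurableSpace SL2R := borel SL2R

instance instBorelSpaceSL2R : BorelSpace SL2R := ⟨rfl⟩

/-- The real projective line, i.e. the space of lines through the origin of `ℝ²`.
Mathlib's action of `SL₂(ℝ)` on it is the one induced by the linear action on `ℝ²`. -/
abbrev RP1 : Type := Projectivization ℝ (Fin 2 → ℝ)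

/-- The quotient topology coming from `ℝ² \ {0}`. -/
instance instTopologicalSpaceRP1 : TopologicalSpace RP1 :=
  TopologicalSpace.coinduced (Projectivization.mk' ℝ (V := Fin 2 → ℝ)) inferInstance

instance instMeasurableSpaceRP1 : MeasurableSpace RP1 := borel RP1

instance instBorelSpaceRP1 : BorelSpace RP1 := ⟨rfl⟩

/-- The rotation invariant metric on the projective line:
`π⁻¹ |arcsin (√(1 - (⟨x, y⟩ / (‖x‖ ‖y‖))²))|`, computed on representatives. -/
def distRP1 (x y : RP1) : ℝ :=
  1 / Real.pi * |Real.arcsin (√(1 - ((x.rep ⬝ᵥ y.rep) /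
    (√(x.rep ⬝ᵥ x.rep) * √(y.rep ⬝ᵥ y.rep))) ^ 2))|

/-- The operator norm of a matrix acting on the Euclidean plane. -/
def opNorm (g : SL2R) : ℝ :=
  ‖Matrix.toEuclideanCLM (𝕜 := ℝ) (g : Matrix (Fin 2) (Fin 2) ℝ)‖

/-- `G_μ`: the group generated (algebraically, no closure is taken) by the support of `μ`. -/
def generatedGroup (μ : Measure SL2R) : Subgroup SL2R := Subgroup.closure μ.support

/-- A subgroup of `G` is unbounded if its elements have unbounded norm. -/
def IsUnbounded (Γ : Subgroup SL2R) : Prop := ¬ ∃ C : ℝ, ∀ g ∈ Γ, opNorm g ≤ C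

/-- A subgroup of `G` is totally irreducible if it preserves no (nonempty) finite set of lines. -/
def IsTotallyIrreducible (Γ : Subgroup SL2R) : Prop :=
  ¬ ∃ S : Set RP1, S.Finite ∧ S.Nonempty ∧ ∀ g ∈ Γ, ∀ x ∈ S, g • x ∈ S

/-- `ν` is `μ`-stationary: the push-forward of `μ × ν` under `(A, x) ↦ A x` is `ν`. -/
def IsStationaryMeasure (μ : Measure SL2R) (ν : Measure RP1) : Prop :=
  (μ.prod ν).map (fun p : SL2R × RP1 => p.1 • p.2) = ν

/-- The product `X_n ⋯ X_1` of the first `n` terms of a sequence whose terms are indexed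
from `0`, the later terms being multiplied on the left. -/
def leftProd (X : ℕ → SL2R) : ℕ → SL2R
  | 0 => 1
  | n + 1 => X n * leftProd X n

/-- `χ` is the Lyapunov exponent of `μ`: for i.i.d. `X_1, X_2, …` with law `μ`, almost surely
`(1 / n) log₂ ‖X_n ⋯ X_1‖ → χ`. -/
def IsLyapunovExponent (μ : Measure SL2R) [IsProbabilityMeasure μ] (χ : ℝ) : Prop :=
  ∀ᵐ X : ℕ → SL2R ∂(Measure.infinitePi fun _ : ℕ => μ),
    Tendsto (fun n : ℕ => 1 / (n : ℝ) * Real.logb 2 (opNorm (leftProd X n))) atTop (𝓝 χ)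

/-- `ν` is exact dimensional with dimension `α`: for `ν`-a.e. `x`, `ν(B_r(x)) = r^(α + o(1))` as
`r → 0`. -/
def HasExactDim (ν : Measure RP1) (α : ℝ) : Prop :=
  ∀ᵐ x ∂ν, Tendsto (fun r : ℝ => Real.log (ν.real {y | distRP1 x y < r}) / Real.log r)
    (𝓝[>] 0) (𝓝 α)

/-- The `n`-fold convolution of `μ` with itself in `G`. -/
def convPow (μ : Measure SL2R) : ℕ → Measure SL2R
  | 0 => Measure.dirac 1
  | n + 1 => (convPow μ n).mconv μ

/-- The quadratic form `Q` restricts to an inner product on the Lie algebra of `G`, that is, on the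
matrices of trace zero. -/
def IsLieAlgebraInner (Q : QuadraticForm ℝ (Matrix (Fin 2) (Fin 2) ℝ)) : Prop :=
  ∀ X : Matrix (Fin 2) (Fin 2) ℝ, X.trace = 0 → X ≠ 0 → 0 < Q X

/-- `γ` restricted to `[0, 1]` is a continuously differentiable path in `G`. -/
def IsC1Path (γ : ℝ → SL2R) : Prop :=
  ∀ i j : Fin 2, ContDiffOn ℝ 1 (fun t => γ t i j) (Set.Icc 0 1)

/-- The velocity of a path in `G` at time `t ∈ [0, 1]`, as a `2 × 2` matrix. -/
def velocity (γ : ℝ → SL2R) (t : ℝ) : Matrix (Fin 2) (Fin 2) ℝ :=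
  Matrix.of fun i j => derivWithin (fun s => γ s i j) (Set.Icc 0 1) t

/-- The length of a path for the left-invariant Riemannian metric on `G` which is given by `Q` on
the tangent space at the identity. The matrix `γ(t)⁻¹ γ'(t)` has trace zero. -/
def pathLength (Q : QuadraticForm ℝ (Matrix (Fin 2) (Fin 2) ℝ)) (γ : ℝ → SL2R) : ℝ :=
  ∫ t in (0 : ℝ)..1, √(Q (((γ t)⁻¹ : SL2R) * velocity γ t))

/-- The distance on `G` of the left-invariant Riemannian metric given by `Q`: the infimum of the
lengths of paths from `g` to `h`. -/
def riemDist (Q : QuadraticForm ℝ (Matrix (Fin 2) (Fin 2) ℝ)) (g h : SL2R) : ℝ :=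
  sInf {l : ℝ | ∃ γ : ℝ → SL2R, IsC1Path γ ∧ γ 0 = g ∧ γ 1 = h ∧ l = pathLength Q γ}

/-- A sequence `𝒟 1, 𝒟 2, …` of dyadic-like measurable partitions of `G`, with respect to a
distance `d` on `G` (`𝒟 0` plays no role). -/
def IsDyadicSystem (d : SL2R → SL2R → ℝ) (𝒟 : ℕ → Set (Set SL2R)) : Prop :=
  ∃ M : ℕ, 0 < M ∧ ∀ n : ℕ, 1 ≤ n →
    Setoid.IsPartition (𝒟 n) ∧
    (∀ D ∈ 𝒟 n, MeasurableSet D) ∧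
    (∀ E ∈ 𝒟 (n + 1), ∃ D ∈ 𝒟 n, E ⊆ D) ∧
    (∀ D ∈ 𝒟 n, {E ∈ 𝒟 (n + 1) | E ⊆ D}.encard ≤ M) ∧
    (∀ D ∈ 𝒟 n,
      (∃ g : SL2R, {h | d g h < 1 / (M : ℝ) * (1 / 2 : ℝ) ^ n} ⊆ D) ∧
      (∃ g : SL2R, D ⊆ {h | d g h < (M : ℝ) * (1 / 2 : ℝ) ^ n}))

/-- The Shannon entropy, in base `2`, of a probability measure with respect to a partition:
`H(η, 𝒜) = - ∑_{A ∈ 𝒜} η(A) log₂ η(A)`. -/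
def entropy (η : Measure SL2R) (𝒜 : Set (Set SL2R)) : ℝ :=
  - ∑' A : 𝒜, η.real (A : Set SL2R) * Real.logb 2 (η.real (A : Set SL2R))

end FurstenbergMeasure

end

open FurstenbergMeasure

open MeasureTheory Filter Topology
open scoped Matrix
open FurstenbergMeasure

noncomputable section

namespace FurstenbergMeasure

/-! ### The geometry of the projective line -/

/-! Write `χ` for the exponent in natural logarithms. The entropy formula compares two ways of
seeing `μ^{⋆n}`: through cells of `𝒟 1` in `G`, and through its action on small arcs of the
projective line.

A determinant-one matrix divides the sine distance of two lines by the product of the factors by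
which it stretches them (`dist_smul_smul`). A typical `g` for `μ^{⋆n}` stretches most lines by about
`e^{χn}`, hence squeezes them into an arc of radius about `e^{-2χn}`. Two matrices in one cell
differ by a bounded factor, so their arcs almost coincide (`dist_smul_le_of_fro_le`). Conversely, if
the arcs of two typical matrices meet, then `g⁻¹ g'` has norm at most `e^{O(εn)}`
(`fro_inv_mul_le_of_dist_le`), which leaves only `e^{O(εn)}` possible cells. Up to subexponential
errors, cells therefore correspond to arcs of radius `e^{-2χn}`. As `μ^{⋆n} × ν` is pushed to `ν`,
the mass of a typical cell is governed by the `ν`-measure of such an arc, `e^{-2χαn + o(n)}`, and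
the entropy is `2χαn + o(n)`.

This needs three inputs.

Positivity of `χ` (`IsStationaryMeasure.integral_log_stretch_pos`): compare the logarithmic energies
of `ν` and of its translates `gν`. In Fourier coefficients the energy is a nonnegative quadratic
form, so by stationarity the mean energy gain is a sum of variances; in the limit the gain is four
times the exponent. A nonpositive exponent would make `ν` invariant under the unbounded group `G_μ`,
impossible for an atomless measure.

Large deviations (`exists_largeDeviation`): positivity for all stationary measures gives, by
compactness, a drift that is uniform in the starting line, hence exponential moment bounds,
exponential contraction, and deviation bounds uniform in the line. Borel–Cantelli then gives the
almost sure growth rate and a limit point `z` of `X_0 ⋯ X_{n-1} x`, distributed by `ν`.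

Exact dimensionality (`ae_eventually_log_measure_ball`): pulling a small arc around `z` back by the
first step multiplies its `ν`-measure by nearly a fixed function of the path. The error is
controlled by differentiation along arcs, with an integrable maximal function. The ergodic theorem
for the Bernoulli shift sums these logarithms along `n` steps, after which the pulled-back ball has
subexponentially small measure only. Hence a ball of radius about `e^{-2χn}` has measure about
`e^{-nH}` and the dimension is `H / (2χ)`. -/

/-- The determinant of two plane vectors. -/
def cross (v w : Fin 2 → ℝ) : ℝ := v 0 * w 1 - v 1 * w 0

/-- The squared Euclidean norm of a plane vector. -/
def nsq (v : Fin 2 → ℝ) : ℝ := v 0 ^ 2 + v 1 ^ 2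

/-- The double-angle embedding of the projective line, on vectors. -/
def embVec (v : Fin 2 → ℝ) : ℂ := ((v 0 : ℂ) + v 1 * Complex.I) ^ 2 / (2 * (nsq v : ℂ))

/-- The double-angle embedding of the projective line as a circle of radius `1 / 2`. -/
def emb (x : RP1) : ℂ := embVec x.rep

lemma nsq_nonneg (v : Fin 2 → ℝ) : 0 ≤ nsq v := by unfold nsq; positivity

lemma nsq_pos {v : Fin 2 → ℝ} (hv : v ≠ 0) : 0 < nsq v := by
  have : v 0 ≠ 0 ∨ v 1 ≠ 0 := by
    by_contra! h
    exact hv (funext fun i => by fin_cases i <;> simp [h.1, h.2])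
  unfold nsq
  rcases this with h | h <;> positivity

lemma nsq_smul (a : ℝ) (v : Fin 2 → ℝ) : nsq (a • v) = a ^ 2 * nsq v := by
  simp [nsq]; ring

lemma embVec_re (v : Fin 2 → ℝ) : (embVec v).re = (v 0 ^ 2 - v 1 ^ 2) / (2 * nsq v) := by
  have : embVec v = (((v 0 ^ 2 - v 1 ^ 2) / (2 * nsq v) : ℝ) : ℂ) +
      ((2 * v 0 * v 1 / (2 * nsq v) : ℝ) : ℂ) * Complex.I := by
    unfold embVec
    push_cast
    rw [add_sq, mul_pow, Complex.I_sq]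
    ring
  rw [this, Complex.add_re, Complex.ofReal_re, Complex.re_ofReal_mul, Complex.I_re]
  ring

lemma embVec_im (v : Fin 2 → ℝ) : (embVec v).im = v 0 * v 1 / nsq v := by
  have : embVec v = (((v 0 ^ 2 - v 1 ^ 2) / (2 * nsq v) : ℝ) : ℂ) +
      ((v 0 * v 1 / (nsq v) : ℝ) : ℂ) * Complex.I := by
    unfold embVec
    push_cast
    rw [add_sq, mul_pow, Complex.I_sq]
    ring
  rw [this, Complex.add_im, Complex.ofReal_im, Complex.im_ofReal_mul, Complex.I_im]
  ring

lemma embVec_smul {a : ℝ} (ha : a ≠ 0) (v : Fin 2 → ℝ) : embVec (a • v) = embVec v := by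
  apply Complex.ext
  · simp only [embVec_re, nsq_smul, Pi.smul_apply, smul_eq_mul]
    rw [← mul_div_mul_left (v 0 ^ 2 - v 1 ^ 2) _ (pow_ne_zero 2 ha)]
    ring_nf
  · simp only [embVec_im, nsq_smul, Pi.smul_apply, smul_eq_mul]
    rw [← mul_div_mul_left (v 0 * v 1) _ (pow_ne_zero 2 ha)]
    ring_nf

lemma exists_rep_smul {v : Fin 2 → ℝ} (hv : v ≠ 0) :
    ∃ a : ℝ, a ≠ 0 ∧ (Projectivization.mk ℝ v hv).rep = a • v := by
  obtain ⟨a, ha⟩ := Projectivization.exists_smul_eq_mk_rep ℝ v hv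
  exact ⟨a, a.ne_zero, ha.symm⟩

@[simp] lemma emb_mk {v : Fin 2 → ℝ} (hv : v ≠ 0) : emb (Projectivization.mk ℝ v hv) = embVec v := by
  obtain ⟨a, ha, h⟩ := exists_rep_smul hv
  rw [emb, h, embVec_smul ha]

lemma continuous_emb : Continuous emb := by
  refine continuous_coinduced_dom.2 ?_
  have : emb ∘ Projectivization.mk' ℝ (V := Fin 2 → ℝ) = fun v => embVec v.1 := by
    ext v; exact emb_mk v.2
  rw [this]
  unfold embVec nsq
  have h (i : Fin 2) : Continuous fun v : {v : Fin 2 → ℝ // v ≠ 0} => v.1 i :=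
    (continuous_apply i).comp continuous_subtype_val
  have h' (i : Fin 2) : Continuous fun v : {v : Fin 2 → ℝ // v ≠ 0} => (v.1 i : ℂ) :=
    Complex.continuous_ofReal.comp (h i)
  refine Continuous.div (((h' 0).add ((h' 1).mul continuous_const)).pow 2)
    (continuous_const.mul (Complex.continuous_ofReal.comp (((h 0).pow 2).add ((h 1).pow 2))))
    fun v => ?_
  have := (nsq_pos v.2).ne'
  unfold nsq at this
  exact mul_ne_zero two_ne_zero (by exact_mod_cast this)

/-- Doubling angles on a circle of radius `1 / 2` turns a chord into `|e^{2ia} - e^{2ib}| / 2 = |sin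
(a - b)|`. The triangle inequality for the sine of the angle thus comes for free from `ℂ`. -/
lemma dist_embVec_sq {v w : Fin 2 → ℝ} (hv : v ≠ 0) (hw : w ≠ 0) :
    dist (embVec v) (embVec w) ^ 2 = cross v w ^ 2 / (nsq v * nsq w) := by
  have hv' := (nsq_pos hv).ne'
  have hw' := (nsq_pos hw).ne'
  rw [Complex.dist_eq, Complex.sq_norm, Complex.normSq_apply, Complex.sub_re, Complex.sub_im,
    embVec_re, embVec_re, embVec_im, embVec_im]
  field_simp
  unfold nsq cross
  ring

lemma norm_embVec {v : Fin 2 → ℝ} (hv : v ≠ 0) : ‖embVec v‖ = 1 / 2 := by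
  have hv' := (nsq_pos hv).ne'
  have : ‖embVec v‖ ^ 2 = (1 / 2) ^ 2 := by
    rw [Complex.sq_norm, Complex.normSq_apply, embVec_re, embVec_im]
    field_simp
    unfold nsq
    ring
  exact (pow_left_inj₀ (norm_nonneg _) (by norm_num) two_ne_zero).1 this

lemma norm_emb (x : RP1) : ‖emb x‖ = 1 / 2 := norm_embVec x.rep_nonzero

lemma mk_eq_mk_iff_cross {v w : Fin 2 → ℝ} (hv : v ≠ 0) (hw : w ≠ 0) :
    Projectivization.mk ℝ v hv = Projectivization.mk ℝ w hw ↔ cross v w = 0 := by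
  rw [Projectivization.mk_eq_mk_iff']
  constructor
  · rintro ⟨a, rfl⟩
    simp [cross]; ring
  · intro h
    have hw' := (nsq_pos hw).ne'
    refine ⟨(v 0 * w 0 + v 1 * w 1) / nsq w, funext fun i => ?_⟩
    unfold cross at h
    have h2 : v 0 * w 1 = v 1 * w 0 := by linarith
    fin_cases i
    · simp only [Fin.zero_eta, Pi.smul_apply, smul_eq_mul]
      field_simp
      unfold nsq
      linear_combination -(w 1) * h2
    · simp only [Fin.mk_one, Pi.smul_apply, smul_eq_mul]
      field_simp
      unfold nsq
      linear_combination (w 0) * h2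

lemma emb_injective : Function.Injective emb := by
  intro x y h
  have h2 := dist_embVec_sq x.rep_nonzero y.rep_nonzero
  rw [show embVec x.rep = embVec y.rep from h, dist_self] at h2
  have h3 : cross x.rep y.rep = 0 := by
    have := mul_pos (nsq_pos x.rep_nonzero) (nsq_pos y.rep_nonzero)
    rw [eq_comm, div_eq_iff this.ne'] at h2
    simpa using h2
  rw [← x.mk_rep, ← y.mk_rep]
  exact (mk_eq_mk_iff_cross _ _).2 h3

lemma continuous_mk' : Continuous (Projectivization.mk' ℝ (V := Fin 2 → ℝ)) :=
  continuous_coinduced_rng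

instance instCompactSpaceRP1 : CompactSpace RP1 := by
  let c : Circle → {v : Fin 2 → ℝ // v ≠ 0} := fun z => ⟨![(z : ℂ).re, (z : ℂ).im], by
    intro h
    have h0 := congrFun h 0
    have h1 := congrFun h 1
    simp at h0 h1
    exact z.coe_ne_zero (Complex.ext h0 h1)⟩
  have hc : Continuous c := by
    refine Continuous.subtype_mk (continuous_pi fun i => ?_) _
    fin_cases i
    · exact Complex.continuous_re.comp continuous_subtype_val
    · exact Complex.continuous_im.comp continuous_subtype_val
  have hs : Function.Surjective (Projectivization.mk' ℝ ∘ c) := by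
    intro x
    let v := x.rep
    have hn : 0 < √(nsq v) := Real.sqrt_pos.2 (nsq_pos x.rep_nonzero)
    have hn2 : √(nsq v) ^ 2 = nsq v := Real.sq_sqrt (nsq_nonneg _)
    let z : ℂ := ⟨v 0 / √(nsq v), v 1 / √(nsq v)⟩
    have hz : z ∈ Submonoid.unitSphere ℂ := by
      rw [Submonoid.unitSphere, ← SetLike.mem_coe]
      change z ∈ Metric.sphere (0 : ℂ) 1
      rw [mem_sphere_zero_iff_norm, ← pow_left_inj₀ (norm_nonneg _) zero_le_one two_ne_zero,
        Complex.sq_norm, Complex.normSq_apply]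
      have : (nsq v) ≠ 0 := (nsq_pos x.rep_nonzero).ne'
      simp only [z]
      field_simp
      rw [hn2]; unfold nsq; ring
    refine ⟨⟨z, hz⟩, ?_⟩
    rw [← x.mk_rep]
    refine (mk_eq_mk_iff_cross (c ⟨z, hz⟩).2 x.rep_nonzero).2 ?_
    simp only [c, z, cross]
    simp [v]
    ring
  exact ⟨by
    rw [← hs.range_eq]
    exact isCompact_range (continuous_mk'.comp hc)⟩

/-- A continuous injection of a compact space into a Hausdorff one is an embedding, so the metric
pulled back from `ℂ` induces the quotient topology on the projective line. -/
lemma isEmbedding_emb : IsEmbedding emb := by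
  have : T2Space RP1 := T2Space.of_injective_continuous emb_injective continuous_emb
  exact (continuous_emb.isClosedEmbedding emb_injective).isEmbedding

/-- The distance on the projective line given by the sine of the angle between two lines. -/
instance instMetricSpaceRP1 : MetricSpace RP1 := isEmbedding_emb.comapMetricSpace emb

lemma dist_eq_emb (x y : RP1) : dist x y = dist (emb x) (emb y) := rfl

lemma dist_mk {v w : Fin 2 → ℝ} (hv : v ≠ 0) (hw : w ≠ 0) :
    dist (Projectivization.mk ℝ v hv) (Projectivization.mk ℝ w hw) =
      |cross v w| / (√(nsq v) * √(nsq w)) := by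
  rw [dist_eq_emb, emb_mk, emb_mk, ← Real.sqrt_sq dist_nonneg, dist_embVec_sq hv hw,
    Real.sqrt_div (sq_nonneg _), Real.sqrt_sq_eq_abs, Real.sqrt_mul (nsq_nonneg _)]

lemma dist_eq_cross (x y : RP1) :
    dist x y = |cross x.rep y.rep| / (√(nsq x.rep) * √(nsq y.rep)) := by
  conv_lhs => rw [← x.mk_rep, ← y.mk_rep]
  exact dist_mk _ _

lemma dist_le_one (x y : RP1) : dist x y ≤ 1 := by
  rw [dist_eq_emb]
  refine (dist_le_norm_add_norm _ _).trans ?_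
  rw [norm_emb, norm_emb]; norm_num

/-! ### The action of `SL₂(ℝ)` -/

lemma det_entries (g : SL2R) : g 0 0 * g 1 1 - g 0 1 * g 1 0 = 1 := by
  have := g.2
  rwa [Matrix.det_fin_two] at this

lemma smul_vec_zero (g : SL2R) (v : Fin 2 → ℝ) : (g • v) 0 = g 0 0 * v 0 + g 0 1 * v 1 := by
  change ((g : Matrix (Fin 2) (Fin 2) ℝ) *ᵥ v) 0 = _
  simp [Matrix.mulVec, dotProduct, Fin.sum_univ_two]

lemma smul_vec_one (g : SL2R) (v : Fin 2 → ℝ) : (g • v) 1 = g 1 0 * v 0 + g 1 1 * v 1 := by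
  change ((g : Matrix (Fin 2) (Fin 2) ℝ) *ᵥ v) 1 = _
  simp [Matrix.mulVec, dotProduct, Fin.sum_univ_two]

lemma cross_smul (g : SL2R) (v w : Fin 2 → ℝ) : cross (g • v) (g • w) = cross v w := by
  have := det_entries g
  simp only [cross, smul_vec_zero, smul_vec_one]
  linear_combination (v 0 * w 1 - v 1 * w 0) * this

/-- The factor by which `g` stretches the vectors in the line `x`. -/
def stretch (g : SL2R) (x : RP1) : ℝ := √(nsq (g • x.rep) / nsq x.rep)

lemma smul_vec_ne_zero (g : SL2R) {v : Fin 2 → ℝ} (hv : v ≠ 0) : g • v ≠ 0 :=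
  (smul_ne_zero_iff_ne g).2 hv

lemma smul_smul_vec (g : SL2R) (a : ℝ) (v : Fin 2 → ℝ) : g • (a • v) = a • (g • v) :=
  smul_comm _ _ _

lemma stretch_mk (g : SL2R) {v : Fin 2 → ℝ} (hv : v ≠ 0) :
    stretch g (Projectivization.mk ℝ v hv) = √(nsq (g • v) / nsq v) := by
  obtain ⟨a, ha, h⟩ := exists_rep_smul hv
  rw [stretch, h, smul_smul_vec, nsq_smul, nsq_smul, mul_div_mul_left _ _ (pow_ne_zero 2 ha)]

lemma stretch_pos (g : SL2R) (x : RP1) : 0 < stretch g x :=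
  Real.sqrt_pos.2 (div_pos (nsq_pos (smul_vec_ne_zero g x.rep_nonzero)) (nsq_pos x.rep_nonzero))

lemma stretch_one (x : RP1) : stretch 1 x = 1 := by
  rw [stretch, one_smul, div_self (nsq_pos x.rep_nonzero).ne', Real.sqrt_one]

lemma smul_eq_mk (g : SL2R) (x : RP1) :
    g • x = Projectivization.mk ℝ (g • x.rep) (smul_vec_ne_zero g x.rep_nonzero) := by
  conv_lhs => rw [← x.mk_rep]
  rfl

lemma stretch_mul (g h : SL2R) (x : RP1) : stretch (g * h) x = stretch g (h • x) * stretch h x := by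
  have h1 := (nsq_pos x.rep_nonzero).ne'
  have h2 := (nsq_pos (smul_vec_ne_zero h x.rep_nonzero)).ne'
  rw [smul_eq_mk h x, stretch_mk, stretch, stretch,
    ← Real.sqrt_mul (div_nonneg (nsq_nonneg _) (nsq_nonneg _)), mul_smul,
    div_mul_div_cancel₀ h2]

lemma stretch_inv_smul (g : SL2R) (x : RP1) : stretch g⁻¹ (g • x) = (stretch g x)⁻¹ := by
  have := stretch_mul g⁻¹ g x
  rw [inv_mul_cancel, stretch_one] at this
  exact eq_inv_of_mul_eq_one_left this.symm

/-- The determinant of two vectors is unchanged by `g`; only the normalising lengths change. All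
contraction estimates below rest on this identity. -/
lemma dist_smul_smul (g : SL2R) (x y : RP1) :
    dist (g • x) (g • y) = dist x y / (stretch g x * stretch g y) := by
  have h1 := (nsq_pos x.rep_nonzero)
  have h2 := (nsq_pos y.rep_nonzero)
  have h3 := (nsq_pos (smul_vec_ne_zero g x.rep_nonzero))
  have h4 := (nsq_pos (smul_vec_ne_zero g y.rep_nonzero))
  rw [smul_eq_mk, smul_eq_mk, dist_mk, cross_smul, dist_eq_cross, stretch, stretch,
    Real.sqrt_div h3.le, Real.sqrt_div h4.le]
  have := Real.sqrt_pos.2 h1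
  have := Real.sqrt_pos.2 h2
  have := Real.sqrt_pos.2 h3
  have := Real.sqrt_pos.2 h4
  field_simp

/-- The Frobenius norm. -/
def fro (g : SL2R) : ℝ := √(g 0 0 ^ 2 + g 0 1 ^ 2 + g 1 0 ^ 2 + g 1 1 ^ 2)

lemma fro_sq (g : SL2R) : fro g ^ 2 = g 0 0 ^ 2 + g 0 1 ^ 2 + g 1 0 ^ 2 + g 1 1 ^ 2 :=
  Real.sq_sqrt (by positivity)

lemma inv_entries (g : SL2R) : g⁻¹ 0 0 = g 1 1 ∧ g⁻¹ 0 1 = - g 0 1 ∧ g⁻¹ 1 0 = - g 1 0 ∧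
    g⁻¹ 1 1 = g 0 0 := by
  simp [Matrix.SpecialLinearGroup.coe_inv, Matrix.adjugate_fin_two]

lemma fro_inv (g : SL2R) : fro g⁻¹ = fro g := by
  obtain ⟨h1, h2, h3, h4⟩ := inv_entries g
  unfold fro
  rw [h1, h2, h3, h4]
  ring_nf

lemma one_le_fro (g : SL2R) : 1 ≤ fro g := by
  have h := det_entries g
  unfold fro
  rw [Real.one_le_sqrt]
  nlinarith [sq_nonneg (g 0 0 - g 1 1), sq_nonneg (g 0 1 + g 1 0)]

lemma fro_pos (g : SL2R) : 0 < fro g := zero_lt_one.trans_le (one_le_fro g)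

lemma nsq_smul_le (g : SL2R) (v : Fin 2 → ℝ) : nsq (g • v) ≤ fro g ^ 2 * nsq v := by
  rw [fro_sq]
  simp only [nsq, smul_vec_zero, smul_vec_one]
  nlinarith [sq_nonneg (g 0 0 * v 1 - g 0 1 * v 0), sq_nonneg (g 1 0 * v 1 - g 1 1 * v 0)]

lemma stretch_le_fro (g : SL2R) (x : RP1) : stretch g x ≤ fro g := by
  have h1 := (nsq_pos x.rep_nonzero)
  rw [stretch, Real.sqrt_le_left (fro_pos g).le, div_le_iff₀ h1]
  exact nsq_smul_le g _

lemma inv_fro_le_stretch (g : SL2R) (x : RP1) : (fro g)⁻¹ ≤ stretch g x := by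
  have h := stretch_le_fro g⁻¹ (g • x)
  rw [stretch_inv_smul, fro_inv] at h
  exact inv_le_of_inv_le₀ (stretch_pos g x) h

lemma mul_entry (g h : SL2R) (i j : Fin 2) : (g * h) i j = g i 0 * h 0 j + g i 1 * h 1 j := by
  simp [Matrix.SpecialLinearGroup.coe_mul, Matrix.mul_apply, Fin.sum_univ_two]

lemma fro_mul_le (g h : SL2R) : fro (g * h) ≤ fro g * fro h := by
  refine le_of_sq_le_sq ?_ (mul_nonneg (fro_pos g).le (fro_pos h).le)
  rw [mul_pow, fro_sq, fro_sq, fro_sq, mul_entry, mul_entry, mul_entry, mul_entry]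
  nlinarith [sq_nonneg (g 0 0 * h 1 0 - g 0 1 * h 0 0), sq_nonneg (g 0 0 * h 1 1 - g 0 1 * h 0 1),
    sq_nonneg (g 1 0 * h 1 0 - g 1 1 * h 0 0), sq_nonneg (g 1 0 * h 1 1 - g 1 1 * h 0 1)]

/-- The square of the stretch as an affine function of the embedding. -/
def stretchSq (g : SL2R) (z : ℂ) : ℝ :=
  (g 0 0 ^ 2 + g 1 0 ^ 2) * (1 / 2 + z.re) + (g 0 1 ^ 2 + g 1 1 ^ 2) * (1 / 2 - z.re) +
    2 * (g 0 0 * g 0 1 + g 1 0 * g 1 1) * z.im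

lemma stretch_sq (g : SL2R) (x : RP1) : stretch g x ^ 2 = stretchSq g (emb x) := by
  have h1 := (nsq_pos x.rep_nonzero).ne'
  rw [stretch, Real.sq_sqrt (div_nonneg (nsq_nonneg _) (nsq_nonneg _)), emb, stretchSq, embVec_re,
    embVec_im]
  field_simp
  simp only [nsq, smul_vec_zero, smul_vec_one]
  ring

lemma continuous_entry (i j : Fin 2) : Continuous fun g : SL2R => g i j :=
  (continuous_apply_apply i j).comp continuous_subtype_val

lemma continuous_stretch : Continuous fun p : SL2R × RP1 => stretch p.1 p.2 := by
  have h : (fun p : SL2R × RP1 => stretch p.1 p.2) = fun p => √(stretchSq p.1 (emb p.2)) := by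
    ext p
    rw [← stretch_sq, Real.sqrt_sq (stretch_pos _ _).le]
  rw [h]
  unfold stretchSq
  have h2 := continuous_emb
  have := fun i j => continuous_entry i j
  fun_prop

lemma continuous_fro : Continuous fro := by
  unfold fro
  have := fun i j => continuous_entry i j
  fun_prop

/-- With the columns of `g` read as complex numbers `a, b`, the vector `g v` is `v₀ a + v₁ b`. Its
square expands into `v₀²`, `v₁²` and `v₀ v₁`, which divided by `nsq v` are affine in `emb`. The
formula makes the joint continuity of the action visible. -/
lemma emb_smul (g : SL2R) (x : RP1) : emb (g • x) =
    ((g 0 0 + g 1 0 * Complex.I) ^ 2 * (1 / 2 + (emb x).re) +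
     (g 0 1 + g 1 1 * Complex.I) ^ 2 * (1 / 2 - (emb x).re) +
     2 * (g 0 0 + g 1 0 * Complex.I) * (g 0 1 + g 1 1 * Complex.I) * (emb x).im) /
     (2 * (stretch g x : ℂ) ^ 2) := by
  have h1 := (nsq_pos x.rep_nonzero).ne'
  have h3 := (nsq_pos (smul_vec_ne_zero g x.rep_nonzero)).ne'
  have h1' : (nsq x.rep : ℂ) ≠ 0 := by exact_mod_cast h1
  have h3' : (nsq (g • x.rep) : ℂ) ≠ 0 := by exact_mod_cast h3
  have h2 : (stretch g x : ℂ) ^ 2 = nsq (g • x.rep) / nsq x.rep := by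
    rw [← Complex.ofReal_pow, stretch, Real.sq_sqrt (div_nonneg (nsq_nonneg _) (nsq_nonneg _))]
    push_cast; rfl
  rw [smul_eq_mk, emb_mk, h2, embVec, emb, embVec_re, embVec_im]
  push_cast
  field_simp
  rw [smul_vec_zero, smul_vec_one, nsq]
  push_cast
  ring

instance instContinuousSMulRP1 : ContinuousSMul SL2R RP1 := by
  refine ⟨isEmbedding_emb.continuous_iff.2 ?_⟩
  have h : (emb ∘ fun p : SL2R × RP1 => p.1 • p.2) = fun p => emb (p.1 • p.2) := rfl
  rw [h]
  simp_rw [emb_smul]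
  have h2 := continuous_emb
  have h3 := continuous_stretch
  have := fun i j => continuous_entry i j
  refine Continuous.div ?_ ?_ ?_
  · fun_prop
  · fun_prop
  · intro p
    have := (stretch_pos p.1 p.2).ne'
    exact mul_ne_zero two_ne_zero (pow_ne_zero 2 (by exact_mod_cast this))

instance instSecondCountableSL2R : SecondCountableTopology SL2R :=
  have : SecondCountableTopology (Matrix (Fin 2) (Fin 2) ℝ) :=
    inferInstanceAs (SecondCountableTopology (Fin 2 → Fin 2 → ℝ))
  TopologicalSpace.Subtype.secondCountableTopology {A : Matrix (Fin 2) (Fin 2) ℝ | A.det = 1}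

instance instSecondCountableRP1 : SecondCountableTopology RP1 := inferInstance

instance instMeasurableSMul₂ : MeasurableSMul₂ SL2R RP1 := ⟨continuous_smul.measurable⟩

instance instMeasurableMul₂SL2R : MeasurableMul₂ SL2R := ⟨continuous_mul.measurable⟩

end FurstenbergMeasure
end

open MeasureTheory Filter Topology
open scoped Matrix
open FurstenbergMeasure

set_option linter.unusedSectionVars false

noncomputable section

namespace FurstenbergMeasure

open scoped ENNReal Pointwise

/-! ### Finitely supported measures and stationary measures -/

/-- The measure is carried by a finite set. -/
def FinSupp {α : Type*} [MeasurableSpace α] (m : Measure α) : Prop :=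
  ∃ T : Finset α, m (T : Set α)ᶜ = 0

namespace FinSupp

variable {α β : Type*} [MeasurableSpace α] [MeasurableSingletonClass α] [MeasurableSpace β]
  [MeasurableSingletonClass β] {m : Measure α} {m' : Measure β}

lemma restrict_eq {T : Finset α} (hT : m (T : Set α)ᶜ = 0) : m.restrict T = m :=
  Measure.restrict_eq_self_of_ae_mem (by rwa [← mem_ae_iff] at hT)

lemma integrable [IsFiniteMeasure m] (h : FinSupp m) (f : α → ℝ) : Integrable f m := by
  obtain ⟨T, hT⟩ := h
  rw [← restrict_eq hT]
  change IntegrableOn f T m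
  have : (T : Set α) = ⋃ a ∈ T, {a} := by ext; simp
  rw [this, integrableOn_finset_iUnion]
  exact fun a _ => integrableOn_singleton (by simp)

lemma integral_eq_sum [IsFiniteMeasure m] {T : Finset α} (hT : m (T : Set α)ᶜ = 0) (f : α → ℝ) :
    ∫ a, f a ∂m = ∑ a ∈ T, m.real {a} * f a := by
  have h : FinSupp m := ⟨T, hT⟩
  conv_lhs => rw [← restrict_eq hT]
  rw [setIntegral_finset _ (h.integrable f).integrableOn]
  rfl

lemma prod [IsFiniteMeasure m] [IsFiniteMeasure m'] (h : FinSupp m) (h' : FinSupp m') :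
    FinSupp (m.prod m') := by
  obtain ⟨T, hT⟩ := h
  obtain ⟨T', hT'⟩ := h'
  refine ⟨T ×ˢ T', ?_⟩
  have : ((T ×ˢ T' : Finset (α × β)) : Set (α × β))ᶜ ⊆
      ((T : Set α)ᶜ ×ˢ Set.univ) ∪ (Set.univ ×ˢ (T' : Set β)ᶜ) := by
    rintro ⟨a, b⟩ hab
    simp only [Finset.coe_product, Set.mem_compl_iff, Set.mem_prod, not_and_or] at hab
    simpa using hab
  refine measure_mono_null this (measure_union_null ?_ ?_)
  · rw [Measure.prod_prod, hT, zero_mul]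
  · rw [Measure.prod_prod, hT', mul_zero]

lemma map (h : FinSupp m) {f : α → β} (hf : Measurable f) : FinSupp (m.map f) := by
  classical
  obtain ⟨T, hT⟩ := h
  refine ⟨T.image f, ?_⟩
  rw [Measure.map_apply hf (Finset.measurableSet _).compl]
  refine measure_mono_null (Set.compl_subset_compl.2 fun a ha => ?_) hT
  simp only [Finset.coe_image]
  exact ⟨a, ha, rfl⟩

lemma ae_iff [IsFiniteMeasure m] (h : FinSupp m) {p : α → Prop} :
    (∀ᵐ a ∂m, p a) ↔ ∀ a, m {a} ≠ 0 → p a := by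
  constructor
  · intro hp a ha
    by_contra hpa
    exact ha (measure_mono_null (by simpa using hpa) hp)
  · intro hp
    obtain ⟨T, hT⟩ := h
    have : {a | ¬ p a} ⊆ (T : Set α)ᶜ ∪ ⋃ a ∈ (T.filter fun a => m {a} = 0 : Finset α), {a} := by
      intro a ha
      by_cases haT : a ∈ T
      · right
        have : m {a} = 0 := by
          by_contra h0
          exact ha (hp a h0)
        simp [haT, this]
      · left; exact haT
    refine measure_mono_null this (measure_union_null hT ?_)
    refine (measure_biUnion_null_iff (Finset.countable_toSet _)).2 fun a ha => ?_
    simpa using (Finset.mem_filter.1 ha).2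

end FinSupp

section SL2

variable {μ : Measure SL2R} [IsProbabilityMeasure μ]

lemma finSupp_of_support_finite (h : μ.support.Finite) : FinSupp μ :=
  ⟨h.toFinset, by rw [Set.Finite.coe_toFinset]; exact Measure.measure_compl_support⟩

lemma measure_singleton_ne_zero_of_mem_support (h : μ.support.Finite) {g : SL2R}
    (hg : g ∈ μ.support) : μ {g} ≠ 0 := by
  intro h0
  have hfin : (μ.support \ {g}).Finite := h.subset Set.sdiff_subset
  have hU : (μ.support \ {g})ᶜ ∈ 𝓝 g := hfin.isClosed.isOpen_compl.mem_nhds (by simp)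
  have h1 := (Measure.mem_support_iff_forall g).1 hg _ hU
  have h2 : (μ.support \ {g})ᶜ ⊆ (μ.support)ᶜ ∪ {g} := by
    intro x hx
    by_cases hxg : x = g
    · right; exact hxg
    · left; intro hxs; exact hx ⟨hxs, hxg⟩
  exact h1.ne' (measure_mono_null h2 (measure_union_null Measure.measure_compl_support h0))

instance instIsProbabilityMeasureConvPow (n : ℕ) : IsProbabilityMeasure (convPow μ n) := by
  induction n with
  | zero => unfold convPow; infer_instance
  | succ n ih => unfold convPow; infer_instance

lemma convPow_zero : convPow μ 0 = Measure.dirac 1 := rfl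

lemma convPow_succ (n : ℕ) : convPow μ (n + 1) = (convPow μ n).mconv μ := rfl

lemma convPow_one : convPow μ 1 = μ := by
  rw [convPow_succ, convPow_zero, Measure.dirac_one_mconv]

lemma convPow_add (m n : ℕ) : convPow μ (m + n) = (convPow μ m).mconv (convPow μ n) := by
  induction n with
  | zero => rw [Nat.add_zero, convPow_zero, Measure.mconv_dirac_one]
  | succ n ih => rw [← Nat.add_assoc, convPow_succ, ih, convPow_succ, Measure.mconv_assoc]

lemma convPow_succ' (n : ℕ) : convPow μ (n + 1) = μ.mconv (convPow μ n) := by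
  rw [Nat.add_comm, convPow_add, convPow_one]

lemma finSupp_mconv {m m' : Measure SL2R} [IsFiniteMeasure m] [IsFiniteMeasure m']
    (h : FinSupp m) (h' : FinSupp m') : FinSupp (m.mconv m') :=
  (h.prod h').map measurable_mul

lemma finSupp_convPow (h : FinSupp μ) (n : ℕ) : FinSupp (convPow μ n) := by
  induction n with
  | zero => exact ⟨{1}, by simp [convPow_zero]⟩
  | succ n ih => exact finSupp_mconv ih h

lemma integral_mconv {m m' : Measure SL2R} [IsFiniteMeasure m] [IsFiniteMeasure m']
    (h : FinSupp m) (h' : FinSupp m') (f : SL2R → ℝ) :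
    ∫ g, f g ∂(m.mconv m') = ∫ g, ∫ g', f (g * g') ∂m' ∂m := by
  have hi := (finSupp_mconv h h').integrable f
  unfold Measure.mconv at hi ⊢
  rw [integral_map measurable_mul.aemeasurable hi.aestronglyMeasurable,
    integral_prod _ ((h.prod h').integrable _)]

lemma integral_convPow_add (h : FinSupp μ) (m n : ℕ) (f : SL2R → ℝ) :
    ∫ g, f g ∂(convPow μ (m + n)) = ∫ g, ∫ g', f (g * g') ∂(convPow μ n) ∂(convPow μ m) := by
  rw [convPow_add, integral_mconv (finSupp_convPow h m) (finSupp_convPow h n)]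

lemma integral_integral_swap_finSupp {α X : Type*} [MeasurableSpace α] [MeasurableSingletonClass α]
    [MeasurableSpace X] {m : Measure α} [IsFiniteMeasure m] (h : FinSupp m) {ν : Measure X}
    {F : α → X → ℝ} (hF : ∀ g, Integrable (F g) ν) :
    ∫ g, ∫ x, F g x ∂ν ∂m = ∫ x, ∫ g, F g x ∂m ∂ν := by
  obtain ⟨T, hT⟩ := h
  simp_rw [FinSupp.integral_eq_sum hT]
  rw [integral_finsetSum _ fun g _ => (hF g).const_mul _]
  simp_rw [integral_const_mul]

variable {ν : Measure RP1}

lemma measurable_act : Measurable fun p : SL2R × RP1 => p.1 • p.2 := continuous_smul.measurable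

lemma IsStationaryMeasure.lintegral (h : IsStationaryMeasure μ ν) [SFinite ν] {f : RP1 → ℝ≥0∞}
    (hf : Measurable f) : ∫⁻ g, ∫⁻ x, f (g • x) ∂ν ∂μ = ∫⁻ x, f x ∂ν := by
  conv_rhs => rw [← h]
  rw [lintegral_map hf measurable_act, lintegral_prod _ (by fun_prop)]

lemma isStationaryMeasure_of_lintegral [SFinite ν]
    (h : ∀ f : RP1 → ℝ≥0∞, Measurable f → ∫⁻ g, ∫⁻ x, f (g • x) ∂ν ∂μ = ∫⁻ x, f x ∂ν) :
    IsStationaryMeasure μ ν := by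
  refine Measure.ext_of_lintegral _ fun f hf => ?_
  rw [← h f hf, lintegral_map hf measurable_act, lintegral_prod _ (by fun_prop)]

lemma IsStationaryMeasure.convPow (h : IsStationaryMeasure μ ν) [SFinite ν] (n : ℕ) :
    IsStationaryMeasure (convPow μ n) ν := by
  refine isStationaryMeasure_of_lintegral fun f hf => ?_
  induction n with
  | zero =>
    rw [convPow_zero, lintegral_dirac]
    simp
  | succ n ih =>
    have hm : Measurable fun g : SL2R => ∫⁻ x, f (g • x) ∂ν :=
      (hf.comp measurable_act).lintegral_prod_right'
    rw [convPow_succ, Measure.lintegral_mconv hm, ← ih]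
    refine lintegral_congr fun g => ?_
    simp_rw [mul_smul]
    exact h.lintegral (f := fun x => f (g • x)) (by fun_prop)

lemma IsStationaryMeasure.measure_eq (h : IsStationaryMeasure μ ν) [SFinite ν] {E : Set RP1}
    (hE : MeasurableSet E) : ν E = ∫⁻ g, ν ((fun x => g • x) ⁻¹' E) ∂μ := by
  conv_lhs => rw [← h, Measure.map_apply measurable_act hE,
    Measure.prod_apply (measurable_act hE)]
  rfl

lemma IsStationaryMeasure.measureReal_eq (h : IsStationaryMeasure μ ν) [IsFiniteMeasure ν]
    {E : Set RP1} (hE : MeasurableSet E) :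
    ν.real E = ∫ g, ν.real ((fun x => g • x) ⁻¹' E) ∂μ := by
  have hm : Measurable fun g : SL2R => ν ((fun x => g • x) ⁻¹' E) :=
    measurable_measure_prodMk_left (measurable_act hE)
  rw [measureReal_def, h.measure_eq hE, ← integral_toReal hm.aemeasurable
    (ae_of_all _ fun _ => measure_lt_top _ _)]
  rfl

lemma integrable_of_continuous [IsFiniteMeasure ν] {f : RP1 → ℝ} (hf : Continuous f) :
    Integrable f ν := by
  obtain ⟨C, hC⟩ := isCompact_univ.exists_bound_of_continuousOn hf.continuousOn
  exact Integrable.of_bound hf.aestronglyMeasurable C (ae_of_all _ fun x => hC x (Set.mem_univ x))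

lemma IsStationaryMeasure.integral (h : IsStationaryMeasure μ ν) [IsProbabilityMeasure ν]
    {f : RP1 → ℝ} (hf : Continuous f) : ∫ g, ∫ x, f (g • x) ∂ν ∂μ = ∫ x, f x ∂ν := by
  conv_rhs => rw [← h]
  obtain ⟨C, hC⟩ := isCompact_univ.exists_bound_of_continuousOn hf.continuousOn
  rw [integral_map measurable_act.aemeasurable hf.aestronglyMeasurable, integral_prod]
  exact Integrable.of_bound (hf.comp continuous_smul).aestronglyMeasurable C
    (ae_of_all _ fun x => hC _ (Set.mem_univ _))

/-- For a finite set one inclusion per generator suffices, since a bijection cannot map it onto a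
proper superset or subset of the same cardinality. -/
lemma closure_le_stabilizer_of_finite (hfin : μ.support.Finite) {S : Set RP1} (hS : S.Finite)
    (h : ∀ g, μ {g} ≠ 0 → ∀ x ∈ S, g⁻¹ • x ∈ S) :
    generatedGroup μ ≤ MulAction.stabilizer SL2R S := by
  refine (Subgroup.closure_le _).2 fun g hg => ?_
  rw [SetLike.mem_coe, MulAction.mem_stabilizer_set_iff_subset_smul_set hS]
  intro x hx
  rw [Set.mem_smul_set_iff_inv_smul_mem]
  exact h g (measure_singleton_ne_zero_of_mem_support hfin hg) x hx

/-- A finite measure has only finitely many atoms above a given positive mass, so the largest mass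
is attained, and by finitely many points. -/
lemma exists_max_atoms {X : Type*} [MeasurableSpace X] [MeasurableSingletonClass X]
    {θ : Measure X} [IsFiniteMeasure θ] {x : X} (hx : θ {x} ≠ 0) :
    ∃ a : ℝ, {y | θ.real {y} = a}.Finite ∧ {y | θ.real {y} = a}.Nonempty ∧
      ∀ y, θ.real {y} ≤ a := by
  have hfin : {y | θ {x} ≤ θ {y}}.Finite :=
    Measure.finite_const_le_meas_of_disjoint_iUnion θ (pos_iff_ne_zero.2 hx)
      (fun y => measurableSet_singleton y) (fun a b hab => by simpa using hab) (measure_ne_top _ _)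
  have hfin' : {y | θ.real {x} ≤ θ.real {y}}.Finite := by
    refine hfin.subset fun y hy => ?_
    exact (ENNReal.toReal_le_toReal (measure_ne_top _ _) (measure_ne_top _ _)).1 hy
  obtain ⟨y, hy, hmax⟩ := hfin'.exists_maximalFor (fun y => θ.real {y}) _ ⟨x, le_refl (θ.real {x})⟩
  have hmax' : ∀ z, θ.real {z} ≤ θ.real {y} := by
    intro z
    by_cases hz : θ.real {x} ≤ θ.real {z}
    · by_contra! h
      exact absurd (hmax hz h.le) (not_le.2 h)
    · exact (not_le.1 hz).le.trans hy
  refine ⟨θ.real {y}, ?_, ⟨y, rfl⟩, hmax'⟩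
  exact hfin'.subset fun z hz => (show θ.real {x} ≤ θ.real {y} from hy).trans (le_of_eq hz.symm)

/-- A stationary measure of a totally irreducible system has no atoms. -/
lemma IsStationaryMeasure.nullSingletonClass (hfin : μ.support.Finite)
    (hirr : IsTotallyIrreducible (generatedGroup μ)) [IsProbabilityMeasure ν]
    (hν : IsStationaryMeasure μ ν) : NullSingletonClass ν := by
  refine ⟨fun x => ?_⟩
  by_contra hx
  obtain ⟨a, hSf, hSne, hmax⟩ := exists_max_atoms hx
  refine hirr ⟨_, hSf, hSne, fun g hg y hy => ?_⟩
  have hle : generatedGroup μ ≤ MulAction.stabilizer SL2R {y | ν.real {y} = a} := by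
    refine closure_le_stabilizer_of_finite hfin hSf fun g hg y hy => ?_
    have hμ := finSupp_of_support_finite hfin
    have hpre : ∀ g : SL2R, (fun x => g • x) ⁻¹' {y} = {g⁻¹ • y} := by
      intro g; ext z; simp [eq_inv_smul_iff]
    have h1 := hν.measureReal_eq (measurableSet_singleton y)
    simp_rw [hpre, show ν.real {y} = a from hy] at h1
    -- The maximal mass `a` at `y` is the `μ`-average of the masses at `g⁻¹ y`, none of which
    -- exceeds `a`; hence all are equal to `a` and the finite set of heaviest atoms is invariant.
    have h3 : ∫ g, (a - ν.real {g⁻¹ • y}) ∂μ = 0 := by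
      rw [integral_sub (hμ.integrable _) (hμ.integrable _), ← h1]
      simp
    rw [integral_eq_zero_iff_of_nonneg (fun g => sub_nonneg.2 (hmax _)) (hμ.integrable _)] at h3
    have := hμ.ae_iff.1 h3 g hg
    simp only [Pi.zero_apply] at this
    exact (sub_eq_zero.1 this).symm
  have := hle hg
  rw [MulAction.mem_stabilizer_iff] at this
  rw [← this]
  exact Set.smul_mem_smul_set hy

end SL2

end FurstenbergMeasure
end

open MeasureTheory Filter Topology
open scoped Matrix
open FurstenbergMeasure

set_option linter.unusedSectionVars false

noncomputable section

namespace FurstenbergMeasure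

open scoped ENNReal Pointwise

/-! ### Norms, small balls and invariant measures -/

lemma norm_toLp (v : Fin 2 → ℝ) : ‖WithLp.toLp 2 v‖ = √(nsq v) := by
  rw [EuclideanSpace.norm_eq, nsq]
  simp [Fin.sum_univ_two]

lemma norm_toEuclideanCLM_apply (g : SL2R) (v : Fin 2 → ℝ) :
    ‖Matrix.toEuclideanCLM (𝕜 := ℝ) (g : Matrix (Fin 2) (Fin 2) ℝ) (WithLp.toLp 2 v)‖ =
      √(nsq (g • v)) := by
  rw [Matrix.toEuclideanCLM_toLp, norm_toLp]
  rfl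

lemma opNorm_le_fro (g : SL2R) : opNorm g ≤ fro g := by
  refine ContinuousLinearMap.opNorm_le_bound _ (fro_pos g).le fun v => ?_
  obtain ⟨v, rfl⟩ := (WithLp.toLp_surjective 2) v
  rw [norm_toEuclideanCLM_apply, norm_toLp, ← Real.sqrt_sq (fro_pos g).le,
    ← Real.sqrt_mul (sq_nonneg _)]
  exact Real.sqrt_le_sqrt (nsq_smul_le g v)

lemma stretch_le_opNorm (g : SL2R) (x : RP1) : stretch g x ≤ opNorm g := by
  have h := ContinuousLinearMap.le_opNorm
    (Matrix.toEuclideanCLM (𝕜 := ℝ) (g : Matrix (Fin 2) (Fin 2) ℝ)) (WithLp.toLp 2 x.rep)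
  rw [norm_toEuclideanCLM_apply, norm_toLp] at h
  rw [stretch, Real.sqrt_div (nsq_nonneg _), div_le_iff₀ (Real.sqrt_pos.2 (nsq_pos x.rep_nonzero))]
  exact h

/-- Two lines that `g` stretches little must be close. For unit vectors at angle `θ`, `‖g‖² sin² θ =
|gv|² + |gw|² - 2 cos θ ⟨gv, gw⟩` in the Frobenius norm (the identity `key`), and the last term is
at most `|gv|² + |gw|²` in absolute value. -/
lemma fro_sq_mul_dist_sq_le (g : SL2R) (x y : RP1) :
    fro g ^ 2 * dist x y ^ 2 ≤ 2 * (stretch g x ^ 2 + stretch g y ^ 2) := by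
  have hx := nsq_pos x.rep_nonzero
  have hy := nsq_pos y.rep_nonzero
  rw [dist_eq_emb, emb, emb, dist_embVec_sq x.rep_nonzero y.rep_nonzero, stretch, stretch,
    Real.sq_sqrt (div_nonneg (nsq_nonneg _) hx.le), Real.sq_sqrt (div_nonneg (nsq_nonneg _) hy.le),
    mul_div_assoc', div_add_div _ _ hx.ne' hy.ne', mul_div_assoc']
  refine div_le_div_of_nonneg_right ?_ (mul_pos hx hy).le
  rw [fro_sq]
  generalize x.rep = v
  generalize y.rep = w
  have key : (g 0 0 ^ 2 + g 0 1 ^ 2 + g 1 0 ^ 2 + g 1 1 ^ 2) * cross v w ^ 2 =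
      nsq (g • v) * nsq w + nsq (g • w) * nsq v - 2 * (v 0 * w 0 + v 1 * w 1) *
        ((g • v) 0 * (g • w) 0 + (g • v) 1 * (g • w) 1) := by
    simp only [cross, nsq, smul_vec_zero, smul_vec_one]
    ring
  rw [key]
  simp only [nsq]
  generalize (g • v) 0 = a
  generalize (g • v) 1 = b
  generalize (g • w) 0 = c
  generalize (g • w) 1 = d
  nlinarith [sq_nonneg (a * w 0 + c * v 0), sq_nonneg (a * w 1 + c * v 1),
    sq_nonneg (b * w 0 + d * v 0), sq_nonneg (b * w 1 + d * v 1),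
    sq_nonneg (a * w 0 - c * v 0), sq_nonneg (a * w 1 - c * v 1),
    sq_nonneg (b * w 0 - d * v 0), sq_nonneg (b * w 1 - d * v 1),
    sq_nonneg (a * w 0 + d * v 1), sq_nonneg (a * w 1 + d * v 0),
    sq_nonneg (b * w 0 + c * v 1), sq_nonneg (b * w 1 + c * v 0)]

/-- Small balls have uniformly small measure. -/
lemma exists_forall_closedBall_le {X : Type*} [MetricSpace X] [CompactSpace X] [MeasurableSpace X]
    [BorelSpace X] (ν : Measure X) [IsFiniteMeasure ν] [NullSingletonClass ν] {ε : ℝ≥0∞}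
    (hε : ε ≠ 0) : ∃ δ > 0, ∀ x, ν (Metric.closedBall x δ) ≤ ε := by
  have h1 : ∀ x : X, ∃ r > 0, ν (Metric.ball x r) ≤ ε := by
    intro x
    have := tendsto_measure_cthickening_of_isClosed (μ := ν) (s := {x})
      ⟨1, one_pos, measure_ne_top _ _⟩ isClosed_singleton
    rw [measure_singleton] at this
    have h2 := (this.mono_left (nhdsWithin_le_nhds (s := Set.Ioi 0))).eventually
      (ge_mem_nhds (pos_iff_ne_zero.2 hε))
    obtain ⟨r, hr, hr0⟩ := (h2.and self_mem_nhdsWithin).exists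
    refine ⟨r, hr0, (measure_mono ?_).trans hr⟩
    intro y hy
    rw [Metric.cthickening_singleton _ (le_of_lt hr0)]
    exact Metric.ball_subset_closedBall hy
  choose r hr0 hr using h1
  obtain ⟨δ, hδ, h⟩ := lebesgue_number_lemma_of_metric (isCompact_univ (X := X))
    (fun x => Metric.isOpen_ball (x := x) (ε := r x))
    (fun x _ => Set.mem_iUnion.2 ⟨x, Metric.mem_ball_self (hr0 x)⟩)
  refine ⟨δ / 2, half_pos hδ, fun x => ?_⟩
  obtain ⟨i, hi⟩ := h x (Set.mem_univ x)
  exact (measure_mono ((Metric.closedBall_subset_ball (half_lt_self hδ)).trans hi)).trans (hr i)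

/-- An unbounded group preserves no atomless probability measure on the projective line. -/
lemma not_forall_map_eq {Γ : Subgroup SL2R} (hΓ : IsUnbounded Γ) (ν : Measure RP1)
    [IsProbabilityMeasure ν] [NullSingletonClass ν] :
    ¬ ∀ g ∈ Γ, ν.map (fun x => g • x) = ν := by
  intro hinv
  obtain ⟨δ, hδ, hball⟩ := exists_forall_closedBall_le ν (ε := 1 / 3) (by simp)
  have hsmall : ∀ B : Set RP1, (∀ x ∈ B, ∀ y ∈ B, dist x y ≤ δ) → ν B ≤ 1 / 3 := by
    intro B hB
    rcases B.eq_empty_or_nonempty with rfl | ⟨x, hx⟩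
    · simp
    · exact (measure_mono fun y hy => Metric.mem_closedBall.2 (hB y hy x hx)).trans (hball x)
  refine hΓ ⟨max (4 / δ ^ 2) (1 / δ), fun g hg => ?_⟩
  by_contra! hlt
  have hF := hlt.trans_le (opNorm_le_fro g)
  set F := fro g with hFdef
  have hF1 : 4 / δ ^ 2 < F := (le_max_left _ _).trans_lt hF
  have hF2 : 1 / δ < F := (le_max_right _ _).trans_lt hF
  have hFpos : 0 < F := fro_pos g
  -- The lines that `g` stretches by at most `√F` lie within distance `δ` of each other because `F >
  -- 4 / δ²`; the images of all other lines do so because `F > 1 / δ`. By invariance both parts have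
  -- measure at most `1 / 3`, which cannot add up to `1`.
  let B : Set RP1 := {x | stretch g x ^ 2 ≤ F}
  have hcont : Continuous fun x => stretch g x :=
    continuous_stretch.comp (Continuous.prodMk_right g)
  have hBm : MeasurableSet B := (isClosed_le (hcont.pow 2) continuous_const).measurableSet
  have hB : ν B ≤ 1 / 3 := by
    refine hsmall B fun x hx y hy => ?_
    have h := fro_sq_mul_dist_sq_le g x y
    rw [← hFdef] at h
    have hx' : stretch g x ^ 2 ≤ F := hx
    have hy' : stretch g y ^ 2 ≤ F := hy
    have h4 : F * dist x y ^ 2 ≤ 4 := by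
      by_contra! hc
      nlinarith
    rw [div_lt_iff₀ (by positivity)] at hF1
    by_contra! hc
    nlinarith [mul_pos hFpos (show 0 < dist x y ^ 2 - δ ^ 2 by nlinarith)]
  have hBc : ν ((fun x => g⁻¹ • x) ⁻¹' Bᶜ) ≤ 1 / 3 := by
    refine hsmall _ fun x hx y hy => ?_
    have hx' : F < stretch g (g⁻¹ • x) ^ 2 := not_le.1 hx
    have hy' : F < stretch g (g⁻¹ • y) ^ 2 := not_le.1 hy
    have h := dist_smul_smul g (g⁻¹ • x) (g⁻¹ • y)
    rw [smul_inv_smul, smul_inv_smul] at h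
    rw [h]
    have hx0 := stretch_pos g (g⁻¹ • x)
    have hy0 := stretch_pos g (g⁻¹ • y)
    have hprod : F ≤ stretch g (g⁻¹ • x) * stretch g (g⁻¹ • y) := by
      refine le_of_sq_le_sq ?_ (mul_pos hx0 hy0).le
      rw [mul_pow]
      nlinarith
    rw [div_le_iff₀ (by positivity)]
    rw [div_lt_iff₀ hδ] at hF2
    have := dist_le_one (g⁻¹ • x) (g⁻¹ • y)
    nlinarith
  have hinvg := hinv g⁻¹ (Γ.inv_mem hg)
  have hm : Measurable fun x : RP1 => g⁻¹ • x := (continuous_const_smul _).measurable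
  rw [← Measure.map_apply hm hBm.compl, hinvg] at hBc
  have h1 : (1 : ℝ≥0∞) ≤ 1 / 3 + 1 / 3 := by
    calc (1 : ℝ≥0∞) = ν (B ∪ Bᶜ) := by rw [Set.union_compl_self, measure_univ]
      _ ≤ ν B + ν Bᶜ := measure_union_le _ _
      _ ≤ _ := add_le_add hB hBc
  rw [← ENNReal.toReal_le_toReal (by simp) (by simp [ENNReal.add_eq_top]),
    ENNReal.toReal_add (by simp) (by simp)] at h1
  norm_num at h1

/-- The embedding of the projective line as the unit circle. -/
def circ (x : RP1) : ℂ := 2 * emb x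

lemma continuous_circ : Continuous circ := continuous_const.mul continuous_emb

lemma norm_circ (x : RP1) : ‖circ x‖ = 1 := by simp [circ, norm_emb]

lemma circ_injective : Function.Injective circ := fun _ _ h =>
  emb_injective (mul_left_cancel₀ two_ne_zero h)

/-- The map `circ` as a bounded continuous function. -/
def circB : BoundedContinuousFunction RP1 ℂ :=
  BoundedContinuousFunction.mkOfCompact ⟨circ, continuous_circ⟩

lemma star_circB_mul : star circB * circB = 1 := by
  ext x
  change (starRingEnd ℂ) (circ x) * circ x = 1
  rw [mul_comm, Complex.mul_conj, Complex.normSq_eq_norm_sq, norm_circ]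
  simp

/-- On the unit circle `circ` and its conjugate are inverse to each other, so every word in them
collapses to a power of one. The star algebra they generate separates points, and a measure is
determined by its integrals over it. -/
lemma mem_closure_circB {f : BoundedContinuousFunction RP1 ℂ}
    (hf : f ∈ Submonoid.closure ({circB} ∪ star {circB})) :
    ∃ k : ℕ, f = circB ^ k ∨ f = star circB ^ k := by
  induction hf using Submonoid.closure_induction_left with
  | one => exact ⟨0, Or.inl (pow_zero _).symm⟩
  | mul_left a ha b _ ih =>
    obtain ⟨k, hk⟩ := ih
    have ha' : a = circB ∨ a = star circB := by
      rcases ha with ha | ha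
      · left; simpa using ha
      · right; rw [Set.mem_star, Set.mem_singleton_iff] at ha; rw [← ha, star_star]
    have h1 := star_circB_mul
    rcases ha' with rfl | rfl <;> rcases hk with rfl | rfl
    · exact ⟨k + 1, Or.inl (pow_succ' _ _).symm⟩
    · rcases k with _ | k
      · exact ⟨1, Or.inl (by simp)⟩
      · refine ⟨k, Or.inr ?_⟩
        rw [pow_succ', ← mul_assoc, mul_comm circB, h1, one_mul]
    · rcases k with _ | k
      · exact ⟨1, Or.inr (by simp)⟩
      · refine ⟨k, Or.inl ?_⟩
        rw [pow_succ', ← mul_assoc, h1, one_mul]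
    · exact ⟨k + 1, Or.inr (pow_succ' _ _).symm⟩

/-- A probability measure on the projective line is determined by its Fourier coefficients. -/
lemma ext_of_integral_circ_pow {θ θ' : Measure RP1} [IsFiniteMeasure θ] [IsFiniteMeasure θ']
    (h : ∀ n : ℕ, ∫ x, circ x ^ n ∂θ = ∫ x, circ x ^ n ∂θ') : θ = θ' := by
  refine ext_of_forall_mem_subalgebra_integral_eq_of_pseudoEMetric_complete_countable (𝕜 := ℂ)
    (A := StarAlgebra.adjoin ℂ {circB}) ?_ ?_
  · intro x y hxy
    refine ⟨circ, ⟨circB.toContinuousMap, ⟨circB, ?_, rfl⟩, rfl⟩, fun h => hxy (circ_injective h)⟩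
    exact StarAlgebra.self_mem_adjoin_singleton ℂ circB
  · intro f hf
    replace hf : f ∈ Subalgebra.toSubmodule (StarAlgebra.adjoin ℂ {circB}).toSubalgebra := hf
    rw [StarAlgebra.adjoin_eq_span] at hf
    have hint : ∀ (f : BoundedContinuousFunction RP1 ℂ) (m : Measure RP1) [IsFiniteMeasure m],
      Integrable f m := fun f m _ => f.integrable m
    induction hf using Submodule.span_induction with
    | mem f hf =>
      obtain ⟨k, rfl | rfl⟩ := mem_closure_circB hf
      · exact h k
      · have : ∀ x, (star circB ^ k) x = (starRingEnd ℂ) (circ x ^ k) := by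
          intro x; rw [map_pow]; rfl
        simp_rw [this]
        rw [integral_conj, integral_conj, h k]
    | zero => simp
    | add f g _ _ hf hg =>
      have e (m : Measure RP1) [IsFiniteMeasure m] :
          ∫ x, (f + g) x ∂m = ∫ x, f x ∂m + ∫ x, g x ∂m := integral_add (hint f m) (hint g m)
      rw [e, e, hf, hg]
    | smul a f _ hf =>
      have e (m : Measure RP1) [IsFiniteMeasure m] :
          ∫ x, (a • f) x ∂m = a • ∫ x, f x ∂m := integral_smul a (fun x => f x)
      rw [e, e, hf]

end FurstenbergMeasure
end

open MeasureTheory Filter Topology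
open scoped Matrix
open FurstenbergMeasure

set_option linter.unusedSectionVars false

noncomputable section

namespace FurstenbergMeasure

open scoped ENNReal Pointwise ComplexConjugate

/-! ### Positivity of the exponent by comparing logarithmic energies -/

lemma _root_.HasSum.of_eq {f g : ℕ → ℝ} {a : ℝ} (h : HasSum g a) (e : ∀ n, f n = g n) :
    HasSum f a := by rwa [funext e]

/-- For unit complex numbers `|1 - r z w̄|² = (1 - r)² + r |z - w|²`, and the chord `|z - w|` is
twice the distance. -/
lemma normSq_one_sub_circ (r : ℝ) (x y : RP1) :
    ‖1 - r * (circ x * conj (circ y))‖ ^ 2 = (1 - r) ^ 2 + 4 * r * dist x y ^ 2 := by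
  have hx : (emb x).re ^ 2 + (emb x).im ^ 2 = 1 / 4 := by
    have := norm_emb x
    have h2 : ‖emb x‖ ^ 2 = 1 / 4 := by rw [this]; norm_num
    rw [Complex.sq_norm, Complex.normSq_apply] at h2
    linarith
  have hy : (emb y).re ^ 2 + (emb y).im ^ 2 = 1 / 4 := by
    have := norm_emb y
    have h2 : ‖emb y‖ ^ 2 = 1 / 4 := by rw [this]; norm_num
    rw [Complex.sq_norm, Complex.normSq_apply] at h2
    linarith
  rw [dist_eq_emb, Complex.dist_eq, Complex.sq_norm, Complex.sq_norm, Complex.normSq_apply,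
    Complex.normSq_apply]
  simp only [circ, Complex.sub_re, Complex.sub_im, Complex.one_re, Complex.one_im, Complex.mul_re,
    Complex.mul_im, Complex.ofReal_re, Complex.ofReal_im, Complex.conj_re, Complex.conj_im,
    Complex.re_ofNat, Complex.im_ofNat, map_mul, Complex.conj_ofNat]
  generalize (emb x).re = a at *
  generalize (emb x).im = b at *
  generalize (emb y).re = c at *
  generalize (emb y).im = d at *
  have hb : b ^ 2 = 1 / 4 - a ^ 2 := by linarith
  have hd : d ^ 2 = 1 / 4 - c ^ 2 := by linarith
  linear_combination (16 * r ^ 2 * (c ^ 2 + d ^ 2) - 4 * r) * hx + (4 * r ^ 2 - 4 * r) * hy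

/-- The regularized logarithmic kernel. -/
def logKernel (r : ℝ) (z w : ℂ) : ℝ := - Real.log (‖1 - r * (z * conj w)‖ ^ 2)

/-- Real part of the Taylor series of `-2 log (1 - ζ)` at `ζ = r z w̄`. The coefficients are
nonnegative, and the term `n = 0` vanishes because `2 / 0 = 0`. -/
lemma hasSum_logKernel {r : ℝ} (hr0 : 0 ≤ r) (hr1 : r < 1) {z w : ℂ} (hz : ‖z‖ = 1) (hw : ‖w‖ = 1) :
    HasSum (fun n : ℕ => 2 / (n : ℝ) * r ^ n * (z ^ n * conj (w ^ n)).re) (logKernel r z w) := by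
  have hn : ‖(r : ℂ) * (z * conj w)‖ < 1 := by
    rw [norm_mul, norm_mul, RCLike.norm_conj, hz, hw, Complex.norm_real, Real.norm_eq_abs,
      abs_of_nonneg hr0]
    simpa using hr1
  have h := (Complex.hasSum_re (Complex.hasSum_taylorSeries_neg_log hn)).mul_left 2
  have e : 2 * (-Complex.log (1 - r * (z * conj w))).re = logKernel r z w := by
    rw [logKernel, Complex.neg_re, Complex.log_re, Real.log_pow]
    push_cast
    ring
  rw [e] at h
  refine h.of_eq fun n => ?_
  have : ((r : ℂ) * (z * conj w)) ^ n / (n : ℂ) =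
      ((r ^ n / n : ℝ) : ℂ) * (z ^ n * conj (w ^ n)) := by
    push_cast
    rw [map_pow]
    ring
  rw [this, Complex.re_ofReal_mul]
  ring

/-- Integrating the Fourier expansion of the kernel against `ν × ν` turns `z ^ n w̄ ^ n` into the
squared modulus of a Fourier coefficient; this is the positive definiteness of the logarithmic
kernel. The factor `r ^ n` permits the exchange of sum and integral. -/
lemma hasSum_energy (ν : Measure RP1) [IsProbabilityMeasure ν] {r : ℝ} (hr0 : 0 ≤ r) (hr1 : r < 1)
    {w : RP1 → ℂ} (hw : Continuous w) (hw1 : ∀ x, ‖w x‖ = 1) :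
    HasSum (fun n : ℕ => 2 / (n : ℝ) * r ^ n * ‖∫ x, w x ^ n ∂ν‖ ^ 2)
      (∫ p, logKernel r (w p.1) (w p.2) ∂(ν.prod ν)) := by
  let F : ℕ → RP1 × RP1 → ℝ := fun n p => 2 / (n : ℝ) * r ^ n * (w p.1 ^ n * conj (w p.2 ^ n)).re
  have hFc : ∀ n, Continuous (fun p : RP1 × RP1 => w p.1 ^ n * conj (w p.2 ^ n)) := fun n => by
    have := Complex.continuous_conj
    fun_prop
  have hint : ∀ n, Integrable (fun p : RP1 × RP1 => w p.1 ^ n * conj (w p.2 ^ n)) (ν.prod ν) :=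
    fun n => Integrable.of_bound (hFc n).aestronglyMeasurable 1
      (ae_of_all _ fun p => by simp [hw1])
  have hFb : ∀ n p, ‖F n p‖ ≤ 2 * r ^ n := by
    intro n p
    simp only [F]
    rw [norm_mul, norm_mul, Real.norm_eq_abs, Real.norm_eq_abs, Real.norm_eq_abs,
      abs_of_nonneg (by positivity : (0 : ℝ) ≤ 2 / n), abs_of_nonneg (by positivity : 0 ≤ r ^ n)]
    have h1 : |(w p.1 ^ n * conj (w p.2 ^ n)).re| ≤ 1 :=
      (Complex.abs_re_le_norm _).trans (by simp [hw1])
    have h2 : (2 : ℝ) / n ≤ 2 := by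
      rcases n.eq_zero_or_pos with rfl | hn
      · simp
      · exact div_le_self zero_le_two (by exact_mod_cast hn)
    calc 2 / (n : ℝ) * r ^ n * |(w p.1 ^ n * conj (w p.2 ^ n)).re| ≤ 2 * r ^ n * 1 := by gcongr
      _ = _ := mul_one _
  have h := hasSum_integral_of_summable_integral_norm (μ := ν.prod ν) (F := F)
    (fun n => ((hint n).re).const_mul _) ?_
  · have e1 : ∀ n, ∫ p, F n p ∂(ν.prod ν) = 2 / (n : ℝ) * r ^ n * ‖∫ x, w x ^ n ∂ν‖ ^ 2 := by
      intro n
      have h3 : ∫ p, (w p.1 ^ n * conj (w p.2 ^ n)).re ∂(ν.prod ν) =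
          (∫ p, (w p.1 ^ n * conj (w p.2 ^ n)) ∂(ν.prod ν)).re := integral_re (hint n)
      simp only [F]
      rw [integral_const_mul, h3, integral_prod_mul (fun x => w x ^ n) (fun y => conj (w y ^ n)),
        integral_conj, Complex.mul_conj, Complex.normSq_eq_norm_sq]
      norm_cast
    have e2 : ∀ p, ∑' n, F n p = logKernel r (w p.1) (w p.2) := fun p =>
      (hasSum_logKernel hr0 hr1 (hw1 p.1) (hw1 p.2)).tsum_eq
    simp_rw [e1, e2] at h
    exact h
  · refine Summable.of_nonneg_of_le (fun n => integral_nonneg fun p => norm_nonneg _) (fun n => ?_)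
      ((summable_geometric_of_lt_one hr0 hr1).mul_left 2)
    calc ∫ p, ‖F n p‖ ∂(ν.prod ν) ≤ ∫ p, 2 * r ^ n ∂(ν.prod ν) :=
          integral_mono_of_nonneg (ae_of_all _ fun p => norm_nonneg _) (integrable_const _)
            (ae_of_all _ fun p => hFb n p)
      _ = 2 * r ^ n := by simp

section

variable {μ : Measure SL2R} [IsProbabilityMeasure μ] {ν : Measure RP1} [IsProbabilityMeasure ν]

/-- The increments of the regularized energy of `ν` under the action of `g`. -/
def energyGain (ν : Measure RP1) (r : ℝ) (g : SL2R) : ℝ :=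
  ∫ p, (logKernel r (circ (g • p.1)) (circ (g • p.2)) - logKernel r (circ p.1) (circ p.2))
    ∂(ν.prod ν)

lemma continuous_logKernel {r : ℝ} (hr0 : 0 ≤ r) (hr1 : r < 1) {w : RP1 → ℂ} (hw : Continuous w)
    (hw1 : ∀ x, ‖w x‖ = 1) : Continuous fun p : RP1 × RP1 => logKernel r (w p.1) (w p.2) := by
  unfold logKernel
  have := Complex.continuous_conj
  refine (Continuous.log (by fun_prop) fun p => ?_).neg
  refine pow_ne_zero 2 (norm_ne_zero_iff.2 fun h => ?_)
  have h1 : ‖(r : ℂ) * (w p.1 * conj (w p.2))‖ = 1 := by rw [← sub_eq_zero.1 h]; simp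
  rw [norm_mul, norm_mul, RCLike.norm_conj, hw1, hw1, Complex.norm_real, Real.norm_eq_abs,
      abs_of_nonneg hr0] at h1
  linarith

lemma integrable_of_continuous_prod {f : RP1 × RP1 → ℝ} (hf : Continuous f) :
    Integrable f (ν.prod ν) := by
  obtain ⟨C, hC⟩ := isCompact_univ.exists_bound_of_continuousOn hf.continuousOn
  exact Integrable.of_bound hf.aestronglyMeasurable C (ae_of_all _ fun x => hC x (Set.mem_univ x))

lemma continuous_smul_left (g : SL2R) : Continuous fun x : RP1 => g • x := continuous_const_smul g

lemma energyGain_eq {r : ℝ} (hr0 : 0 ≤ r) (hr1 : r < 1) (g : SL2R) :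
    energyGain ν r g = ∫ p, logKernel r (circ (g • p.1)) (circ (g • p.2)) ∂(ν.prod ν) -
      ∫ p, logKernel r (circ p.1) (circ p.2) ∂(ν.prod ν) :=
  integral_sub
    (integrable_of_continuous_prod (continuous_logKernel hr0 hr1
      (w := fun x => circ (g • x)) (continuous_circ.comp (continuous_smul_left g))
      fun _ => norm_circ _))
    (integrable_of_continuous_prod (continuous_logKernel hr0 hr1 continuous_circ norm_circ))

/-- The Fourier coefficients of the translates of `ν`. -/
def fourierCoef (ν : Measure RP1) (n : ℕ) (g : SL2R) : ℂ := ∫ x, circ (g • x) ^ n ∂ν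

lemma integral_fourierCoef (hν : IsStationaryMeasure μ ν) (n : ℕ) :
    ∫ g, (fourierCoef ν n g).re ∂μ = (fourierCoef ν n 1).re ∧
    ∫ g, (fourierCoef ν n g).im ∂μ = (fourierCoef ν n 1).im := by
  have hc : Continuous fun x => circ x ^ n := continuous_circ.pow n
  have hint : ∀ g : SL2R, Integrable (fun x => circ (g • x) ^ n) ν := fun g =>
    Integrable.of_bound (hc.comp (continuous_smul_left g)).aestronglyMeasurable 1
      (ae_of_all _ fun x => by simp [norm_circ])
  have h1 : ∀ g, (fourierCoef ν n g).re = ∫ x, (circ (g • x) ^ n).re ∂ν := fun g =>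
    (integral_re (hint g)).symm
  have h2 : ∀ g, (fourierCoef ν n g).im = ∫ x, (circ (g • x) ^ n).im ∂ν := fun g =>
    (integral_im (hint g)).symm
  constructor
  · simp_rw [h1]
    rw [hν.integral (f := fun x => (circ x ^ n).re) (Complex.continuous_re.comp hc)]
    simp
  · simp_rw [h2]
    rw [hν.integral (f := fun x => (circ x ^ n).im) (Complex.continuous_im.comp hc)]
    simp

/-- By stationarity the `μ`-mean of the coefficient of `gν` is that of `ν`, so this is the formula
for a variance. -/
lemma integral_normSq_fourierCoef (hμ : FinSupp μ) (hν : IsStationaryMeasure μ ν) (n : ℕ) :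
    ∫ g, ‖fourierCoef ν n g‖ ^ 2 ∂μ - ‖fourierCoef ν n 1‖ ^ 2 =
      ∫ g, ‖fourierCoef ν n g - fourierCoef ν n 1‖ ^ 2 ∂μ := by
  obtain ⟨h1, h2⟩ := integral_fourierCoef hν n
  have e : ∀ g, ‖fourierCoef ν n g - fourierCoef ν n 1‖ ^ 2 = ‖fourierCoef ν n g‖ ^ 2 -
      2 * (fourierCoef ν n 1).re * (fourierCoef ν n g).re -
      2 * (fourierCoef ν n 1).im * (fourierCoef ν n g).im + ‖fourierCoef ν n 1‖ ^ 2 := by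
    intro g
    simp only [Complex.sq_norm, Complex.normSq_apply, Complex.sub_re, Complex.sub_im]
    ring
  simp_rw [e]
  rw [integral_add (hμ.integrable _) (hμ.integrable _),
    integral_sub (hμ.integrable _) (hμ.integrable _),
    integral_sub (hμ.integrable _) (hμ.integrable _), integral_const_mul, integral_const_mul, h1, h2]
  simp only [Complex.sq_norm, Complex.normSq_apply, integral_const, probReal_univ, one_smul]
  ring

/-- The mean gain of energy is a series of variances with nonnegative weights, so it bounds each
single term. -/
lemma le_integral_energyGain (hμ : FinSupp μ) (hν : IsStationaryMeasure μ ν) {r : ℝ} (hr0 : 0 ≤ r)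
    (hr1 : r < 1) (n : ℕ) :
    2 / (n : ℝ) * r ^ n * ∫ g, ‖fourierCoef ν n g - fourierCoef ν n 1‖ ^ 2 ∂μ ≤
      ∫ g, energyGain ν r g ∂μ := by
  obtain ⟨T, hT⟩ := hμ
  have hμ : FinSupp μ := ⟨T, hT⟩
  have hs : ∀ g : SL2R, HasSum (fun n : ℕ => 2 / (n : ℝ) * r ^ n *
      (‖fourierCoef ν n g‖ ^ 2 - ‖fourierCoef ν n 1‖ ^ 2)) (energyGain ν r g) := by
    intro g
    rw [energyGain_eq hr0 hr1]
    have h1 := hasSum_energy ν hr0 hr1 (w := fun x => circ (g • x))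
      (continuous_circ.comp (continuous_smul_left g)) fun _ => norm_circ _
    have h2 := hasSum_energy ν hr0 hr1 continuous_circ norm_circ
    refine (h1.sub h2).of_eq fun n => ?_
    simp only [fourierCoef, one_smul]
    ring
  have hsum : HasSum (fun n : ℕ => 2 / (n : ℝ) * r ^ n *
      ∫ g, ‖fourierCoef ν n g - fourierCoef ν n 1‖ ^ 2 ∂μ) (∫ g, energyGain ν r g ∂μ) := by
    have := hasSum_sum (s := T) fun g _ => (hs g).mul_left (μ.real {g})
    rw [← FinSupp.integral_eq_sum hT] at this
    refine this.of_eq fun n => ?_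
    rw [← integral_normSq_fourierCoef hμ hν, ← FinSupp.integral_eq_sum hT, integral_const_mul,
      integral_sub (hμ.integrable _) (integrable_const _)]
    simp
  exact le_hasSum hsum n fun m _ => mul_nonneg (by positivity)
    (integral_nonneg fun g => by positivity)

lemma logKernel_sub_eq {r : ℝ} (hr0 : 0 ≤ r) (hr1 : r < 1) (g : SL2R) (x y : RP1) :
    logKernel r (circ (g • x)) (circ (g • y)) - logKernel r (circ x) (circ y) =
      Real.log (((1 - r) ^ 2 + 4 * r * dist x y ^ 2) /
        ((1 - r) ^ 2 + 4 * r * (dist x y / (stretch g x * stretch g y)) ^ 2)) := by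
  have h0 : 0 < (1 - r) ^ 2 := pow_pos (by linarith) 2
  rw [logKernel, logKernel, normSq_one_sub_circ, normSq_one_sub_circ, dist_smul_smul,
    Real.log_div (by positivity) (by positivity)]
  ring

/-- The quotient compares `(1 - r)² + D` with `(1 - r)² + D / s`, where `s` lies between `fro g ^
(-4)` and `fro g ^ 4`. The bound does not depend on `r` and dominates the passage `r → 1`. -/
lemma abs_logKernel_sub_le {r : ℝ} (hr0 : 0 ≤ r) (hr1 : r < 1) (g : SL2R) (x y : RP1) :
    |logKernel r (circ (g • x)) (circ (g • y)) - logKernel r (circ x) (circ y)| ≤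
      Real.log (fro g ^ 4) := by
  have h0 : 0 < (1 - r) ^ 2 := pow_pos (by linarith) 2
  rw [logKernel_sub_eq hr0 hr1]
  have hx := stretch_pos g x
  have hy := stretch_pos g y
  have hF := one_le_fro g
  have hF0 := fro_pos g
  have hx1 := stretch_le_fro g x
  have hy1 := stretch_le_fro g y
  have hx2 := inv_fro_le_stretch g x
  have hy2 := inv_fro_le_stretch g y
  set s := (stretch g x * stretch g y) ^ 2 with hs
  have hs0 : 0 < s := by positivity
  have hs1 : s ≤ fro g ^ 4 := by
    calc s ≤ (fro g * fro g) ^ 2 := by rw [hs]; gcongr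
      _ = _ := by ring
  have hs2 : (fro g ^ 4)⁻¹ ≤ s := by
    calc (fro g ^ 4)⁻¹ = ((fro g)⁻¹ * (fro g)⁻¹) ^ 2 := by rw [← mul_inv, inv_pow]; ring_nf
      _ ≤ s := by rw [hs]; gcongr
  have hF4 : 1 ≤ fro g ^ 4 := one_le_pow₀ hF
  set D := 4 * r * dist x y ^ 2 with hD
  have hD0 : 0 ≤ D := by positivity
  have e : 4 * r * (dist x y / (stretch g x * stretch g y)) ^ 2 = D / s := by
    rw [div_pow, hD, hs]; ring
  rw [e]
  have h1 : D / s ≤ D * fro g ^ 4 := by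
    rw [div_eq_mul_inv]
    exact mul_le_mul_of_nonneg_left (inv_le_of_inv_le₀ (by positivity) hs2) hD0
  have h2 : D ≤ D / s * fro g ^ 4 := by
    rw [div_mul_eq_mul_div, le_div_iff₀ hs0]
    exact mul_le_mul_of_nonneg_left hs1 hD0
  have hDs : 0 ≤ D / s := by positivity
  rw [abs_le, ← Real.log_inv]
  constructor
  · refine Real.log_le_log (by positivity) ?_
    rw [le_div_iff₀ (by positivity), inv_mul_le_iff₀ (by positivity)]
    nlinarith
  · refine Real.log_le_log (by positivity) ?_
    rw [div_le_iff₀ (by positivity)]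
    nlinarith

lemma continuous_log_stretch (g : SL2R) : Continuous fun x => Real.log (stretch g x) :=
  (continuous_stretch.comp (Continuous.prodMk_right g)).log fun x => (stretch_pos g x).ne'

/-- At `r = 1` the kernel is `-log (4 dist²)`, whose increment under `g` is `2 log` of the product
of the two stretches wherever the points differ. The diagonal is null as `ν` has no atoms. -/
lemma tendsto_energyGain [NullSingletonClass ν] (g : SL2R) :
    Tendsto (fun k : ℕ => energyGain ν (1 - 1 / ((k : ℝ) + 1)) g) atTop
      (𝓝 (4 * ∫ x, Real.log (stretch g x) ∂ν)) := by
  have hr : ∀ k : ℕ, 0 ≤ 1 - 1 / ((k : ℝ) + 1) ∧ 1 - 1 / ((k : ℝ) + 1) < 1 := by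
    intro k
    have h1 : 1 / ((k : ℝ) + 1) ≤ 1 := by
      rw [div_le_one (by positivity)]; linarith [k.cast_nonneg (α := ℝ)]
    have h2 : 0 < 1 / ((k : ℝ) + 1) := by positivity
    constructor <;> linarith
  have hlim : 4 * ∫ x, Real.log (stretch g x) ∂ν =
      ∫ p, (2 * Real.log (stretch g p.1) + 2 * Real.log (stretch g p.2)) ∂(ν.prod ν) := by
    have hc := continuous_log_stretch g
    have h1 : Integrable (fun p : RP1 × RP1 => 2 * Real.log (stretch g p.1)) (ν.prod ν) :=
      integrable_of_continuous_prod (continuous_const.mul (hc.comp continuous_fst))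
    have h2 : Integrable (fun p : RP1 × RP1 => 2 * Real.log (stretch g p.2)) (ν.prod ν) :=
      integrable_of_continuous_prod (continuous_const.mul (hc.comp continuous_snd))
    rw [integral_add h1 h2, integral_prod _ h1, integral_prod _ h2]
    simp only [integral_const, probReal_univ, one_smul, integral_const_mul]
    ring
  rw [hlim]
  have hdiag : ∀ᵐ p ∂(ν.prod ν), p.1 ≠ p.2 := by
    have hm : MeasurableSet {p : RP1 × RP1 | p.1 = p.2} := (isClosed_diagonal).measurableSet
    rw [ae_iff]
    simp only [ne_eq, not_not]
    rw [Measure.measure_prod_null hm]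
    refine ae_of_all _ fun x => ?_
    have : Prod.mk x ⁻¹' {p : RP1 × RP1 | p.1 = p.2} = {x} := by ext y; simp [eq_comm]
    change ν (Prod.mk x ⁻¹' {p : RP1 × RP1 | p.1 = p.2}) = 0
    rw [this, measure_singleton]
  refine tendsto_integral_of_dominated_convergence (fun _ => Real.log (fro g ^ 4)) (fun k => ?_)
    (integrable_const _) (fun k => ae_of_all _ fun p => ?_) ?_
  · refine Continuous.aestronglyMeasurable (Continuous.sub ?_ ?_)
    · exact continuous_logKernel (hr k).1 (hr k).2 (w := fun x => circ (g • x))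
        (continuous_circ.comp (continuous_smul_left g)) fun _ => norm_circ _
    · exact continuous_logKernel (hr k).1 (hr k).2 continuous_circ norm_circ
  · exact abs_logKernel_sub_le (hr k).1 (hr k).2 g p.1 p.2
  · filter_upwards [hdiag] with p hp
    have hd : 0 < dist p.1 p.2 := dist_pos.2 hp
    have hx := stretch_pos g p.1
    have hy := stretch_pos g p.2
    have ht : Tendsto (fun k : ℕ => 1 - 1 / ((k : ℝ) + 1)) atTop (𝓝 1) := by
      simpa using tendsto_const_nhds.sub (tendsto_one_div_add_atTop_nhds_zero_nat (𝕜 := ℝ))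
    have e : 2 * Real.log (stretch g p.1) + 2 * Real.log (stretch g p.2) =
        Real.log (((1 - 1) ^ 2 + 4 * 1 * dist p.1 p.2 ^ 2) /
        ((1 - 1) ^ 2 + 4 * 1 * (dist p.1 p.2 / (stretch g p.1 * stretch g p.2)) ^ 2)) := by
      have : (((1 - 1) ^ 2 + 4 * 1 * dist p.1 p.2 ^ 2) /
        ((1 - 1) ^ 2 + 4 * 1 * (dist p.1 p.2 / (stretch g p.1 * stretch g p.2)) ^ 2)) =
          (stretch g p.1 * stretch g p.2) ^ 2 := by
        field_simp
        ring
      rw [this, Real.log_pow, Real.log_mul hx.ne' hy.ne']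
      push_cast; ring
    rw [e]
    simp_rw [logKernel_sub_eq (hr _).1 (hr _).2]
    have hcont : ContinuousAt (fun r : ℝ => Real.log (((1 - r) ^ 2 + 4 * r * dist p.1 p.2 ^ 2) /
        ((1 - r) ^ 2 + 4 * r * (dist p.1 p.2 / (stretch g p.1 * stretch g p.2)) ^ 2))) 1 := by
      refine ContinuousAt.log (ContinuousAt.div (by fun_prop) (by fun_prop) ?_) ?_
      · have : 0 < (dist p.1 p.2 / (stretch g p.1 * stretch g p.2)) ^ 2 := by positivity
        simp only [sub_self]; nlinarith
      · have : 0 < (dist p.1 p.2 / (stretch g p.1 * stretch g p.2)) ^ 2 := by positivity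
        have : 0 < dist p.1 p.2 ^ 2 := by positivity
        simp only [sub_self]; positivity
    exact hcont.tendsto.comp ht

/-- **Furstenberg's theorem**: the exponent of every stationary measure is positive. -/
lemma IsStationaryMeasure.integral_log_stretch_pos (hfin : μ.support.Finite)
    (hunb : IsUnbounded (generatedGroup μ)) (hirr : IsTotallyIrreducible (generatedGroup μ))
    (hν : IsStationaryMeasure μ ν) : 0 < ∫ g, ∫ x, Real.log (stretch g x) ∂ν ∂μ := by
  have hμ := finSupp_of_support_finite hfin
  have hna := hν.nullSingletonClass hfin hirr
  by_contra! hneg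
  have hlim : Tendsto (fun k : ℕ => ∫ g, energyGain ν (1 - 1 / ((k : ℝ) + 1)) g ∂μ) atTop
      (𝓝 (4 * ∫ g, ∫ x, Real.log (stretch g x) ∂ν ∂μ)) := by
    obtain ⟨T, hT⟩ := hμ
    rw [← integral_const_mul]
    simp_rw [FinSupp.integral_eq_sum hT]
    exact tendsto_finsetSum _ fun g _ => (tendsto_energyGain g).const_mul _
  have hr : ∀ k : ℕ, 0 ≤ 1 - 1 / ((k : ℝ) + 1) ∧ 1 - 1 / ((k : ℝ) + 1) < 1 := by
    intro k
    have h1 : 1 / ((k : ℝ) + 1) ≤ 1 := by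
      rw [div_le_one (by positivity)]; linarith [k.cast_nonneg (α := ℝ)]
    have h2 : 0 < 1 / ((k : ℝ) + 1) := by positivity
    constructor <;> linarith
  have ht : Tendsto (fun k : ℕ => 1 - 1 / ((k : ℝ) + 1)) atTop (𝓝 1) := by
    simpa using tendsto_const_nhds.sub (tendsto_one_div_add_atTop_nhds_zero_nat (𝕜 := ℝ))
  -- With a nonpositive exponent the limit of the mean energy gains is nonpositive, so each variance
  -- vanishes: almost every translate of `ν` has the same Fourier coefficients as `ν`.
  have hzero : ∀ n : ℕ, ∫ g, ‖fourierCoef ν n g - fourierCoef ν n 1‖ ^ 2 ∂μ = 0 := by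
    intro n
    rcases n.eq_zero_or_pos with rfl | hn
    · simp [fourierCoef]
    have h1 := le_of_tendsto_of_tendsto' (((ht.pow n).const_mul (2 / (n : ℝ))).mul_const
      (∫ g, ‖fourierCoef ν n g - fourierCoef ν n 1‖ ^ 2 ∂μ)) hlim
      fun k => le_integral_energyGain hμ hν (hr k).1 (hr k).2 n
    have h2 : 0 ≤ ∫ g, ‖fourierCoef ν n g - fourierCoef ν n 1‖ ^ 2 ∂μ :=
      integral_nonneg fun g => by positivity
    have h3 : (0 : ℝ) < 2 / n := by positivity
    rw [one_pow, mul_one] at h1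
    by_contra h4
    have := mul_pos h3 (lt_of_le_of_ne h2 (Ne.symm h4))
    linarith
  have hmap : ∀ g, μ {g} ≠ 0 → ν.map (fun x => g • x) = ν := by
    intro g hg
    have hm : Measurable fun x : RP1 => g • x := (continuous_smul_left g).measurable
    have : IsProbabilityMeasure (ν.map fun x => g • x) :=
      Measure.isProbabilityMeasure_map hm.aemeasurable
    refine ext_of_integral_circ_pow fun n => ?_
    have hc : Continuous fun x => circ x ^ n := continuous_circ.pow n
    rw [integral_map hm.aemeasurable hc.aestronglyMeasurable]
    have h1 := hzero n
    rw [integral_eq_zero_iff_of_nonneg (fun g => by positivity) (hμ.integrable _)] at h1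
    have h2 := hμ.ae_iff.1 h1 g hg
    simp only [Pi.zero_apply, ne_eq, OfNat.ofNat_ne_zero, not_false_eq_true, pow_eq_zero_iff,
      norm_eq_zero, sub_eq_zero] at h2
    simpa [fourierCoef] using h2
  refine not_forall_map_eq hunb ν fun g hg => ?_
  have hm (g : SL2R) : Measurable fun x : RP1 => g • x := (continuous_smul_left g).measurable
  induction hg using Subgroup.closure_induction with
  | mem g hg => exact hmap g (measure_singleton_ne_zero_of_mem_support hfin hg)
  | one => simp
  | mul g h _ _ ihg ihh =>
    have : (fun x : RP1 => (g * h) • x) = (fun x => g • x) ∘ fun x => h • x := by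
      ext x; simp [mul_smul]
    rw [this, ← Measure.map_map (hm g) (hm h), ihh, ihg]
  | inv g _ ih =>
    conv_lhs => rw [← ih]
    rw [Measure.map_map (hm _) (hm _)]
    simp [Function.comp_def]

end

end FurstenbergMeasure
end

open MeasureTheory Filter Topology
open scoped Matrix
open FurstenbergMeasure

set_option linter.unusedSectionVars false

noncomputable section

namespace FurstenbergMeasure

open scoped ENNReal Pointwise

/-! ### Uniform positivity of the drift -/

section

variable {μ : Measure SL2R} [IsProbabilityMeasure μ] {ν : Measure RP1}

lemma isStationaryMeasure_of_integral [IsProbabilityMeasure ν]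
    (h : ∀ f : RP1 → ℝ, Continuous f → ∫ g, ∫ x, f (g • x) ∂ν ∂μ = ∫ x, f x ∂ν) :
    IsStationaryMeasure μ ν := by
  have := Measure.isProbabilityMeasure_map (μ := μ.prod ν) measurable_act.aemeasurable
  refine ext_of_forall_integral_eq_of_IsFiniteMeasure fun f => ?_
  rw [← h f f.continuous, integral_map measurable_act.aemeasurable
    f.continuous.aestronglyMeasurable, integral_prod]
  exact Integrable.of_bound (f.continuous.comp continuous_smul).aestronglyMeasurable ‖f‖
    (ae_of_all _ fun x => f.norm_coe_le_norm _)

lemma integrable_comp_smul [IsFiniteMeasure ν] {f : RP1 → ℝ} (hf : Continuous f) (g : SL2R) :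
    Integrable (fun x => f (g • x)) ν :=
  integrable_of_continuous (hf.comp (continuous_smul_left g))

/-- The expected logarithmic growth after `n` steps. -/
def drift (μ : Measure SL2R) (n : ℕ) (x : RP1) : ℝ :=
  ∫ g, Real.log (stretch g x) ∂(convPow μ n)

lemma log_stretch_mul (g h : SL2R) (x : RP1) :
    Real.log (stretch (g * h) x) = Real.log (stretch g (h • x)) + Real.log (stretch h x) := by
  rw [stretch_mul, Real.log_mul (stretch_pos _ _).ne' (stretch_pos _ _).ne']

/-- Cocycle identity for `log stretch`: the last step acts on the line reached after `n` steps. -/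
lemma drift_succ (hμ : FinSupp μ) (n : ℕ) (x : RP1) :
    drift μ (n + 1) x = ∫ h, drift μ 1 (h • x) ∂(convPow μ n) + drift μ n x := by
  have hn := finSupp_convPow hμ n
  rw [drift, convPow_succ', integral_mconv hμ hn]
  simp_rw [log_stretch_mul]
  simp_rw [integral_add (hn.integrable _) (hn.integrable _)]
  rw [integral_add (hμ.integrable _) (integrable_const _)]
  simp only [integral_const, probReal_univ, one_smul, drift, convPow_one]
  congr 1
  obtain ⟨T, hT⟩ := hμ
  obtain ⟨T', hT'⟩ := hn
  simp_rw [FinSupp.integral_eq_sum hT, FinSupp.integral_eq_sum hT', Finset.mul_sum]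
  rw [Finset.sum_comm]
  refine Finset.sum_congr rfl fun _ _ => Finset.sum_congr rfl fun _ _ => by ring

lemma drift_zero (x : RP1) : drift μ 0 x = 0 := by
  rw [drift, convPow_zero, integral_dirac, stretch_one, Real.log_one]

lemma drift_eq_sum (hμ : FinSupp μ) (n : ℕ) (x : RP1) :
    drift μ n x = ∑ k ∈ Finset.range n, ∫ h, drift μ 1 (h • x) ∂(convPow μ k) := by
  induction n with
  | zero => simp [drift_zero]
  | succ n ih => rw [drift_succ hμ, Finset.sum_range_succ, ih, add_comm]

lemma continuous_integral_finSupp {m : Measure SL2R} [IsFiniteMeasure m] (h : FinSupp m)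
    {F : SL2R → RP1 → ℝ} (hF : ∀ g, Continuous (F g)) : Continuous fun x => ∫ g, F g x ∂m := by
  obtain ⟨T, hT⟩ := h
  simp_rw [FinSupp.integral_eq_sum hT]
  exact continuous_finsetSum _ fun g _ => (hF g).const_mul _

lemma continuous_drift (hμ : FinSupp μ) (n : ℕ) : Continuous (drift μ n) :=
  continuous_integral_finSupp (finSupp_convPow hμ n) continuous_log_stretch

lemma integral_drift_one (hμ : FinSupp μ) [IsProbabilityMeasure ν] :
    ∫ x, drift μ 1 x ∂ν = ∫ g, ∫ x, Real.log (stretch g x) ∂ν ∂μ := by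
  rw [integral_integral_swap_finSupp hμ fun g => integrable_of_continuous (continuous_log_stretch g)]
  simp_rw [drift, convPow_one]

/-- The Cesàro average of the first laws of the chain started at `x`. -/
def cesaro (μ : Measure SL2R) (n : ℕ) (x : RP1) : Measure RP1 :=
  (((n + 1 : ℕ) : ℝ≥0∞)⁻¹) • ∑ k ∈ Finset.range (n + 1), (convPow μ k).map fun g => g • x

lemma measurable_smul_right (x : RP1) : Measurable fun g : SL2R => g • x :=
  (continuous_id.smul continuous_const).measurable

instance (n : ℕ) (x : RP1) : IsProbabilityMeasure (cesaro μ n x) := by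
  refine ⟨?_⟩
  have (k : ℕ) : IsProbabilityMeasure ((convPow μ k).map fun g => g • x) :=
    Measure.isProbabilityMeasure_map (measurable_smul_right x).aemeasurable
  rw [cesaro, Measure.smul_apply, Measure.finsetSum_apply]
  simp only [measure_univ, Finset.sum_const, Finset.card_range, nsmul_eq_mul, mul_one, smul_eq_mul]
  exact ENNReal.inv_mul_cancel (by simp) (ENNReal.natCast_ne_top _)

lemma integral_cesaro (n : ℕ) (x : RP1) {f : RP1 → ℝ} (hf : Continuous f) :
    ∫ y, f y ∂(cesaro μ n x) =
      ((n : ℝ) + 1)⁻¹ * ∑ k ∈ Finset.range (n + 1), ∫ g, f (g • x) ∂(convPow μ k) := by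
  have (k : ℕ) : IsProbabilityMeasure ((convPow μ k).map fun g => g • x) :=
    Measure.isProbabilityMeasure_map (measurable_smul_right x).aemeasurable
  rw [cesaro, integral_smul_measure, integral_finsetSum_measure
    fun k _ => integrable_of_continuous hf]
  simp_rw [integral_map (measurable_smul_right x).aemeasurable hf.aestronglyMeasurable]
  rw [ENNReal.toReal_inv, ENNReal.toReal_natCast, smul_eq_mul]
  push_cast
  rfl

/-- If for every `n` some starting line had drift below `1`, the averaged laws of the chains started
there would accumulate at a stationary measure whose exponent is a limit of numbers at most `1 / (n
+ 1)`. That contradicts the positivity for every stationary measure. -/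
lemma exists_one_le_drift (hfin : μ.support.Finite)
    (hunb : IsUnbounded (generatedGroup μ)) (hirr : IsTotallyIrreducible (generatedGroup μ)) :
    ∃ n : ℕ, 0 < n ∧ ∀ x, 1 ≤ drift μ n x := by
  have hμ := finSupp_of_support_finite hfin
  by_contra! hcon
  choose! x hx using hcon
  -- `cesaro μ n` averages the `n + 1` laws at times `0, …, n`, so it integrates the one-step drift
  -- to `drift μ (n + 1) / (n + 1)`; hence the starting line with index `n + 1`. Limits along a
  -- nonprincipal ultrafilter replace the choice of a subsequence.
  let θ : ℕ → ProbabilityMeasure RP1 := fun n => ⟨cesaro μ n (x (n + 1)), inferInstance⟩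
  let U : Ultrafilter ℕ := hyperfilter ℕ
  have hU : (U : Filter ℕ) ≤ atTop := Nat.hyperfilter_le_atTop
  obtain ⟨θ₀, hθ₀⟩ : ∃ θ₀, Tendsto θ U (𝓝 θ₀) := by
    have := isCompact_univ.ultrafilter_le_nhds (U.map θ) (by simp)
    obtain ⟨θ₀, -, h⟩ := this
    exact ⟨θ₀, h⟩
  have hlim : ∀ f : RP1 → ℝ, Continuous f →
      Tendsto (fun n => ∫ y, f y ∂(cesaro μ n (x (n + 1)))) U (𝓝 (∫ y, f y ∂(θ₀ : Measure RP1))) :=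
    fun f hf => (ProbabilityMeasure.tendsto_iff_forall_integral_tendsto.1 hθ₀)
      (BoundedContinuousFunction.mkOfCompact ⟨f, hf⟩)
  have hinv : Tendsto (fun n : ℕ => ((n : ℝ) + 1)⁻¹) U (𝓝 0) := by
    have := (tendsto_one_div_add_atTop_nhds_zero_nat (𝕜 := ℝ)).mono_left hU
    simpa using this
  have hstat : IsStationaryMeasure μ (θ₀ : Measure RP1) := by
    refine isStationaryMeasure_of_integral fun f hf => ?_
    rw [integral_integral_swap_finSupp hμ fun g => integrable_comp_smul hf g]
    have hPf : Continuous fun y => ∫ g, f (g • y) ∂μ :=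
      continuous_integral_finSupp hμ fun g => hf.comp (continuous_smul_left g)
    obtain ⟨C, hC⟩ := isCompact_univ.exists_bound_of_continuousOn hf.continuousOn
    have h1 := (hlim _ hPf).sub (hlim f hf)
    -- One more step shifts the averaged laws by one, so the difference telescopes to two boundary
    -- terms and is at most `2 * C / (n + 1)`.
    have h2 : Tendsto (fun n => ∫ y, ∫ g, f (g • y) ∂μ ∂(cesaro μ n (x (n + 1))) -
        ∫ y, f y ∂(cesaro μ n (x (n + 1)))) U (𝓝 0) := by
      have hz : Tendsto (fun n : ℕ => ((n : ℝ) + 1)⁻¹ * (2 * C)) U (𝓝 0) := by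
        simpa using hinv.mul_const (2 * C)
      refine squeeze_zero_norm (fun n => ?_) hz
      rw [integral_cesaro _ _ hPf, integral_cesaro _ _ hf, ← mul_sub,
        ← Finset.sum_sub_distrib]
      have e : ∀ k, ∫ h, ∫ g, f (g • h • x (n + 1)) ∂μ ∂(convPow μ k) =
          ∫ g, f (g • x (n + 1)) ∂(convPow μ (k + 1)) := by
        intro k
        have hk := finSupp_convPow hμ k
        rw [convPow_succ', integral_mconv hμ hk]
        simp_rw [mul_smul]
        obtain ⟨T, hT⟩ := hμ
        obtain ⟨T', hT'⟩ := hk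
        simp_rw [FinSupp.integral_eq_sum hT, FinSupp.integral_eq_sum hT', Finset.mul_sum]
        rw [Finset.sum_comm]
        refine Finset.sum_congr rfl fun _ _ => Finset.sum_congr rfl fun _ _ => by ring
      simp_rw [e]
      rw [Finset.sum_range_sub (fun k => ∫ g, f (g • x (n + 1)) ∂(convPow μ k))]
      have hb : ∀ k, |∫ g, f (g • x (n + 1)) ∂(convPow μ k)| ≤ C := by
        intro k
        have := norm_integral_le_of_norm_le_const (μ := convPow μ k)
          (ae_of_all _ fun g : SL2R => hC (g • x (n + 1)) (Set.mem_univ _))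
        simpa using this
      rw [norm_mul, Real.norm_eq_abs, Real.norm_eq_abs, abs_of_pos (by positivity)]
      refine mul_le_mul_of_nonneg_left ?_ (by positivity)
      have h3 := hb (n + 1)
      have h4 := hb 0
      rw [abs_le] at h3 h4 ⊢
      constructor <;> linarith
    have := tendsto_nhds_unique h1 h2
    linarith
  have hpos := hstat.integral_log_stretch_pos hfin hunb hirr
  rw [← integral_drift_one hμ] at hpos
  have hle : ∫ y, drift μ 1 y ∂(θ₀ : Measure RP1) ≤ 0 := by
    refine le_of_tendsto_of_tendsto' (hlim _ (continuous_drift hμ 1)) hinv fun n => ?_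
    rw [integral_cesaro _ _ (continuous_drift hμ 1), ← drift_eq_sum hμ]
    have := hx (n + 1) n.succ_pos
    have h0 : 0 < ((n : ℝ) + 1)⁻¹ := by positivity
    nlinarith
  linarith

/-! ### Moments of the stretch -/

/-- The stretch is multiplicative along the walk, and the bound for the last `m` steps is uniform in
the line reached after the first `n`; so uniform moments are submultiplicative. -/
lemma moment_mul (hμ : FinSupp μ) {t a b : ℝ} {m n : ℕ} (ha0 : 0 ≤ a)
    (ha : ∀ x, ∫ g, stretch g x ^ t ∂(convPow μ m) ≤ a)
    (hb : ∀ x, ∫ g, stretch g x ^ t ∂(convPow μ n) ≤ b) (x : RP1) :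
    ∫ g, stretch g x ^ t ∂(convPow μ (m + n)) ≤ a * b := by
  have hm := finSupp_convPow hμ m
  have hn := finSupp_convPow hμ n
  rw [integral_convPow_add hμ]
  simp_rw [stretch_mul, Real.mul_rpow (stretch_pos _ _).le (stretch_pos _ _).le]
  have e : ∫ g, ∫ g', stretch g (g' • x) ^ t * stretch g' x ^ t ∂(convPow μ n) ∂(convPow μ m) =
      ∫ g', (∫ g, stretch g (g' • x) ^ t ∂(convPow μ m)) * stretch g' x ^ t ∂(convPow μ n) := by
    obtain ⟨T, hT⟩ := hm
    obtain ⟨T', hT'⟩ := hn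
    simp_rw [FinSupp.integral_eq_sum hT, FinSupp.integral_eq_sum hT', Finset.mul_sum,
      Finset.sum_mul, Finset.mul_sum]
    rw [Finset.sum_comm]
    refine Finset.sum_congr rfl fun _ _ => Finset.sum_congr rfl fun _ _ => by ring
  rw [e]
  calc _ ≤ ∫ g', a * stretch g' x ^ t ∂(convPow μ n) :=
        integral_mono (hn.integrable _) (hn.integrable _) fun g' =>
          mul_le_mul_of_nonneg_right (ha _) (Real.rpow_nonneg (stretch_pos _ _).le _)
    _ = a * ∫ g', stretch g' x ^ t ∂(convPow μ n) := integral_const_mul _ _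
    _ ≤ a * b := mul_le_mul_of_nonneg_left (hb x) ha0

lemma rpow_stretch_le (g : SL2R) (x : RP1) (t : ℝ) : stretch g x ^ t ≤ fro g ^ |t| := by
  rcases le_or_gt 0 t with ht | ht
  · rw [abs_of_nonneg ht]
    exact Real.rpow_le_rpow (stretch_pos _ _).le (stretch_le_fro g x) ht
  · rw [abs_of_neg ht, Real.rpow_neg (fro_pos g).le, ← Real.inv_rpow (fro_pos g).le]
    exact Real.rpow_le_rpow_of_nonpos (inv_pos.2 (fro_pos g)) (inv_fro_le_stretch g x) ht.le

/-- Division of `n` by `N` with remainder: the quotient contributes the exponential rate, the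
remainder only one of finitely many constants. -/
lemma moment_growth (hμ : FinSupp μ) {t β : ℝ} {N : ℕ} (hN : 0 < N)
    (h : ∀ x, ∫ g, stretch g x ^ t ∂(convPow μ N) ≤ Real.exp (N * β)) :
    ∃ C > 0, ∀ (n : ℕ) (x : RP1), ∫ g, stretch g x ^ t ∂(convPow μ n) ≤ C * Real.exp (n * β) := by
  let c : ℕ → ℝ := fun r => ∫ g, fro g ^ |t| ∂(convPow μ r)
  have hc0 : ∀ r, 0 ≤ c r := fun r => integral_nonneg fun g => Real.rpow_nonneg (fro_pos g).le _
  have hc : ∀ r x, ∫ g, stretch g x ^ t ∂(convPow μ r) ≤ c r := fun r x =>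
    integral_mono ((finSupp_convPow hμ r).integrable _) ((finSupp_convPow hμ r).integrable _)
      fun g => rpow_stretch_le g x t
  have hq : ∀ q x, ∫ g, stretch g x ^ t ∂(convPow μ (N * q)) ≤ Real.exp (N * q * β) := by
    intro q
    induction q with
    | zero => intro x; simp [convPow_zero, stretch_one]
    | succ q ih =>
      intro x
      have := moment_mul hμ (Real.exp_pos _).le ih h x
      rw [Nat.mul_succ]
      refine this.trans (le_of_eq ?_)
      rw [← Real.exp_add]; push_cast; ring_nf
  refine ⟨(∑ r ∈ Finset.range N, c r + 1) * Real.exp (N * |β|), mul_pos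
    (add_pos_of_nonneg_of_pos (Finset.sum_nonneg fun r _ => hc0 r) one_pos) (Real.exp_pos _),
    fun n x => ?_⟩
  have h1 := moment_mul hμ (Real.exp_pos _).le (hq (n / N)) (hc (n % N)) x
  rw [Nat.div_add_mod] at h1
  have h2 : c (n % N) ≤ ∑ r ∈ Finset.range N, c r + 1 :=
    (Finset.single_le_sum (fun r _ => hc0 r) (Finset.mem_range.2 (Nat.mod_lt n hN))).trans
      (by linarith)
  have h3 : Real.exp (N * (n / N : ℕ) * β) ≤ Real.exp (N * |β|) * Real.exp (n * β) := by
    rw [← Real.exp_add, Real.exp_le_exp]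
    have h4 : (n : ℝ) = N * (n / N : ℕ) + (n % N : ℕ) := by exact_mod_cast (Nat.div_add_mod n N).symm
    have h5 : ((n % N : ℕ) : ℝ) ≤ N := by exact_mod_cast (Nat.mod_lt n hN).le
    have h6 : -((n % N : ℕ) * β) ≤ N * |β| := by
      calc -((n % N : ℕ) * β) = (n % N : ℕ) * (-β) := by ring
        _ ≤ (n % N : ℕ) * |β| := mul_le_mul_of_nonneg_left (neg_le_abs β) (Nat.cast_nonneg _)
        _ ≤ N * |β| := mul_le_mul_of_nonneg_right h5 (abs_nonneg _)
    rw [h4]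
    nlinarith
  calc _ ≤ Real.exp (N * (n / N : ℕ) * β) * c (n % N) := h1
    _ ≤ (Real.exp (N * |β|) * Real.exp (n * β)) * (∑ r ∈ Finset.range N, c r + 1) := by
      gcongr
      exact hc0 _
    _ = _ := by ring

lemma abs_log_stretch_le (g : SL2R) (x : RP1) : |Real.log (stretch g x)| ≤ Real.log (fro g) := by
  rw [abs_le, ← Real.log_inv]
  exact ⟨Real.log_le_log (inv_pos.2 (fro_pos g)) (inv_fro_le_stretch g x),
    Real.log_le_log (stretch_pos g x) (stretch_le_fro g x)⟩

lemma exists_fro_bound {m : Measure SL2R} [IsFiniteMeasure m] (h : FinSupp m) :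
    ∃ L > 0, ∀ g, m {g} ≠ 0 → Real.log (fro g) ≤ L := by
  obtain ⟨T, hT⟩ := h
  refine ⟨∑ g ∈ T, Real.log (fro g) + 1, add_pos_of_nonneg_of_pos
    (Finset.sum_nonneg fun g _ => Real.log_nonneg (one_le_fro g)) one_pos, fun g hg => ?_⟩
  have hgT : g ∈ T := by
    by_contra h
    exact hg (measure_mono_null (by simpa using h) hT)
  exact (Finset.single_le_sum (fun g _ => Real.log_nonneg (one_le_fro g)) hgT).trans (by linarith)

/-- `log stretch` is bounded on the finite support, so the second-order Taylor bound for the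
exponential holds for small `t`, uniformly in the line, and `1 + u ≤ exp u` closes the estimate. -/
lemma moment_le_exp_drift (hμ : FinSupp μ) (n : ℕ) : ∃ L > 0, ∀ t : ℝ, |t| * L ≤ 1 → ∀ x,
    ∫ g, stretch g x ^ t ∂(convPow μ n) ≤ Real.exp (t * drift μ n x + t ^ 2 * L ^ 2) := by
  have hn := finSupp_convPow hμ n
  obtain ⟨L, hL0, hL⟩ := exists_fro_bound hn
  refine ⟨L, hL0, fun t ht x => ?_⟩
  calc ∫ g, stretch g x ^ t ∂(convPow μ n)
      ≤ ∫ g, (1 + t * Real.log (stretch g x) + t ^ 2 * L ^ 2) ∂(convPow μ n) := by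
        refine integral_mono_ae (hn.integrable _) (hn.integrable _) (hn.ae_iff.2 fun g hg => ?_)
        have h1 := (abs_log_stretch_le g x).trans (hL g hg)
        have h2 : |t * Real.log (stretch g x)| ≤ 1 := by
          rw [abs_mul]
          exact (mul_le_mul_of_nonneg_left h1 (abs_nonneg _)).trans ht
        have h3 := Real.abs_exp_sub_one_sub_id_le h2
        have h4 : (t * Real.log (stretch g x)) ^ 2 ≤ t ^ 2 * L ^ 2 := by
          rw [mul_pow]
          exact mul_le_mul_of_nonneg_left (sq_le_sq' (abs_le.1 h1).1 (abs_le.1 h1).2) (sq_nonneg _)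
        change stretch g x ^ t ≤ 1 + t * Real.log (stretch g x) + t ^ 2 * L ^ 2
        rw [Real.rpow_def_of_pos (stretch_pos g x), mul_comm]
        have := (abs_le.1 h3).2
        linarith
    _ = t * drift μ n x + t ^ 2 * L ^ 2 + 1 := by
        rw [integral_add (hn.integrable _) (hn.integrable _),
          integral_add (hn.integrable _) (hn.integrable _), integral_const_mul]
        simp [drift]
        ring
    _ ≤ _ := Real.add_one_le_exp _

/-- The inverse stretch has exponentially decaying moments. -/
lemma exists_moment_decay (hfin : μ.support.Finite)
    (hunb : IsUnbounded (generatedGroup μ)) (hirr : IsTotallyIrreducible (generatedGroup μ)) :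
    ∃ s : ℝ, 0 < s ∧ s ≤ 1 ∧ ∃ c > 0, ∃ C > 0, ∀ (n : ℕ) (x : RP1),
      ∫ g, stretch g x ^ (-(2 * s)) ∂(convPow μ n) ≤ C * Real.exp (-(c * n)) := by
  have hμ := finSupp_of_support_finite hfin
  obtain ⟨N, hN, hd⟩ := exists_one_le_drift hfin hunb hirr
  obtain ⟨L, hL0, hL⟩ := moment_le_exp_drift hμ N
  -- The second bound keeps `2 * s * L ≤ 1`, the range of the Taylor estimate; the third makes the
  -- quadratic error `4 * s ^ 2 * L ^ 2` at most `s`, half of the gain `2 * s` from a drift of at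
  -- least `1` over `N` steps.
  let s : ℝ := min 1 (min (1 / (2 * L)) (1 / (4 * L ^ 2)))
  have hs0 : 0 < s := by positivity
  have hs1 : s ≤ 1 := min_le_left _ _
  have hs2 : s * (2 * L) ≤ 1 := by
    rw [← le_div_iff₀ (by positivity)]; exact (min_le_right _ _).trans (min_le_left _ _)
  have hs3 : s * (4 * L ^ 2) ≤ 1 := by
    rw [← le_div_iff₀ (by positivity)]; exact (min_le_right _ _).trans (min_le_right _ _)
  have hN' : (0 : ℝ) < N := by exact_mod_cast hN
  obtain ⟨C, hC, h⟩ := moment_growth hμ (t := -(2 * s)) (β := -(s / N)) hN fun x => by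
    refine (hL (-(2 * s)) ?_ x).trans (Real.exp_le_exp.2 ?_)
    · rw [abs_neg, abs_of_pos (by positivity)]; linarith
    · have := hd x
      rw [mul_neg, mul_div_cancel₀ _ hN'.ne']
      nlinarith
  refine ⟨s, hs0, hs1, s / N, by positivity, C, hC, fun n x => (h n x).trans (le_of_eq ?_)⟩
  ring_nf

/-- The random walk contracts the projective line exponentially fast on average. -/
lemma exists_contraction (hfin : μ.support.Finite)
    (hunb : IsUnbounded (generatedGroup μ)) (hirr : IsTotallyIrreducible (generatedGroup μ)) :
    ∃ s : ℝ, 0 < s ∧ s ≤ 1 ∧ ∃ c > 0, ∃ C > 0, ∀ (n : ℕ) (x y : RP1),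
      ∫ g : SL2R, dist (g • x) (g • y) ^ s ∂(convPow μ n) ≤ C * Real.exp (-(c * n)) := by
  have hμ := finSupp_of_support_finite hfin
  obtain ⟨s, hs0, hs1, c, hc, C, hC, h⟩ := exists_moment_decay hfin hunb hirr
  refine ⟨s, hs0, hs1, c, hc, C, hC, fun n x y => ?_⟩
  have hn := finSupp_convPow hμ n
  -- The contraction factor is the inverse product of two stretches; the arithmetic–geometric mean
  -- inequality separates them, at the price of doubling the exponent to `2 * s`.
  calc ∫ g : SL2R, dist (g • x) (g • y) ^ s ∂(convPow μ n)
      ≤ ∫ g : SL2R, (1 / 2 * stretch g x ^ (-(2 * s)) + 1 / 2 * stretch g y ^ (-(2 * s)))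
          ∂(convPow μ n) := by
        refine integral_mono (hn.integrable _) (hn.integrable _) fun g => ?_
        have hx := stretch_pos g x
        have hy := stretch_pos g y
        change dist (g • x) (g • y) ^ s ≤ _
        rw [dist_smul_smul, div_eq_mul_inv, Real.mul_rpow dist_nonneg (by positivity), mul_inv,
          Real.mul_rpow (by positivity) (by positivity)]
        have e : ∀ a : ℝ, 0 < a → a ^ (-(2 * s)) = (a⁻¹ ^ s) ^ 2 := by
          intro a ha
          rw [Real.inv_rpow ha.le, ← Real.rpow_neg ha.le, ← Real.rpow_natCast, ← Real.rpow_mul ha.le]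
          congr 1; push_cast; ring
        rw [e _ hx, e _ hy]
        have h1 : dist x y ^ s ≤ 1 := Real.rpow_le_one dist_nonneg (dist_le_one x y) hs0.le
        have h2 : 0 ≤ (stretch g x)⁻¹ ^ s * (stretch g y)⁻¹ ^ s := by positivity
        nlinarith [sq_nonneg ((stretch g x)⁻¹ ^ s - (stretch g y)⁻¹ ^ s)]
    _ = 1 / 2 * ∫ g : SL2R, stretch g x ^ (-(2 * s)) ∂(convPow μ n) +
        1 / 2 * ∫ g : SL2R, stretch g y ^ (-(2 * s)) ∂(convPow μ n) := by
        rw [integral_add (hn.integrable _) (hn.integrable _), integral_const_mul,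
          integral_const_mul]
    _ ≤ _ := by
        have := h n x
        have := h n y
        linarith

/-- The squared stretch is affine in `emb`, with slope controlled by `fro g ^ 2`, and is bounded
below by `fro g ^ (-2)`. -/
lemma abs_log_stretch_sub_le (g : SL2R) (x y : RP1) :
    |Real.log (stretch g x) - Real.log (stretch g y)| ≤ fro g ^ 4 * dist x y := by
  wlog hxy : stretch g x ≤ stretch g y generalizing x y
  · rw [abs_sub_comm, dist_comm]
    exact this y x (not_le.1 hxy).le
  have hx := stretch_pos g x
  have hy := stretch_pos g y
  have hF := fro_pos g
  have h1 : Real.log (stretch g y) - Real.log (stretch g x) ≤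
      (stretch g y ^ 2 - stretch g x ^ 2) / stretch g x ^ 2 / 2 := by
    have := Real.log_le_sub_one_of_pos (show 0 < stretch g y ^ 2 / stretch g x ^ 2 by positivity)
    rw [Real.log_div (by positivity) (by positivity), Real.log_pow, Real.log_pow] at this
    push_cast at this
    rw [sub_div, div_self (by positivity)]
    linarith
  have h2 : stretch g y ^ 2 - stretch g x ^ 2 ≤ 2 * fro g ^ 2 * dist x y := by
    have hd := dist_eq_emb x y
    rw [Complex.dist_eq] at hd
    have hre : |(emb x).re - (emb y).re| ≤ dist x y := by
      rw [hd, ← Complex.sub_re]; exact Complex.abs_re_le_norm _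
    have him : |(emb x).im - (emb y).im| ≤ dist x y := by
      rw [hd, ← Complex.sub_im]; exact Complex.abs_im_le_norm _
    rw [stretch_sq, stretch_sq, fro_sq, stretchSq, stretchSq]
    have hA : |(g 0 0 ^ 2 + g 1 0 ^ 2) - (g 0 1 ^ 2 + g 1 1 ^ 2)| ≤
        g 0 0 ^ 2 + g 0 1 ^ 2 + g 1 0 ^ 2 + g 1 1 ^ 2 := by
      rw [abs_le]; constructor <;> nlinarith [sq_nonneg (g 0 0), sq_nonneg (g 0 1),
        sq_nonneg (g 1 0), sq_nonneg (g 1 1)]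
    have hB : |2 * (g 0 0 * g 0 1 + g 1 0 * g 1 1)| ≤
        g 0 0 ^ 2 + g 0 1 ^ 2 + g 1 0 ^ 2 + g 1 1 ^ 2 := by
      rw [abs_le]; constructor <;> nlinarith [sq_nonneg (g 0 0 + g 0 1),
        sq_nonneg (g 1 0 + g 1 1), sq_nonneg (g 0 0 - g 0 1), sq_nonneg (g 1 0 - g 1 1)]
    have h3 := mul_le_mul hA hre (abs_nonneg _) (by positivity)
    have h4 := mul_le_mul hB him (abs_nonneg _) (by positivity)
    rw [← abs_mul] at h3 h4
    have h5 := (abs_le.1 h3).1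
    have h6 := (abs_le.1 h4).1
    linarith
  have h3 : (stretch g x ^ 2)⁻¹ ≤ fro g ^ 2 := by
    rw [← inv_pow]
    have := inv_fro_le_stretch g x
    exact pow_le_pow_left₀ (by positivity) (inv_le_of_inv_le₀ hF this) 2
  rw [abs_sub_comm, abs_of_nonneg (sub_nonneg.2 (Real.log_le_log hx hxy))]
  refine h1.trans ?_
  rw [div_eq_mul_inv _ (stretch g x ^ 2)]
  have h4 : 0 ≤ stretch g y ^ 2 - stretch g x ^ 2 := by nlinarith
  have h5 := mul_le_mul h2 h3 (by positivity) (by positivity)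
  linarith

/-- The exponent of `μ` with respect to `ν`. -/
def exponent (μ : Measure SL2R) (ν : Measure RP1) : ℝ := ∫ x, drift μ 1 x ∂ν

/-- The chains from `x` and from a `ν`-random line approach each other exponentially fast, and the
latter stays distributed by `ν`. So the expected increment at time `k` differs from the exponent by
`O(e^{-ck})`, and these errors are summable. -/
lemma exists_drift_bound (hfin : μ.support.Finite) (hunb : IsUnbounded (generatedGroup μ))
    (hirr : IsTotallyIrreducible (generatedGroup μ)) [IsProbabilityMeasure ν]
    (hν : IsStationaryMeasure μ ν) :
    ∃ C > 0, ∀ (n : ℕ) (x : RP1), |drift μ n x - n * exponent μ ν| ≤ C := by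
  have hμ := finSupp_of_support_finite hfin
  obtain ⟨s, hs0, hs1, c, hc, C, hC, h⟩ := exists_contraction hfin hunb hirr
  let K : ℝ := ∫ g, fro g ^ 4 ∂μ
  have hK0 : 0 ≤ K := integral_nonneg fun g => by have := fro_pos g; positivity
  have hlip : ∀ x y, |drift μ 1 x - drift μ 1 y| ≤ K * dist x y := by
    intro x y
    rw [drift, drift, convPow_one, ← integral_sub (hμ.integrable _) (hμ.integrable _),
      ← integral_mul_const]
    exact (abs_integral_le_integral_abs).trans (integral_mono (hμ.integrable _) (hμ.integrable _)
      fun g => abs_log_stretch_sub_le g x y)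
  have hk : ∀ (k : ℕ) x, |∫ g, drift μ 1 (g • x) ∂(convPow μ k) - exponent μ ν| ≤
      K * C * Real.exp (-(c * k)) := by
    intro k x
    have hk := finSupp_convPow hμ k
    have e : exponent μ ν = ∫ y, ∫ g, drift μ 1 (g • y) ∂(convPow μ k) ∂ν := by
      rw [← integral_integral_swap_finSupp hk fun g =>
        integrable_comp_smul (continuous_drift hμ 1) g,
        (hν.convPow k).integral (continuous_drift hμ 1)]
      rfl
    have hcont : Continuous fun y => ∫ g, drift μ 1 (g • y) ∂(convPow μ k) :=
      continuous_integral_finSupp hk fun g => (continuous_drift hμ 1).comp (continuous_smul_left g)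
    have e2 : ∫ g, drift μ 1 (g • x) ∂(convPow μ k) - exponent μ ν =
        ∫ y, (∫ g, drift μ 1 (g • x) ∂(convPow μ k) - ∫ g, drift μ 1 (g • y) ∂(convPow μ k)) ∂ν := by
      rw [integral_sub (integrable_const _) (integrable_of_continuous hcont), e]
      simp
    rw [e2]
    have hb : ∀ y, ‖∫ g, drift μ 1 (g • x) ∂(convPow μ k) -
        ∫ g, drift μ 1 (g • y) ∂(convPow μ k)‖ ≤ K * C * Real.exp (-(c * k)) := by
      intro y
      rw [← integral_sub (hk.integrable _) (hk.integrable _)]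
      calc _ ≤ ∫ g, |drift μ 1 (g • x) - drift μ 1 (g • y)| ∂(convPow μ k) :=
            abs_integral_le_integral_abs
        _ ≤ ∫ g : SL2R, K * dist (g • x) (g • y) ^ s ∂(convPow μ k) := by
            refine integral_mono (hk.integrable _) (hk.integrable _) fun g => ?_
            refine (hlip _ _).trans (mul_le_mul_of_nonneg_left ?_ hK0)
            exact Real.self_le_rpow_of_le_one dist_nonneg (dist_le_one _ _) hs1
        _ = K * ∫ g : SL2R, dist (g • x) (g • y) ^ s ∂(convPow μ k) := integral_const_mul _ _
        _ ≤ K * (C * Real.exp (-(c * k))) := mul_le_mul_of_nonneg_left (h k x y) hK0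
        _ = _ := by ring
    have := norm_integral_le_of_norm_le_const (μ := ν) (ae_of_all _ hb)
    simpa using this
  have hsum : Summable fun k : ℕ => Real.exp (-(c * k)) := by
    have := Real.summable_exp_nat_mul_iff.2 (neg_neg_of_pos hc)
    refine this.congr fun k => by ring_nf
  refine ⟨K * C * ∑' k : ℕ, Real.exp (-(c * k)) + 1, by positivity, fun n x => ?_⟩
  have e : drift μ n x - n * exponent μ ν =
      ∑ k ∈ Finset.range n, (∫ g, drift μ 1 (g • x) ∂(convPow μ k) - exponent μ ν) := by
    rw [drift_eq_sum hμ, Finset.sum_sub_distrib]; simp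
  rw [e]
  calc _ ≤ ∑ k ∈ Finset.range n, K * C * Real.exp (-(c * k)) :=
        (Finset.abs_sum_le_sum_abs _ _).trans (Finset.sum_le_sum fun k _ => hk k x)
    _ = K * C * ∑ k ∈ Finset.range n, Real.exp (-(c * k)) := by rw [Finset.mul_sum]
    _ ≤ K * C * ∑' k : ℕ, Real.exp (-(c * k)) := mul_le_mul_of_nonneg_left
        (hsum.sum_le_tsum _ fun k _ => (Real.exp_pos _).le) (by positivity)
    _ ≤ _ := by linarith

/-- Exponential large deviation bounds for the stretch, uniformly in the starting point. -/
lemma exists_largeDeviation (hfin : μ.support.Finite) (hunb : IsUnbounded (generatedGroup μ))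
    (hirr : IsTotallyIrreducible (generatedGroup μ)) [IsProbabilityMeasure ν]
    (hν : IsStationaryMeasure μ ν) {ε : ℝ} (hε : 0 < ε) :
    ∃ c > 0, ∃ C > 0, ∀ (n : ℕ) (x : RP1),
      (convPow μ n).real {g | Real.exp (n * (exponent μ ν + ε)) ≤ stretch g x} ≤
        C * Real.exp (-(c * n)) ∧
      (convPow μ n).real {g | stretch g x ≤ Real.exp (n * (exponent μ ν - ε))} ≤
        C * Real.exp (-(c * n)) := by
  have hμ := finSupp_of_support_finite hfin
  obtain ⟨C₀, hC₀, hd⟩ := exists_drift_bound hfin hunb hirr hν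
  set χ := exponent μ ν
  -- Of the allowed excess `ε`, the bounded error `C₀` of the drift consumes at most a quarter over
  -- `N` steps. The choice of `t` below limits the quadratic error of the moment bound to another
  -- quarter; Markov's inequality profits from the remaining half.
  obtain ⟨N, hN⟩ := exists_nat_gt (4 * C₀ / ε)
  have hN0 : (0 : ℝ) < N := lt_trans (by positivity) hN
  have hN' : 0 < N := by exact_mod_cast hN0
  rw [div_lt_iff₀ hε] at hN
  obtain ⟨L, hL0, hL⟩ := moment_le_exp_drift hμ N
  let t : ℝ := min (1 / L) (N * ε / (4 * L ^ 2))
  have ht0 : 0 < t := by positivity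
  have ht1 : t * L ≤ 1 := by rw [← le_div_iff₀ hL0]; exact min_le_left _ _
  have ht2 : t * (4 * L ^ 2) ≤ N * ε := by
    rw [← le_div_iff₀ (by positivity)]; exact min_le_right _ _
  obtain ⟨C₁, hC₁, h₁⟩ := moment_growth hμ (t := t) (β := t * (χ + ε / 2)) hN' fun x => by
    refine (hL t (by rwa [abs_of_pos ht0]) x).trans (Real.exp_le_exp.2 ?_)
    have h := (abs_le.1 (hd N x)).2
    have h1 : t * drift μ N x ≤ t * (N * χ + C₀) := mul_le_mul_of_nonneg_left (by linarith) ht0.le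
    have h2 : t * (t * (4 * L ^ 2)) ≤ t * (N * ε) := mul_le_mul_of_nonneg_left ht2 ht0.le
    have h3 : t * (4 * C₀) ≤ t * (N * ε) := mul_le_mul_of_nonneg_left hN.le ht0.le
    nlinarith
  obtain ⟨C₂, hC₂, h₂⟩ := moment_growth hμ (t := -t) (β := -t * (χ - ε / 2)) hN' fun x => by
    refine (hL (-t) (by rwa [abs_neg, abs_of_pos ht0]) x).trans (Real.exp_le_exp.2 ?_)
    have h := (abs_le.1 (hd N x)).1
    have h1 : t * (N * χ - C₀) ≤ t * drift μ N x := mul_le_mul_of_nonneg_left (by linarith) ht0.le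
    have h2 : t * (t * (4 * L ^ 2)) ≤ t * (N * ε) := mul_le_mul_of_nonneg_left ht2 ht0.le
    have h3 : t * (4 * C₀) ≤ t * (N * ε) := mul_le_mul_of_nonneg_left hN.le ht0.le
    nlinarith
  have hmarkov : ∀ (n : ℕ) (x : RP1) (a r B : ℝ), ∫ g, stretch g x ^ r ∂(convPow μ n) ≤ B →
      (convPow μ n).real {g | Real.exp a ≤ stretch g x ^ r} ≤ B * Real.exp (-a) := by
    intro n x a r B hB
    have := mul_meas_ge_le_integral_of_nonneg (μ := convPow μ n)
      (ae_of_all _ fun g => Real.rpow_nonneg (stretch_pos g x).le r)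
      ((finSupp_convPow hμ n).integrable _) (Real.exp a)
    have h3 := this.trans hB
    rw [Real.exp_neg, ← div_eq_mul_inv, le_div_iff₀ (Real.exp_pos _), mul_comm]
    exact h3
  refine ⟨t * ε / 2, by positivity, max C₁ C₂, lt_max_of_lt_left hC₁, fun n x => ⟨?_, ?_⟩⟩
  · refine (measureReal_mono ?_).trans ((hmarkov n x (n * (t * (χ + ε))) t _ (h₁ n x)).trans ?_)
    · intro g hg
      change Real.exp (n * (t * (χ + ε))) ≤ stretch g x ^ t
      have := Real.rpow_le_rpow (Real.exp_pos _).le (show _ ≤ _ from hg) ht0.le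
      rw [← Real.exp_mul] at this
      refine le_trans (le_of_eq ?_) this
      ring_nf
    · rw [mul_assoc, ← Real.exp_add]
      refine mul_le_mul (le_max_left _ _) (Real.exp_le_exp.2 (le_of_eq (by ring)))
        (Real.exp_pos _).le (hC₁.le.trans (le_max_left _ _))
  · refine (measureReal_mono ?_).trans
      ((hmarkov n x (n * (-t * (χ - ε))) (-t) _ (h₂ n x)).trans ?_)
    · intro g hg
      change Real.exp (n * (-t * (χ - ε))) ≤ stretch g x ^ (-t)
      have := Real.rpow_le_rpow_of_nonpos (stretch_pos g x) (show _ ≤ _ from hg)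
        (neg_nonpos.2 ht0.le)
      rw [← Real.exp_mul] at this
      refine le_trans (le_of_eq ?_) this
      ring_nf
    · rw [mul_assoc, ← Real.exp_add]
      refine mul_le_mul (le_max_right _ _) (Real.exp_le_exp.2 (le_of_eq (by ring)))
        (Real.exp_pos _).le (hC₁.le.trans (le_max_left _ _))

end

end FurstenbergMeasure
end

open MeasureTheory Filter Topology
open scoped Matrix
open FurstenbergMeasure

set_option linter.unusedSectionVars false

noncomputable section

namespace FurstenbergMeasure

open scoped ENNReal Pointwise

/-! ### The space of trajectories -/

section

variable {μ : Measure SL2R} [IsProbabilityMeasure μ] {ν : Measure RP1}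

/-- The law of an i.i.d. sequence of matrices. -/
abbrev pathMeasure (μ : Measure SL2R) [IsProbabilityMeasure μ] : Measure (ℕ → SL2R) :=
  Measure.infinitePi fun _ : ℕ => μ

/-- The shift on sequences. -/
def shift {S : Type*} (X : ℕ → S) : ℕ → S := fun n => X (n + 1)

/-- Prepend a first term to a sequence. -/
def prepend {S : Type*} (p : S × (ℕ → S)) : ℕ → S := fun n => Nat.casesOn n p.1 p.2

lemma measurable_shift {S : Type*} [MeasurableSpace S] : Measurable (shift (S := S)) :=
  measurable_pi_lambda _ fun n => measurable_pi_apply (n + 1)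

lemma measurable_prepend {S : Type*} [MeasurableSpace S] : Measurable (prepend (S := S)) := by
  refine measurable_pi_lambda _ fun n => ?_
  cases n with
  | zero => exact measurable_fst
  | succ n => exact (measurable_pi_apply n).comp measurable_snd

/-- It suffices to compare cylinders, which may be taken to constrain exactly the coordinates `0, …,
n` by filling in `Set.univ`. Shift invariance and the Markov property of the walk follow from this.
-/
lemma map_prepend {S : Type*} [MeasurableSpace S] (m : Measure S) [IsProbabilityMeasure m] :
    (m.prod (Measure.infinitePi fun _ : ℕ => m)).map prepend = Measure.infinitePi fun _ : ℕ => m := by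
  classical
  refine Measure.eq_infinitePi _ fun s t ht => ?_
  obtain ⟨n, hn⟩ : ∃ n, s ⊆ Finset.range (n + 1) := by
    obtain ⟨n, hn⟩ := s.exists_nat_subset_range
    exact ⟨n, hn.trans (Finset.range_mono n.le_succ)⟩
  let t' : ℕ → Set S := fun i => if i ∈ s then t i else Set.univ
  have ht' : ∀ i, MeasurableSet (t' i) := fun i => by
    by_cases h : i ∈ s <;> simp [t', h, ht]
  have h1 : (s : Set ℕ).pi t = ((Finset.range (n + 1) : Finset ℕ) : Set ℕ).pi t' := by
    ext x
    simp only [Set.mem_pi, Finset.mem_coe, t']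
    constructor
    · intro h i _
      by_cases hi : i ∈ s
      · simpa [hi] using h i hi
      · simp [hi]
    · intro h i hi
      simpa [hi] using h i (hn hi)
  have h2 : ∏ i ∈ s, m (t i) = ∏ i ∈ Finset.range (n + 1), m (t' i) := by
    rw [← Finset.prod_subset hn fun i _ hi => by simp [t', hi]]
    exact Finset.prod_congr rfl fun i hi => by simp [t', hi]
  rw [h1, h2, Measure.map_apply measurable_prepend
    (MeasurableSet.pi (Finset.countable_toSet _) fun i _ => ht' i)]
  have h3 : prepend ⁻¹' ((Finset.range (n + 1) : Finset ℕ) : Set ℕ).pi t' =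
      t' 0 ×ˢ ((Finset.range n : Finset ℕ) : Set ℕ).pi fun i => t' (i + 1) := by
    ext ⟨a, x⟩
    simp only [Set.mem_preimage, Set.mem_pi, Finset.mem_coe, Finset.mem_range, Set.mem_prod]
    constructor
    · intro h
      exact ⟨h 0 n.succ_pos, fun i hi => h (i + 1) (Nat.succ_lt_succ hi)⟩
    · rintro ⟨h0, h⟩ i hi
      cases i with
      | zero => exact h0
      | succ i => exact h i (Nat.lt_of_succ_lt_succ hi)
  rw [h3, Measure.prod_prod, Measure.infinitePi_pi _ fun i _ => ht' (i + 1),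
    Finset.prod_range_succ', mul_comm]

lemma measurePreserving_zero_shift {S : Type*} [MeasurableSpace S] (m : Measure S)
    [IsProbabilityMeasure m] :
    MeasurePreserving (fun X : ℕ → S => (X 0, shift X)) (Measure.infinitePi fun _ : ℕ => m)
      (m.prod (Measure.infinitePi fun _ : ℕ => m)) := by
  have hm : Measurable fun X : ℕ → S => (X 0, shift X) :=
    (measurable_pi_apply 0).prodMk measurable_shift
  refine ⟨hm, ?_⟩
  conv_lhs => rw [← map_prepend m]
  rw [Measure.map_map hm measurable_prepend]
  exact Measure.map_id

lemma measurePreserving_shift {S : Type*} [MeasurableSpace S] (m : Measure S)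
    [IsProbabilityMeasure m] :
    MeasurePreserving (shift (S := S)) (Measure.infinitePi fun _ : ℕ => m)
      (Measure.infinitePi fun _ : ℕ => m) :=
  measurePreserving_snd.comp (measurePreserving_zero_shift m)

lemma shift_iterate {S : Type*} (n : ℕ) (X : ℕ → S) (k : ℕ) : shift^[n] X k = X (n + k) := by
  induction n generalizing X with
  | zero => simp
  | succ n ih => rw [Function.iterate_succ_apply, ih, shift]; congr 1; omega

/-- The product `X 0 * ⋯ * X (n - 1)`. -/
def rightProd (X : ℕ → SL2R) : ℕ → SL2R
  | 0 => 1
  | n + 1 => rightProd X n * X n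

lemma rightProd_succ' (X : ℕ → SL2R) (n : ℕ) :
    rightProd X (n + 1) = X 0 * rightProd (shift X) n := by
  induction n with
  | zero => simp [rightProd]
  | succ n ih => rw [rightProd, ih, rightProd, mul_assoc]; rfl

lemma measurePreserving_mul (m m' : Measure SL2R) :
    MeasurePreserving (fun p : SL2R × SL2R => p.1 * p.2) (m.prod m') (m.mconv m') :=
  ⟨measurable_mul, rfl⟩

/-- The product of the first `n` terms has law `convPow μ n` and is independent of the shifted
sequence; in particular it is independent of the limit point that the shifted sequence determines.
-/
lemma measurePreserving_rightProd (n : ℕ) :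
    MeasurePreserving (fun X : ℕ → SL2R => (rightProd X n, shift^[n] X)) (pathMeasure μ)
      ((convPow μ n).prod (pathMeasure μ)) := by
  induction n with
  | zero =>
    refine ⟨measurable_const.prodMk measurable_id, ?_⟩
    rw [convPow_zero, Measure.dirac_prod]
    rfl
  | succ n ih =>
    have h1 := ((MeasurePreserving.id (convPow μ n)).prod (measurePreserving_zero_shift μ)).comp ih
    have h2 := (measurePreserving_prodAssoc (convPow μ n) μ (pathMeasure μ)).symm _
    have h3 := ((measurePreserving_mul (convPow μ n) μ).prod (MeasurePreserving.id (pathMeasure μ)))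
    have h := h3.comp (h2.comp h1)
    convert! h using 1
    ext X : 1
    simp only [Function.comp_apply, Prod.map, rightProd, Function.iterate_succ_apply',
      MeasurableEquiv.prodAssoc, MeasurableEquiv.symm_mk, id]
    simp [shift_iterate]

lemma measurePreserving_leftProd (n : ℕ) :
    MeasurePreserving (fun X : ℕ → SL2R => (leftProd X n, shift^[n] X)) (pathMeasure μ)
      ((convPow μ n).prod (pathMeasure μ)) := by
  induction n with
  | zero =>
    refine ⟨measurable_const.prodMk measurable_id, ?_⟩
    rw [convPow_zero, Measure.dirac_prod]
    rfl
  | succ n ih =>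
    have h1 := ((MeasurePreserving.id (convPow μ n)).prod (measurePreserving_zero_shift μ)).comp ih
    have h2 := (measurePreserving_prodAssoc (convPow μ n) μ (pathMeasure μ)).symm _
    have h3 := ((measurePreserving_mul μ (convPow μ n)).comp
      (Measure.measurePreserving_swap (μ := convPow μ n) (ν := μ))).prod
      (MeasurePreserving.id (pathMeasure μ))
    have h := h3.comp (h2.comp h1)
    rw [convPow_succ']
    convert! h using 1
    ext X : 1
    simp only [Function.comp_apply, Prod.map, leftProd, Function.iterate_succ_apply',
      MeasurableEquiv.prodAssoc, MeasurableEquiv.symm_mk, id]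
    simp [shift_iterate]

lemma summable_exp_neg {c : ℝ} (hc : 0 < c) : Summable fun k : ℕ => Real.exp (-(c * k)) := by
  have := Real.summable_exp_nat_mul_iff.2 (neg_neg_of_pos hc)
  exact this.congr fun k => by ring_nf

lemma tsum_ofReal_exp_ne_top {c : ℝ} (hc : 0 < c) (C : ℝ) :
    ∑' n : ℕ, ENNReal.ofReal (C * Real.exp (-(c * n))) ≠ ∞ :=
  ((summable_exp_neg hc).mul_left C).tsum_ofReal_ne_top

/-- The series has finite expectation, hence is finite almost surely. -/
lemma ae_summable_of_integral_le {Ω : Type*} [MeasurableSpace Ω] {P : Measure Ω}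
    {f : ℕ → Ω → ℝ} (hf : ∀ n, Measurable (f n)) (hf0 : ∀ n ω, 0 ≤ f n ω) {c C : ℝ} (hc : 0 < c)
    (h : ∀ n, ∫⁻ ω, ENNReal.ofReal (f n ω) ∂P ≤ ENNReal.ofReal (C * Real.exp (-(c * n)))) :
    ∀ᵐ ω ∂P, Summable fun n => f n ω := by
  have h1 : ∫⁻ ω, ∑' n, ENNReal.ofReal (f n ω) ∂P ≠ ∞ := by
    rw [lintegral_tsum fun n => (hf n).ennreal_ofReal.aemeasurable]
    exact ne_top_of_le_ne_top (tsum_ofReal_exp_ne_top hc C) (ENNReal.tsum_le_tsum h)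
  filter_upwards [ae_lt_top (Measurable.tsum fun n => (hf n).ennreal_ofReal) h1] with ω hω
  have := ENNReal.summable_toReal hω.ne
  simpa [ENNReal.toReal_ofReal (hf0 _ ω)] using this

/-- Almost sure growth rates for processes with the law of the random walk. -/
lemma ae_eventually_stretch (hfin : μ.support.Finite) (hunb : IsUnbounded (generatedGroup μ))
    (hirr : IsTotallyIrreducible (generatedGroup μ)) [IsProbabilityMeasure ν]
    (hν : IsStationaryMeasure μ ν) {ε : ℝ} (hε : 0 < ε) {Ω : Type*} [MeasurableSpace Ω]
    {P : Measure Ω} {θ : Measure RP1} [IsProbabilityMeasure θ] {Z : ℕ → Ω → SL2R × RP1}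
    (hZ : ∀ n, MeasurePreserving (Z n) P ((convPow μ n).prod θ)) :
    ∀ᵐ ω ∂P, ∀ᶠ n : ℕ in atTop,
      Real.exp (n * (exponent μ ν - ε)) < stretch (Z n ω).1 (Z n ω).2 ∧
      stretch (Z n ω).1 (Z n ω).2 < Real.exp (n * (exponent μ ν + ε)) := by
  obtain ⟨c, hc, C, hC, h⟩ := exists_largeDeviation hfin hunb hirr hν hε
  let B : ℕ → Set (SL2R × RP1) := fun n =>
    {p | Real.exp (n * (exponent μ ν + ε)) ≤ stretch p.1 p.2} ∪
    {p | stretch p.1 p.2 ≤ Real.exp (n * (exponent μ ν - ε))}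
  have hm := continuous_stretch.measurable
  have hBm : ∀ n, MeasurableSet (B n) := fun n =>
    (measurableSet_le measurable_const hm).union (measurableSet_le hm measurable_const)
  have hB : ∀ n, P (Z n ⁻¹' B n) ≤ ENNReal.ofReal (2 * C * Real.exp (-(c * n))) := by
    intro n
    rw [(hZ n).measure_preimage (hBm n).nullMeasurableSet, Measure.prod_apply_symm (hBm n)]
    calc _ ≤ ∫⁻ _, ENNReal.ofReal (2 * C * Real.exp (-(c * n))) ∂θ := by
          refine lintegral_mono fun x => ?_
          rw [← ofReal_measureReal]
          refine ENNReal.ofReal_le_ofReal ((measureReal_union_le _ _).trans ?_)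
          exact (add_le_add (h n x).1 (h n x).2).trans (le_of_eq (by ring))
      _ = _ := by simp
  -- Borel–Cantelli. Only the law of each single `Z n` enters, so the same statement serves for left
  -- and right products, with a fixed or a random line.
  have h0 := measure_limsup_atTop_eq_zero (ne_top_of_le_ne_top (tsum_ofReal_exp_ne_top hc (2 * C))
    (ENNReal.tsum_le_tsum hB))
  have : ∀ᵐ ω ∂P, ω ∉ limsup (fun n => Z n ⁻¹' B n) atTop := measure_eq_zero_iff_ae_notMem.1 h0
  filter_upwards [this] with ω hω
  rw [mem_limsup_iff_frequently_mem, not_frequently] at hω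
  filter_upwards [hω] with n hn
  simp only [B, Set.mem_preimage, Set.mem_union, not_or] at hn
  exact ⟨not_le.1 hn.2, not_le.1 hn.1⟩

/-- The lines spanned by the two coordinate vectors. -/
def axis (i : Fin 2) : RP1 := Projectivization.mk ℝ (Pi.single i 1) (by simp)

lemma fro_sq_eq_stretch (g : SL2R) :
    fro g ^ 2 = stretch g (axis 0) ^ 2 + stretch g (axis 1) ^ 2 := by
  rw [axis, axis, stretch_mk, stretch_mk, Real.sq_sqrt (div_nonneg (nsq_nonneg _) (nsq_nonneg _)),
    Real.sq_sqrt (div_nonneg (nsq_nonneg _) (nsq_nonneg _)), fro_sq]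
  simp only [nsq, smul_vec_zero, smul_vec_one]
  simp
  ring

lemma fro_le_stretch_add (g : SL2R) : fro g ≤ stretch g (axis 0) + stretch g (axis 1) := by
  have h0 := stretch_pos g (axis 0)
  have h1 := stretch_pos g (axis 1)
  refine le_of_sq_le_sq ?_ (by positivity)
  rw [fro_sq_eq_stretch]
  nlinarith

lemma measurePreserving_mk_right {m : Measure SL2R} [SFinite m] (x : RP1) :
    MeasurePreserving (fun g : SL2R => (g, x)) m (m.prod (Measure.dirac x)) :=
  ⟨by fun_prop, by rw [Measure.prod_dirac]⟩

/-- Almost sure growth of the Frobenius norm. -/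
lemma ae_eventually_fro (hfin : μ.support.Finite) (hunb : IsUnbounded (generatedGroup μ))
    (hirr : IsTotallyIrreducible (generatedGroup μ)) [IsProbabilityMeasure ν]
    (hν : IsStationaryMeasure μ ν) {ε : ℝ} (hε : 0 < ε) {Ω : Type*} [MeasurableSpace Ω]
    {P : Measure Ω} {Z : ℕ → Ω → SL2R} (hZ : ∀ n, MeasurePreserving (Z n) P (convPow μ n)) :
    ∀ᵐ ω ∂P, ∀ᶠ n : ℕ in atTop,
      Real.exp (n * (exponent μ ν - ε)) < opNorm (Z n ω) ∧
      fro (Z n ω) < 2 * Real.exp (n * (exponent μ ν + ε)) := by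
  have h0 := ae_eventually_stretch hfin hunb hirr hν hε
    fun n => (measurePreserving_mk_right (axis 0)).comp (hZ n)
  have h1 := ae_eventually_stretch hfin hunb hirr hν hε
    fun n => (measurePreserving_mk_right (axis 1)).comp (hZ n)
  filter_upwards [h0, h1] with ω h0 h1
  filter_upwards [h0, h1] with n h0 h1
  simp only [Function.comp_apply] at h0 h1
  refine ⟨h0.1.trans_le (stretch_le_opNorm _ _), (fro_le_stretch_add _).trans_lt ?_⟩
  linarith [h0.2, h1.2]

/-- The operator norm lies between a stretch and the Frobenius norm, whose growth rates agree.
Tolerances `1 / (k + 1)` keep the number of almost sure events countable; dividing by `log 2` passes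
to base two. -/
lemma isLyapunovExponent_exponent (hfin : μ.support.Finite) (hunb : IsUnbounded (generatedGroup μ))
    (hirr : IsTotallyIrreducible (generatedGroup μ)) [IsProbabilityMeasure ν]
    (hν : IsStationaryMeasure μ ν) : IsLyapunovExponent μ (exponent μ ν / Real.log 2) := by
  have h : ∀ k : ℕ, ∀ᵐ X ∂(pathMeasure μ), ∀ᶠ n : ℕ in atTop,
      Real.exp (n * (exponent μ ν - 1 / ((k : ℝ) + 1))) < opNorm (leftProd X n) ∧
      fro (leftProd X n) < 2 * Real.exp (n * (exponent μ ν + 1 / ((k : ℝ) + 1))) := fun k =>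
    ae_eventually_fro hfin hunb hirr hν (by positivity) fun n =>
      measurePreserving_fst.comp (measurePreserving_leftProd n)
  filter_upwards [ae_all_iff.2 h] with X hX
  have hlim : Tendsto (fun n : ℕ => 1 / (n : ℝ) * Real.log (opNorm (leftProd X n))) atTop
      (𝓝 (exponent μ ν)) := by
    rw [Metric.tendsto_atTop']
    intro ε hε
    obtain ⟨k, hk⟩ := exists_nat_one_div_lt (half_pos hε)
    obtain ⟨N, hN⟩ := exists_nat_gt (2 * Real.log 2 / ε)
    obtain ⟨N', hN'⟩ := eventually_atTop.1 (hX k)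
    refine ⟨max N N', fun n hn => ?_⟩
    have hnN : (N : ℝ) < n := by exact_mod_cast (le_max_left _ _).trans_lt hn
    have hn0 : (0 : ℝ) < n := lt_of_le_of_lt (Nat.cast_nonneg _) hnN
    obtain ⟨h1, h2⟩ := hN' n ((le_max_right _ _).trans hn.le)
    have hop : 0 < opNorm (leftProd X n) := (Real.exp_pos _).trans h1
    have h1' := Real.log_lt_log (Real.exp_pos _) h1
    have h2' := Real.log_lt_log hop ((opNorm_le_fro _).trans_lt h2)
    rw [Real.log_exp] at h1'
    rw [Real.log_mul two_ne_zero (Real.exp_pos _).ne', Real.log_exp] at h2'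
    have h3 := hN.trans hnN
    rw [div_lt_iff₀ hε] at h3
    rw [Real.dist_eq, one_div_mul_eq_div, abs_lt]
    have e : ∀ a b : ℝ, a / n - b = (a - n * b) / n := by intro a b; field_simp
    rw [e, lt_div_iff₀ hn0, div_lt_iff₀ hn0]
    constructor <;> nlinarith
  have := hlim.div_const (Real.log 2)
  refine this.congr fun n => ?_
  rw [Real.logb]; ring

lemma exists_contraction_dist (hfin : μ.support.Finite)
    (hunb : IsUnbounded (generatedGroup μ)) (hirr : IsTotallyIrreducible (generatedGroup μ)) :
    ∃ c > 0, ∃ C > 0, ∀ (n : ℕ) (x y : RP1),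
      ∫⁻ g : SL2R, ENNReal.ofReal (dist (g • x) (g • y)) ∂(convPow μ n) ≤
        ENNReal.ofReal (C * Real.exp (-(c * n))) := by
  obtain ⟨s, hs0, hs1, c, hc, C, hC, h⟩ := exists_contraction hfin hunb hirr
  refine ⟨c, hc, C, hC, fun n x y => ?_⟩
  have hn := finSupp_convPow (finSupp_of_support_finite hfin) n
  rw [← ofReal_integral_eq_lintegral_ofReal (hn.integrable _) (ae_of_all _ fun g => dist_nonneg)]
  refine ENNReal.ofReal_le_ofReal (le_trans ?_ (h n x y))
  exact integral_mono (hn.integrable _) (hn.integrable _) fun g =>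
    Real.self_le_rpow_of_le_one dist_nonneg (dist_le_one _ _) hs1

lemma measurable_rightProd (n : ℕ) : Measurable fun X : ℕ → SL2R => rightProd X n := by
  induction n with
  | zero => unfold rightProd; fun_prop
  | succ n ih => exact ih.mul (measurable_pi_apply n)

lemma measurable_rightProd_smul (n : ℕ) (x : RP1) :
    Measurable fun X : ℕ → SL2R => rightProd X n • x :=
  (measurable_smul_right x).comp (measurable_rightProd n)

lemma measurePreserving_rightProd_apply (n : ℕ) :
    MeasurePreserving (fun X : ℕ → SL2R => (rightProd X n, X n)) (pathMeasure μ)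
      ((convPow μ n).prod μ) := by
  have h := ((MeasurePreserving.id (convPow μ n)).prod
    (measurePreserving_eval_infinitePi (fun _ : ℕ => μ) 0)).comp
      (measurePreserving_rightProd (μ := μ) n)
  convert! h using 1
  ext X : 1
  simp [Prod.map, shift_iterate]

/-- In a right product the new factor acts first: the two points are the images of `x` and `X n • x`
under the same product, which is independent of `X n` and contracts. The points therefore converge,
unlike those of left products. -/
lemma lintegral_dist_rightProd_le {B : ℝ≥0∞} (n : ℕ)
    (h : ∀ x y : RP1, ∫⁻ g : SL2R, ENNReal.ofReal (dist (g • x) (g • y)) ∂(convPow μ n) ≤ B)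
    (x : RP1) :
    ∫⁻ X, ENNReal.ofReal (dist (rightProd X n • x) (rightProd X (n + 1) • x)) ∂(pathMeasure μ) ≤
      B := by
  obtain ⟨F, hF⟩ : ∃ F : SL2R × SL2R → ℝ≥0∞,
      F = fun p => ENNReal.ofReal (dist (p.1 • x) (p.1 • p.2 • x)) := ⟨_, rfl⟩
  have hm : Measurable F := by
    rw [hF]
    refine (Measurable.dist ?_ ?_).ennreal_ofReal
    · exact (measurable_smul_right x).comp measurable_fst
    · exact measurable_act.comp
        (measurable_fst.prodMk ((measurable_smul_right x).comp measurable_snd))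
  have h3 := (measurePreserving_rightProd_apply (μ := μ) n).lintegral_comp hm
  have e : ∀ X : ℕ → SL2R, ENNReal.ofReal (dist (rightProd X n • x) (rightProd X (n + 1) • x)) =
      F (rightProd X n, X n) := by
    intro X
    rw [hF, rightProd, mul_smul]
  rw [lintegral_congr e, h3, lintegral_prod_symm _ hm.aemeasurable]
  calc _ ≤ ∫⁻ _, B ∂μ := lintegral_mono fun g => by
        simp only [hF]
        exact h _ _
    _ = _ := by simp

/-- The boundary map: the limit point of the random walk on the projective line. -/
lemma exists_boundaryMap (hfin : μ.support.Finite) (hunb : IsUnbounded (generatedGroup μ))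
    (hirr : IsTotallyIrreducible (generatedGroup μ)) [IsProbabilityMeasure ν]
    (hν : IsStationaryMeasure μ ν) : ∃ z : (ℕ → SL2R) → RP1,
      MeasurePreserving z (pathMeasure μ) ν ∧ ∀ᵐ X ∂(pathMeasure μ), z X = X 0 • z (shift X) := by
  obtain ⟨c, hc, C, hC, h⟩ := exists_contraction_dist hfin hunb hirr
  obtain ⟨x₀⟩ : Nonempty RP1 := ⟨axis 0⟩
  have hmY (n : ℕ) : Measurable fun X : ℕ → SL2R => rightProd X n • x₀ :=
    measurable_rightProd_smul n x₀
  have hconv : ∀ᵐ X ∂(pathMeasure μ), ∃ l, Tendsto (fun n => rightProd X n • x₀) atTop (𝓝 l) := by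
    have := ae_summable_of_integral_le (P := pathMeasure μ)
      (f := fun n X => dist (rightProd X n • x₀) (rightProd X (n + 1) • x₀))
      (fun n => (hmY n).dist (hmY (n + 1))) (fun _ _ => dist_nonneg) hc (C := C)
      (fun n => lintegral_dist_rightProd_le n (h n) x₀)
    filter_upwards [this] with X hX
    exact cauchySeq_tendsto_of_complete (cauchySeq_of_summable_dist hX)
  obtain ⟨z, hz, hlim⟩ := measurable_limit_of_tendsto_metrizable_ae
    (fun n => (hmY n).aemeasurable) hconv
  refine ⟨z, ⟨hz, ?_⟩, ?_⟩
  · have := Measure.isProbabilityMeasure_map (μ := pathMeasure μ) hz.aemeasurable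
    refine ext_of_forall_integral_eq_of_IsFiniteMeasure fun f => ?_
    rw [integral_map hz.aemeasurable f.continuous.aestronglyMeasurable]
    have hmYx : ∀ n, Measurable fun p : (ℕ → SL2R) × RP1 => rightProd p.1 n • p.2 := fun n =>
      measurable_act.comp (((measurable_rightProd n).comp measurable_fst).prodMk measurable_snd)
    -- Contraction makes the limit independent of the starting point. Started from a `ν`-random
    -- point the process has law `ν` at every time by stationarity, so the limit has law `ν`.
    have h1 : ∀ᵐ p ∂((pathMeasure μ).prod ν),
        Tendsto (fun n => rightProd p.1 n • p.2) atTop (𝓝 (z p.1)) := by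
      have hs := ae_summable_of_integral_le (P := (pathMeasure μ).prod ν)
        (f := fun n p => dist (rightProd p.1 n • x₀) (rightProd p.1 n • p.2))
        (fun n => ((hmY n).comp measurable_fst).dist (hmYx n)) (fun _ _ => dist_nonneg) hc (C := C)
        fun n => by
          have hmn : Measurable fun p : (ℕ → SL2R) × RP1 =>
              ENNReal.ofReal (dist (rightProd p.1 n • x₀) (rightProd p.1 n • p.2)) :=
            (((hmY n).comp measurable_fst).dist (hmYx n)).ennreal_ofReal
          rw [lintegral_prod_symm _ hmn.aemeasurable]
          calc _ ≤ ∫⁻ _, ENNReal.ofReal (C * Real.exp (-(c * n))) ∂ν := by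
                refine lintegral_mono fun x => le_trans (le_of_eq ?_) (h n x₀ x)
                have hm : Measurable fun g : SL2R => ENNReal.ofReal (dist (g • x₀) (g • x)) :=
                  ((measurable_smul_right x₀).dist (measurable_smul_right x)).ennreal_ofReal
                exact (measurePreserving_fst.comp (measurePreserving_rightProd n)).lintegral_comp hm
            _ = _ := by simp
      have hl := Measure.quasiMeasurePreserving_fst (μ := pathMeasure μ) (ν := ν) |>.ae hlim
      filter_upwards [hs, hl] with p hp hl
      exact (tendsto_iff_of_dist hp.tendsto_atTop_zero).1 hl
    have h2 : Tendsto (fun n => ∫ p, f (rightProd p.1 n • p.2) ∂((pathMeasure μ).prod ν)) atTop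
        (𝓝 (∫ p, f (z p.1) ∂((pathMeasure μ).prod ν))) := by
      refine tendsto_integral_of_dominated_convergence (fun _ => ‖f‖) (fun n => ?_)
        (integrable_const _) (fun n => ae_of_all _ fun p => f.norm_coe_le_norm _) ?_
      · exact (f.continuous.measurable.comp (hmYx n)).aestronglyMeasurable
      · filter_upwards [h1] with p hp
        exact (f.continuous.tendsto _).comp hp
    have h3 : ∀ n, ∫ p, f (rightProd p.1 n • p.2) ∂((pathMeasure μ).prod ν) = ∫ x, f x ∂ν := by
      intro n
      have hmp := (measurePreserving_fst.comp (measurePreserving_rightProd (μ := μ) n)).prod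
        (MeasurePreserving.id ν)
      have hm : AEStronglyMeasurable (fun p : SL2R × RP1 => f (p.1 • p.2))
          ((convPow μ n).prod ν) := (f.continuous.comp continuous_smul).aestronglyMeasurable
      have h5 := integral_map hmp.measurable.aemeasurable (by rwa [hmp.map_eq])
      rw [hmp.map_eq, ← integral_map measurable_act.aemeasurable
        f.continuous.aestronglyMeasurable, hν.convPow n] at h5
      exact h5.symm
    simp_rw [h3] at h2
    rw [← tendsto_nhds_unique h2 tendsto_const_nhds, integral_fun_fst (fun X => f (z X))]
    simp
  · have hl := (measurePreserving_shift μ).quasiMeasurePreserving.ae hlim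
    filter_upwards [hlim, hl] with X h1 h2
    have h3 := h2.const_smul (X 0)
    simp_rw [← mul_smul, ← rightProd_succ'] at h3
    exact tendsto_nhds_unique (h1.comp (tendsto_add_atTop_nat 1)) h3

end

end FurstenbergMeasure
end

open MeasureTheory Filter Topology
open scoped Matrix
open FurstenbergMeasure

set_option linter.unusedSectionVars false

noncomputable section

namespace FurstenbergMeasure

open scoped ENNReal

/-! ### The maximal ergodic inequality and the ergodic theorem for Bernoulli shifts -/

section

variable {Ω : Type*} [MeasurableSpace Ω] {P : Measure Ω} {T : Ω → Ω}

/-- The maximum of the first Birkhoff sums. -/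
def maxSum (T : Ω → Ω) (g : Ω → ℝ) : ℕ → Ω → ℝ
  | 0 => 0
  | N + 1 => fun ω => max 0 (g ω + maxSum T g N (T ω))

lemma maxSum_nonneg (g : Ω → ℝ) (N : ℕ) (ω : Ω) : 0 ≤ maxSum T g N ω := by
  cases N with
  | zero => exact le_rfl
  | succ N => exact le_max_left _ _

lemma maxSum_le_succ (g : Ω → ℝ) (N : ℕ) (ω : Ω) : maxSum T g N ω ≤ maxSum T g (N + 1) ω := by
  induction N generalizing ω with
  | zero => exact maxSum_nonneg g 1 ω
  | succ N ih => exact max_le_max le_rfl (add_le_add le_rfl (ih (T ω)))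

lemma birkhoffSum_le_maxSum (g : Ω → ℝ) (N : ℕ) (ω : Ω) :
    birkhoffSum T g N ω ≤ maxSum T g N ω := by
  induction N generalizing ω with
  | zero => simp [maxSum]
  | succ N ih =>
    rw [birkhoffSum_succ']
    exact (add_le_add le_rfl (ih (T ω))).trans (le_max_right _ _)

lemma measurable_maxSum (hT : Measurable T) {g : Ω → ℝ} (hg : Measurable g) (N : ℕ) :
    Measurable (maxSum T g N) := by
  induction N with
  | zero => exact measurable_const
  | succ N ih => exact measurable_const.max (hg.add (ih.comp hT))

lemma integrable_maxSum (hT : MeasurePreserving T P P) {g : Ω → ℝ} (hgi : Integrable g P) (N : ℕ) :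
    Integrable (maxSum T g N) P := by
  induction N with
  | zero => exact integrable_zero _ _ _
  | succ N ih =>
    have : Integrable (fun ω => g ω + maxSum T g N (T ω)) P :=
      hgi.add (hT.integrable_comp_of_integrable ih)
    exact (integrable_zero _ _ _).sup this

/-- Hopf's maximal ergodic lemma. -/
lemma setIntegral_maxSum_nonneg (hT : MeasurePreserving T P P) {g : Ω → ℝ} (hg : Measurable g)
    (hgi : Integrable g P) (N : ℕ) : 0 ≤ ∫ ω in {ω | 0 < maxSum T g N ω}, g ω ∂P := by
  have hm := measurable_maxSum hT.measurable hg N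
  have hE : MeasurableSet {ω | 0 < maxSum T g N ω} := measurableSet_lt measurable_const hm
  have hi := integrable_maxSum hT hgi N
  have hiT : Integrable (fun ω => maxSum T g N (T ω)) P := hT.integrable_comp_of_integrable hi
  have h1 : ∫ ω, maxSum T g N (T ω) ∂P = ∫ ω, maxSum T g N ω ∂P := by
    conv_rhs => rw [← hT.map_eq, integral_map hT.measurable.aemeasurable hm.aestronglyMeasurable]
  rw [← integral_indicator hE]
  -- Where the maximum `M_N` is positive it equals `g + M_{N-1} ∘ T ≤ g + M_N ∘ T`; elsewhere it is
  -- zero. So `M_N - M_N ∘ T`, which has integral zero, is bounded by `g` restricted to that set.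
  calc (0 : ℝ) = ∫ ω, (maxSum T g N ω - maxSum T g N (T ω)) ∂P := by
        rw [integral_sub hi hiT, h1, sub_self]
    _ ≤ _ := by
        refine integral_mono (hi.sub hiT) (hgi.indicator hE) fun ω => ?_
        by_cases h : 0 < maxSum T g N ω
        · simp only [Set.indicator, Set.mem_ofPred_eq, h, if_true]
          cases N with
          | zero => exact absurd h (lt_irrefl _)
          | succ N =>
            have h2 : maxSum T g (N + 1) ω = g ω + maxSum T g N (T ω) := by
              rcases max_choice 0 (g ω + maxSum T g N (T ω)) with h3 | h3
              · exact absurd h3 h.ne'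
              · exact h3
            have := maxSum_le_succ (T := T) g N (T ω)
            linarith
        · simp only [Set.indicator, Set.mem_ofPred_eq, h, if_false]
          have := maxSum_nonneg (T := T) g N (T ω)
          linarith [not_lt.1 h]

/-- The sets in the maximal lemma increase with `N` and exhaust the space up to a null set. -/
lemma integral_nonneg_of_ae_exists (hT : MeasurePreserving T P P) {g : Ω → ℝ} (hg : Measurable g)
    (hgi : Integrable g P) (h : ∀ᵐ ω ∂P, ∃ n, 0 < birkhoffSum T g n ω) : 0 ≤ ∫ ω, g ω ∂P := by
  have hE : ∀ N, MeasurableSet {ω | 0 < maxSum T g N ω} := fun N =>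
    measurableSet_lt measurable_const (measurable_maxSum hT.measurable hg N)
  have hmono : Monotone fun N => {ω | 0 < maxSum T g N ω} :=
    monotone_nat_of_le_succ fun N ω hω => lt_of_lt_of_le hω (maxSum_le_succ g N ω)
  have h1 := tendsto_setIntegral_of_monotone hE hmono hgi.integrableOn
  have h2 : ∫ ω in ⋃ N, {ω | 0 < maxSum T g N ω}, g ω ∂P = ∫ ω, g ω ∂P := by
    rw [Measure.restrict_eq_self_of_ae_mem]
    filter_upwards [h] with ω hω
    obtain ⟨n, hn⟩ := hω
    exact Set.mem_iUnion.2 ⟨n, hn.trans_le (birkhoffSum_le_maxSum g n ω)⟩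
  rw [h2] at h1
  exact ge_of_tendsto' h1 fun N => setIntegral_maxSum_nonneg hT hg hgi N

lemma birkhoffSum_sub_const (f : Ω → ℝ) (a : ℝ) (n : ℕ) (ω : Ω) :
    birkhoffSum T (fun ω => f ω - a) n ω = birkhoffSum T f n ω - n * a := by
  simp [birkhoffSum, Finset.sum_sub_distrib]

end

section

open ProbabilityTheory

variable {S : Type*} [MeasurableSpace S] {m : Measure S} [IsProbabilityMeasure m]

/-- Shift-invariant sets are trivial for a Bernoulli measure. -/
lemma measure_zero_or_one_of_shift_invariant {B : Set (ℕ → S)} (hB : MeasurableSet B)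
    (hinv : shift ⁻¹' B = B) : (Measure.infinitePi fun _ : ℕ => m) B = 0 ∨
      (Measure.infinitePi fun _ : ℕ => m) B = 1 := by
  have hi : iIndepFun (fun (n : ℕ) (X : ℕ → S) => X n) (Measure.infinitePi fun _ : ℕ => m) :=
    iIndepFun_infinitePi (X := fun _ x => x) fun _ => measurable_id
  refine measure_zero_or_one_of_measurableSet_limsup_atTop
    (fun n => (measurable_pi_apply n).comap_le) hi ?_
  rw [limsup_eq_iInf_iSup_of_nat, MeasurableSpace.measurableSet_iInf]
  intro n
  -- An invariant set equals its preimage under every iterate, so it depends only on the coordinates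
  -- from `n` on: it is a tail event, and Kolmogorov's zero-one law applies.
  have hn : ∀ n : ℕ, shift^[n] ⁻¹' B = B := by
    intro n
    induction n with
    | zero => rfl
    | succ n ih => rw [Function.iterate_succ, Set.preimage_comp, ih, hinv]
  have hm : @Measurable _ _ (⨆ i ≥ n, MeasurableSpace.comap (fun X : ℕ → S => X i) inferInstance) _
      (shift^[n] : (ℕ → S) → (ℕ → S)) := by
    refine @measurable_pi_lambda _ _ _ (_) _ _ fun k => ?_
    have e : (fun X : ℕ → S => shift^[n] X k) = fun X => X (n + k) := by
      ext X; exact shift_iterate n X k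
    rw [e]
    refine Measurable.mono (comap_measurable _) ?_ le_rfl
    exact le_iSup₂_of_le (n + k) (Nat.le_add_right n k) le_rfl
  have := hm hB
  rwa [hn n] at this

/-- That the sums exceed some positive linear rate infinitely often is a shift-invariant event. If
it had full measure, some Birkhoff sum would almost surely be positive, and the maximal inequality
would contradict the negative integral. -/
lemma ae_eventually_birkhoffSum_le {g : (ℕ → S) → ℝ} (hg : Measurable g)
    (hgi : Integrable g (Measure.infinitePi fun _ : ℕ => m))
    (hneg : ∫ X, g X ∂(Measure.infinitePi fun _ : ℕ => m) < 0) {q : ℝ} (hq : 0 < q) :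
    ∀ᵐ X ∂(Measure.infinitePi fun _ : ℕ => m), ∀ᶠ n : ℕ in atTop, birkhoffSum shift g n X ≤ n * q := by
  set P := Measure.infinitePi fun _ : ℕ => m
  have hS : ∀ n, Measurable fun X => birkhoffSum shift g n X := fun n => by
    unfold birkhoffSum
    exact Finset.measurable_sum _ fun k _ => hg.comp (measurable_shift.iterate k)
  let B : Set (ℕ → S) := {X | ∃ j : ℕ, ∀ N : ℕ, ∃ n ≥ N, n * (1 / ((j : ℝ) + 1)) <
    birkhoffSum shift g n X}
  have hBm : MeasurableSet B := by
    have : B = ⋃ j : ℕ, ⋂ N : ℕ, ⋃ n ≥ N, {X | n * (1 / ((j : ℝ) + 1)) <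
        birkhoffSum shift g n X} := by ext; simp [B]
    rw [this]
    exact MeasurableSet.iUnion fun j => MeasurableSet.iInter fun N => MeasurableSet.iUnion fun n =>
      MeasurableSet.iUnion fun _ => measurableSet_lt measurable_const (hS n)
  -- Shifting adds or removes one term of the sum. Passing from `j` to `2 * j + 1` halves the rate,
  -- and the freed half absorbs any constant for large `n`.
  have key : ∀ (c a : ℝ) (j : ℕ), ∃ N₀ : ℕ, ∀ n ≥ N₀, n * (1 / ((2 * j + 1 : ℕ) + 1 : ℝ)) + a ≤
      n * (1 / ((j : ℝ) + 1)) + c := by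
    intro c a j
    obtain ⟨N₀, hN₀⟩ := exists_nat_gt ((a - c) * (2 * ((j : ℝ) + 1)))
    refine ⟨N₀, fun n hn => ?_⟩
    have h1 : (N₀ : ℝ) ≤ n := by exact_mod_cast hn
    have h2 : (0 : ℝ) < (j : ℝ) + 1 := by positivity
    have e : (((2 * j + 1 : ℕ) : ℝ) + 1) = 2 * ((j : ℝ) + 1) := by push_cast; ring
    rw [e]
    have e2 : (n : ℝ) * (1 / ((j : ℝ) + 1)) = 2 * (n * (1 / (2 * ((j : ℝ) + 1)))) := by
      field_simp
    have h3 : (a - c) ≤ n * (1 / (2 * ((j : ℝ) + 1))) := by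
      rw [mul_one_div, le_div_iff₀ (by positivity)]
      linarith
    linarith
  have hinv : shift ⁻¹' B = B := by
    ext X
    constructor
    · rintro ⟨j, hj⟩
      refine ⟨2 * j + 1, fun N => ?_⟩
      obtain ⟨N₀, hN₀⟩ := key (g X) (1 / ((2 * j + 1 : ℕ) + 1 : ℝ)) j
      obtain ⟨n, hn, h⟩ := hj (max N N₀)
      refine ⟨n + 1, ((le_max_left _ _).trans hn).trans n.le_succ, ?_⟩
      rw [birkhoffSum_succ']
      have := hN₀ n ((le_max_right _ _).trans hn)
      push_cast at this h ⊢
      linarith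
    · rintro ⟨j, hj⟩
      refine ⟨2 * j + 1, fun N => ?_⟩
      obtain ⟨N₀, hN₀⟩ := key (1 / ((j : ℝ) + 1)) (g X) j
      obtain ⟨n, hn, h⟩ := hj (max N N₀ + 1)
      obtain ⟨n, rfl⟩ : ∃ k, n = k + 1 := ⟨n - 1, by omega⟩
      have hn' : max N N₀ ≤ n := by omega
      refine ⟨n, (le_max_left _ _).trans hn', ?_⟩
      rw [birkhoffSum_succ'] at h
      have := hN₀ n ((le_max_right _ _).trans hn')
      push_cast at this h ⊢
      linarith
  have hB0 : P B = 0 := by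
    rcases measure_zero_or_one_of_shift_invariant (m := m) hBm hinv with h | h
    · exact h
    · exfalso
      refine absurd (integral_nonneg_of_ae_exists (measurePreserving_shift m) hg hgi ?_)
        (not_le.2 hneg)
      filter_upwards [(mem_ae_iff_prob_eq_one hBm).2 h] with X hX
      obtain ⟨j, hj⟩ := hX
      obtain ⟨n, -, hn⟩ := hj 0
      exact ⟨n, lt_of_le_of_lt (by positivity) hn⟩
  have : ∀ᵐ X ∂P, X ∉ B := measure_eq_zero_iff_ae_notMem.1 hB0
  filter_upwards [this] with X hX
  obtain ⟨j, hj⟩ := exists_nat_one_div_lt hq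
  simp only [B, Set.mem_ofPred_eq, not_exists, not_forall, not_and, not_lt] at hX
  obtain ⟨N, hN⟩ := hX j
  filter_upwards [eventually_ge_atTop N] with n hn
  exact (hN n hn).trans (mul_le_mul_of_nonneg_left hj.le (Nat.cast_nonneg n))

/-- The ergodic theorem for Bernoulli shifts. -/
theorem ae_tendsto_birkhoffSum_div {f : (ℕ → S) → ℝ} (hf : Measurable f)
    (hfi : Integrable f (Measure.infinitePi fun _ : ℕ => m)) :
    ∀ᵐ X ∂(Measure.infinitePi fun _ : ℕ => m),
      Tendsto (fun n : ℕ => birkhoffSum shift f n X / n) atTop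
        (𝓝 (∫ X, f X ∂(Measure.infinitePi fun _ : ℕ => m))) := by
  set P := Measure.infinitePi fun _ : ℕ => m
  have main : ∀ f : (ℕ → S) → ℝ, Measurable f → Integrable f P → ∀ j : ℕ,
      ∀ᵐ X ∂P, ∀ᶠ n : ℕ in atTop, birkhoffSum shift f n X ≤
        n * (∫ X, f X ∂P + 2 * (1 / ((j : ℝ) + 1))) := by
    intro f hf hfi j
    have hj : (0 : ℝ) < 1 / ((j : ℝ) + 1) := by positivity
    have := ae_eventually_birkhoffSum_le (m := m) (g := fun X => f X - (∫ X, f X ∂P + 1 / ((j : ℝ) + 1)))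
      (hf.sub_const _) (hfi.sub (integrable_const _)) ?_ hj
    · filter_upwards [this] with X hX
      filter_upwards [hX] with n hn
      rw [birkhoffSum_sub_const] at hn
      linarith
    · rw [integral_sub hfi (integrable_const _)]
      simp only [integral_const, probReal_univ, one_smul]
      linarith
  filter_upwards [ae_all_iff.2 (main f hf hfi), ae_all_iff.2 (main (fun X => - f X) hf.neg hfi.neg)]
    with X h1 h2
  rw [Metric.tendsto_atTop']
  intro ε hε
  obtain ⟨j, hj⟩ := exists_nat_one_div_lt (half_pos hε)
  obtain ⟨N₁, hN₁⟩ := eventually_atTop.1 (h1 j)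
  obtain ⟨N₂, hN₂⟩ := eventually_atTop.1 (h2 j)
  refine ⟨max N₁ N₂, fun n hn => ?_⟩
  have hn0 : (0 : ℝ) < n := by
    exact_mod_cast lt_of_le_of_lt (Nat.zero_le _) hn
  have h3 := hN₁ n ((le_max_left _ _).trans hn.le)
  have h4 := hN₂ n ((le_max_right _ _).trans hn.le)
  have e : birkhoffSum shift (fun X => - f X) n X = - birkhoffSum shift f n X := by
    simp [birkhoffSum]
  rw [e, integral_neg] at h4
  have e2 : ∀ a b : ℝ, a / n - b = (a - n * b) / n := by intro a b; field_simp
  rw [Real.dist_eq, abs_lt, e2, lt_div_iff₀ hn0, div_lt_iff₀ hn0]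
  constructor <;> nlinarith

end

end FurstenbergMeasure
end

open MeasureTheory Filter Topology
open scoped Matrix
open FurstenbergMeasure

set_option linter.unusedSectionVars false

noncomputable section

namespace FurstenbergMeasure

open scoped ENNReal

/-! ### Arcs of the projective line and differentiation of measures along arcs -/

/-- The open arc with end points `[u]` and `[w]` that consists of the lines `[v]` with
`det (u, v) * det (v, w) > 0`. -/
def arc (u w : Fin 2 → ℝ) : Set RP1 := {x | 0 < cross u x.rep * cross x.rep w}

/-- The sets which are open arcs. -/
def IsArc (B : Set RP1) : Prop := ∃ u w, B = arc u w

lemma mk_mem_arc {u w v : Fin 2 → ℝ} (hv : v ≠ 0) :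
    Projectivization.mk ℝ v hv ∈ arc u w ↔ 0 < cross u v * cross v w := by
  obtain ⟨a, ha, h⟩ := exists_rep_smul hv
  have : cross u (a • v) * cross (a • v) w = a ^ 2 * (cross u v * cross v w) := by
    simp [cross]; ring
  rw [arc, Set.mem_ofPred_eq, h, this]
  exact mul_pos_iff_of_pos_left (by positivity)

lemma IsArc.isOpen {B : Set RP1} (hB : IsArc B) : IsOpen B := by
  obtain ⟨u, w, rfl⟩ := hB
  refine isOpen_coinduced.2 ?_
  have : Projectivization.mk' ℝ (V := Fin 2 → ℝ) ⁻¹' arc u w =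
      {v | 0 < cross u v.1 * cross v.1 w} := by
    ext v; exact mk_mem_arc v.2
  rw [this]
  unfold cross
  have h (i : Fin 2) : Continuous fun v : {v : Fin 2 → ℝ // v ≠ 0} => v.1 i :=
    (continuous_apply i).comp continuous_subtype_val
  have h0 := h 0
  have h1 := h 1
  exact isOpen_lt continuous_const (((continuous_const.mul h1).sub (continuous_const.mul h0)).mul
    ((h0.mul continuous_const).sub (h1.mul continuous_const)))

lemma IsArc.measurableSet {B : Set RP1} (hB : IsArc B) : MeasurableSet B := hB.isOpen.measurableSet

lemma IsArc.preimage_smul {B : Set RP1} (hB : IsArc B) (g : SL2R) : IsArc {x | g • x ∈ B} := by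
  obtain ⟨u, w, rfl⟩ := hB
  refine ⟨g⁻¹ • u, g⁻¹ • w, ?_⟩
  ext x
  have h1 : cross (g⁻¹ • u) x.rep = cross u (g • x.rep) := by
    rw [← cross_smul g, smul_inv_smul]
  have h2 : cross x.rep (g⁻¹ • w) = cross (g • x.rep) w := by
    rw [← cross_smul g, smul_inv_smul]
  rw [Set.mem_ofPred_eq, smul_eq_mk, mk_mem_arc, arc, Set.mem_ofPred_eq, h1, h2]

/-- The end points are the centre rotated by `± arcsin r`. Arcs rather than balls are used because
they are stable under preimages by matrices. -/
lemma isArc_ball (x : RP1) {r : ℝ} (hr : 0 < r) (hr1 : r < 1) : IsArc (Metric.ball x r) := by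
  set v := x.rep with hv
  have hn := nsq_pos x.rep_nonzero
  rw [← hv] at hn
  set c := √(1 - r ^ 2) with hc
  have hc2 : c ^ 2 = 1 - r ^ 2 := Real.sq_sqrt (by nlinarith)
  refine ⟨![c * v 0 + r * v 1, c * v 1 - r * v 0], ![c * v 0 - r * v 1, c * v 1 + r * v 0], ?_⟩
  ext y
  have hn' := nsq_pos y.rep_nonzero
  rw [Metric.mem_ball, dist_comm, arc, Set.mem_ofPred_eq, ← sq_lt_sq₀ dist_nonneg hr.le, dist_eq_emb, emb,
    emb, dist_embVec_sq x.rep_nonzero y.rep_nonzero, ← hv, div_lt_iff₀ (mul_pos hn hn'), ← sub_pos]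
  refine iff_of_eq (congrArg _ ?_)
  simp only [cross, nsq, Matrix.cons_val_zero, Matrix.cons_val_one]
  generalize y.rep = w
  linear_combination (v 0 * w 1 - v 1 * w 0) ^ 2 * hc2

/-- Sending `x` to infinity makes the rest of the projective line an affine line with coordinate
`s`. An arc through `x` becomes the complement of a compact interval, that is, two rays. -/
lemma IsArc.exists_coord (x : RP1) : ∃ s : RP1 → ℝ, ∀ B, IsArc B → x ∈ B →
    ∃ p q : ℝ, ∀ y, y ≠ x → (y ∈ B ↔ p < s y ∨ s y < q) := by
  have hn := nsq_pos x.rep_nonzero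
  set v := x.rep with hv
  let v' : Fin 2 → ℝ := ![- v 1 / nsq v, v 0 / nsq v]
  refine ⟨fun y => cross y.rep v' / cross v y.rep, ?_⟩
  rintro _ ⟨u, w, rfl⟩ hx
  rw [arc, Set.mem_ofPred_eq, ← hv] at hx
  have hA : cross u v ≠ 0 := fun h => by simp [h] at hx
  have hC : cross v w ≠ 0 := fun h => by simp [h] at hx
  refine ⟨max (-(cross u v' / cross u v)) (-(cross v' w / cross v w)),
    min (-(cross u v' / cross u v)) (-(cross v' w / cross v w)), fun y hy => ?_⟩
  have hy2 : cross v y.rep ≠ 0 := by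
    intro h
    rw [← mk_eq_mk_iff_cross x.rep_nonzero y.rep_nonzero, x.mk_rep, y.mk_rep] at h
    exact hy h.symm
  rw [arc, Set.mem_ofPred_eq]
  set s := cross y.rep v' / cross v y.rep with hs
  have h1 : cross u y.rep * cross y.rep w = (cross u v * cross v w) * cross v y.rep ^ 2 *
      ((s + cross u v' / cross u v) * (s + cross v' w / cross v w)) := by
    rw [hs]
    field_simp
    simp only [v', cross, Matrix.cons_val_zero, Matrix.cons_val_one]
    field_simp
    simp only [nsq]
    ring
  rw [h1, mul_pos_iff_of_pos_left (by positivity), max_lt_iff, lt_min_iff, mul_pos_iff]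
  constructor
  · rintro (h | h)
    · left; constructor <;> linarith
    · right; constructor <;> linarith
  · rintro (h | h)
    · left; constructor <;> linarith
    · right; constructor <;> linarith

open Classical in
-- For arcs through a common point, the union of the right rays is one of them and likewise on the
-- left; so two arcs cover all the others.
lemma exists_subset_union_erase {𝓖 : Finset (Set RP1)} (h𝓖 : ∀ B ∈ 𝓖, IsArc B) {x : RP1}
    (hx : ∀ B ∈ 𝓖, x ∈ B) (hc : 2 < 𝓖.card) : ∃ B ∈ 𝓖, B ⊆ ⋃ C ∈ 𝓖.erase B, C := by
  obtain ⟨s, hs⟩ := IsArc.exists_coord x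
  choose! p q hpq using fun B (hB : B ∈ 𝓖) => hs B (h𝓖 B hB) (hx B hB)
  have hne : 𝓖.Nonempty := Finset.card_pos.1 (by omega)
  obtain ⟨B₁, hB₁, hp⟩ := 𝓖.exists_min_image p hne
  obtain ⟨B₂, hB₂, hq⟩ := 𝓖.exists_max_image q hne
  obtain ⟨B, hB, hB'⟩ := Finset.exists_mem_notMem_of_card_lt_card
    (lt_of_le_of_lt Finset.card_le_two hc : ({B₁, B₂} : Finset (Set RP1)).card < 𝓖.card)
  simp only [Finset.mem_insert, Finset.mem_singleton, not_or] at hB'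
  refine ⟨B, hB, fun y hy => ?_⟩
  simp only [Finset.mem_erase, Set.mem_iUnion]
  by_cases hyx : y = x
  · exact ⟨B₁, ⟨Ne.symm hB'.1, hB₁⟩, hyx ▸ hx B₁ hB₁⟩
  rcases (hpq B hB y hyx).1 hy with h | h
  · exact ⟨B₁, ⟨Ne.symm hB'.1, hB₁⟩, (hpq B₁ hB₁ y hyx).2 (Or.inl ((hp B hB).trans_lt h))⟩
  · exact ⟨B₂, ⟨Ne.symm hB'.2, hB₂⟩, (hpq B₂ hB₂ y hyx).2 (Or.inr (h.trans_le (hq B hB)))⟩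

open Classical in
/-- A finite family of arcs has a subfamily with the same union and multiplicity at most two. -/
lemma exists_subfamily_card_le_two {𝓕 : Finset (Set RP1)} (h𝓕 : ∀ B ∈ 𝓕, IsArc B) :
    ∃ 𝓖 ⊆ 𝓕, (⋃ B ∈ 𝓖, B) = (⋃ B ∈ 𝓕, B) ∧ ∀ x, {B ∈ 𝓖 | x ∈ B}.card ≤ 2 := by
  -- In a subfamily of minimal cardinality with the same union no arc is redundant, whereas among
  -- three arcs with a common point one is.
  obtain ⟨𝓖, h𝓖, hmin⟩ := (𝓕.powerset.filter fun 𝓖 => (⋃ B ∈ 𝓖, B) = (⋃ B ∈ 𝓕, B)).exists_min_image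
    Finset.card ⟨𝓕, by simp⟩
  simp only [Finset.mem_filter, Finset.mem_powerset] at h𝓖 hmin
  refine ⟨𝓖, h𝓖.1, h𝓖.2, fun x => ?_⟩
  by_contra! hc
  obtain ⟨B, hB, hsub⟩ := exists_subset_union_erase (𝓖 := {B ∈ 𝓖 | x ∈ B})
    (fun B hB => h𝓕 B (h𝓖.1 (Finset.mem_filter.1 hB).1)) (fun B hB => (Finset.mem_filter.1 hB).2) hc
  have hB' := (Finset.mem_filter.1 hB).1
  have := hmin (𝓖.erase B) ⟨(Finset.erase_subset _ _).trans h𝓖.1, ?_⟩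
  · have := Finset.card_erase_lt_of_mem hB'
    omega
  · rw [← h𝓖.2]
    refine Set.Subset.antisymm (Set.biUnion_mono (Finset.erase_subset B 𝓖) fun _ _ => subset_rfl) ?_
    refine Set.iUnion₂_subset fun C hC => ?_
    by_cases h : C = B
    · rw [h]
      exact hsub.trans (Set.biUnion_mono
        (fun D hD => by
          have := Finset.mem_erase.1 hD
          exact Finset.mem_erase.2 ⟨this.1, (Finset.mem_filter.1 this.2).1⟩) fun _ _ => subset_rfl)
    · exact Set.subset_biUnion_of_mem (u := fun C : Set RP1 => C) (Finset.mem_erase.2 ⟨h, hC⟩)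

/-- The covering lemma for arcs. -/
lemma measure_sUnion_arc_le {m m' : Measure RP1} [IsFiniteMeasure m] {t : ℝ≥0∞}
    {𝓐 : Set (Set RP1)} (h𝓐 : ∀ B ∈ 𝓐, IsArc B) (h : ∀ B ∈ 𝓐, m B ≤ t * m' B) :
    m (⋃₀ 𝓐) ≤ 2 * t * m' Set.univ := by
  classical
  refine le_of_forall_lt fun c hc => ?_
  -- Inner regularity reduces to a compact set and so to finitely many arcs; multiplicity two then
  -- bounds the sum of their `m'`-measures without any enlargement, so no doubling property is
  -- needed.
  obtain ⟨K, hK, hKc, hcK⟩ := (isOpen_sUnion fun B hB => (h𝓐 B hB).isOpen).exists_lt_isCompact hc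
  refine hcK.trans_le ?_
  rw [Set.sUnion_eq_biUnion] at hK
  obtain ⟨T, hT, hTf, hKT⟩ := hKc.elim_finite_subcover_image (fun B hB => (h𝓐 B hB).isOpen) hK
  obtain ⟨𝓖, h𝓖, hU, hcard⟩ := exists_subfamily_card_le_two (𝓕 := hTf.toFinset)
    fun B hB => h𝓐 B (hT (hTf.mem_toFinset.1 hB))
  have h𝓖' : ∀ B ∈ 𝓖, B ∈ 𝓐 := fun B hB => hT (hTf.mem_toFinset.1 (h𝓖 hB))
  have hKU : K ⊆ ⋃ B ∈ 𝓖, B := by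
    rw [hU]
    simpa using hKT
  have hsum : ∑ B ∈ 𝓖, m' B ≤ 2 * m' Set.univ := by
    calc ∑ B ∈ 𝓖, m' B = ∑ B ∈ 𝓖, ∫⁻ x, B.indicator 1 x ∂m' :=
          Finset.sum_congr rfl fun B hB => (lintegral_indicator_one (h𝓐 B (h𝓖' B hB)).measurableSet).symm
      _ = ∫⁻ x, ∑ B ∈ 𝓖, B.indicator 1 x ∂m' :=
          (lintegral_finsetSum _ fun B hB =>
            measurable_one.indicator (h𝓐 B (h𝓖' B hB)).measurableSet).symm
      _ ≤ ∫⁻ _, 2 ∂m' := by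
          refine lintegral_mono fun x => ?_
          have : ∑ B ∈ 𝓖, B.indicator (1 : RP1 → ℝ≥0∞) x = ({B ∈ 𝓖 | x ∈ B}.card : ℝ≥0∞) := by
            simp [Set.indicator_apply]
          simp only [this]
          exact_mod_cast hcard x
      _ = 2 * m' Set.univ := by simp
  calc m K ≤ m (⋃ B ∈ 𝓖, B) := measure_mono hKU
    _ ≤ ∑ B ∈ 𝓖, m B := measure_biUnion_finset_le _ _
    _ ≤ ∑ B ∈ 𝓖, t * m' B := Finset.sum_le_sum fun B hB => h B (h𝓖' B hB)
    _ = t * ∑ B ∈ 𝓖, m' B := (Finset.mul_sum _ _ _).symm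
    _ ≤ t * (2 * m' Set.univ) := by gcongr
    _ = _ := by ring

end FurstenbergMeasure
end

open MeasureTheory Filter Topology
open scoped Matrix
open FurstenbergMeasure

set_option linter.unusedSectionVars false

noncomputable section

namespace FurstenbergMeasure

/-! ### Differentiation and maximal inequalities along arcs. -/

open scoped ENNReal

/-- Uniform differentiation along arcs, off a set of small measure. -/
lemma exists_arc_differentiation {ν : Measure RP1} [IsProbabilityMeasure ν] {h : RP1 → ℝ}
    (hm : Measurable h) (hi : Integrable h ν) {ε : ℝ} (hε : 0 < ε) :
    ∃ δ > 0, ∃ N : Set RP1, MeasurableSet N ∧ ν N ≤ ENNReal.ofReal ε ∧ ∀ x ∉ N, ∀ B, IsArc B → x ∈ B →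
      B ⊆ Metric.ball x δ → |(∫ y in B, h y ∂ν) - h x * ν.real B| ≤ ε * ν.real B := by
  -- With `L¹` error `ε ^ 2 / 9`, the covering lemma at level `ε / 3` discards measure `2 * ε / 3`
  -- and Markov's inequality `ε / 3`. Outside, the error of the arc mean is at most three times `ε /
  -- 3`: from the mean of `d`, the oscillation of `φ`, and `d x`.
  obtain ⟨φ, hφ, hφi⟩ := hi.exists_boundedContinuous_integral_sub_le (ε := ε ^ 2 / 9) (by positivity)
  have hφm : Measurable φ := φ.continuous.measurable
  obtain ⟨δ, hδ, hu⟩ := Metric.uniformContinuous_iff.1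
    (CompactSpace.uniformContinuous_of_continuous φ.continuous) (ε / 3) (by positivity)
  set d : RP1 → ℝ := fun y => |h y - φ y| with hd
  have hdm : Measurable d := measurable_norm.comp (hm.sub hφm)
  have hdi : Integrable d ν := (hi.sub hφi).abs
  have hd0 : ∀ y, 0 ≤ d y := fun y => abs_nonneg _
  set m' := ν.withDensity fun y => ENNReal.ofReal (d y) with hm'
  have hm'r : ∀ E, MeasurableSet E → m' E = ENNReal.ofReal (∫ y in E, d y ∂ν) := fun E hE => by
    rw [hm', withDensity_apply _ hE, ofReal_integral_eq_lintegral_ofReal hdi.integrableOn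
      (ae_of_all _ hd0)]
  set 𝓐 := {B | IsArc B ∧ ν B ≤ ENNReal.ofReal (3 / ε) * m' B} with h𝓐
  have hA := measure_sUnion_arc_le (m := ν) (m' := m') (t := ENNReal.ofReal (3 / ε)) (𝓐 := 𝓐)
    (fun B hB => hB.1) fun B hB => hB.2
  rw [hm'r _ MeasurableSet.univ, setIntegral_univ] at hA
  have hN2 : ν {y | ε / 3 ≤ d y} ≤ ENNReal.ofReal (ε / 3) := by
    have := mul_meas_ge_le_integral_of_nonneg (ae_of_all ν hd0) hdi (ε / 3)
    rw [← ofReal_measureReal]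
    refine ENNReal.ofReal_le_ofReal ?_
    have h2 : ∫ y, d y ∂ν ≤ ε ^ 2 / 9 := hφ
    have h3 : ε / 3 * ν.real {y | ε / 3 ≤ d y} ≤ ε / 3 * (ε / 3) := by nlinarith
    exact le_of_mul_le_mul_left h3 (by positivity)
  refine ⟨δ, hδ, ⋃₀ 𝓐 ∪ {y | ε / 3 ≤ d y}, ?_, ?_, fun x hx B hB hxB hBδ => ?_⟩
  · exact (isOpen_sUnion fun B hB => hB.1.isOpen).measurableSet.union
      (measurableSet_le measurable_const hdm)
  · refine (measure_union_le _ _).trans ((add_le_add hA hN2).trans ?_)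
    rw [show (2 : ℝ≥0∞) = ENNReal.ofReal 2 by simp, ← ENNReal.ofReal_mul (by norm_num),
      ← ENNReal.ofReal_mul (by positivity), ← ENNReal.ofReal_add
        (mul_nonneg (by positivity) (integral_nonneg hd0)) (by positivity)]
    refine ENNReal.ofReal_le_ofReal ?_
    have h2 : ∫ y, d y ∂ν ≤ ε ^ 2 / 9 := hφ
    calc 2 * (3 / ε) * ∫ y, d y ∂ν + ε / 3 ≤ 2 * (3 / ε) * (ε ^ 2 / 9) + ε / 3 := by gcongr
      _ = ε := by field_simp; ring
  · rw [Set.mem_union, not_or] at hx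
    have hBm := hB.measurableSet
    have h1 : 3 / ε * ∫ y in B, d y ∂ν < ν.real B := by
      have : ¬ ν B ≤ ENNReal.ofReal (3 / ε) * m' B := fun h => hx.1 ⟨B, ⟨hB, h⟩, hxB⟩
      rw [hm'r B hBm, ← ENNReal.ofReal_mul (by positivity), ← ofReal_measureReal, not_le] at this
      exact (ENNReal.ofReal_lt_ofReal_iff_of_nonneg
        (mul_nonneg (by positivity) (integral_nonneg hd0))).1 this
    have h1' : ∫ y in B, d y ∂ν ≤ ε / 3 * ν.real B := by
      have : ε / 3 * (3 / ε * ∫ y in B, d y ∂ν) = ∫ y in B, d y ∂ν := by field_simp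
      rw [← this]
      gcongr
    have h2 : d x < ε / 3 := not_le.1 hx.2
    have h3 : (∫ y in B, h y ∂ν) - h x * ν.real B = ∫ y in B, (h y - h x) ∂ν := by
      rw [integral_sub hi.integrableOn (integrable_const _), setIntegral_const, smul_eq_mul, mul_comm (h x)]
    rw [h3]
    calc |∫ y in B, (h y - h x) ∂ν| ≤ ∫ y in B, |h y - h x| ∂ν := abs_integral_le_integral_abs
      _ ≤ ∫ y in B, (d y + 2 * ε / 3) ∂ν := by
          refine setIntegral_mono_on (hi.sub (integrable_const _)).abs.integrableOn
            (hdi.add (integrable_const _)).integrableOn hBm fun y hy => ?_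
          have h4 := hu (hBδ hy)
          rw [Real.dist_eq] at h4
          have h5 : |h y - h x| ≤ |h y - φ y| + |φ y - φ x| + |h x - φ x| := by
            rw [abs_sub_comm (h x)]
            exact (abs_sub_le _ (φ x) _).trans (add_le_add_left (abs_sub_le _ _ _) _)
          simp only [hd] at h2 ⊢
          linarith
      _ = (∫ y in B, d y ∂ν) + 2 * ε / 3 * ν.real B := by
          rw [integral_add hdi.integrableOn (integrable_const _), setIntegral_const, smul_eq_mul,
            mul_comm (ν.real B)]
      _ ≤ ε * ν.real B := by linarith

/-- The maximal inequality for the logarithm of the ratio of two measures on arcs. -/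
lemma exists_arc_maximal {m ν : Measure RP1} [IsProbabilityMeasure ν] [IsFiniteMeasure m]
    (hle : m ≤ ν) : ∃ M : RP1 → ℝ, Measurable M ∧ (∀ x, 0 ≤ M x) ∧ Integrable M m ∧
      ∀ᵐ x ∂m, ∀ B, IsArc B → x ∈ B → 0 < m.real B ∧
        |Real.log (m.real B) - Real.log (ν.real B)| ≤ M x := by
  -- The maximal function `F` counts the `j` for which `x` lies in some arc of ratio at most `exp
  -- (-j)`. The covering lemma makes these sets exponentially small for `m`. An arc with logarithmic
  -- ratio `s` puts `x` in the first `⌊s⌋₊ + 1` of them, whence `F` bounds `s`.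
  set 𝓐 : ℕ → Set (Set RP1) := fun j =>
    {B | IsArc B ∧ m B ≤ ENNReal.ofReal (Real.exp (-j)) * ν B} with h𝓐
  have hAo : ∀ j, MeasurableSet (⋃₀ 𝓐 j) := fun j =>
    (isOpen_sUnion fun B hB => hB.1.isOpen).measurableSet
  have hA : ∀ j, m (⋃₀ 𝓐 j) ≤ ENNReal.ofReal (2 * Real.exp (-(1 * j))) := fun j => by
    refine (measure_sUnion_arc_le (fun B hB => hB.1) fun B hB => hB.2).trans (le_of_eq ?_)
    rw [measure_univ, mul_one, ENNReal.ofReal_mul (by norm_num), one_mul]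
    simp
  set F : RP1 → ℝ≥0∞ := fun x => ∑' j, (⋃₀ 𝓐 j).indicator 1 x with hF
  have hFm : Measurable F := Measurable.tsum fun j => measurable_one.indicator (hAo j)
  have hFi : ∫⁻ x, F x ∂m ≠ ∞ := by
    rw [hF, lintegral_tsum fun j => (measurable_one.indicator (hAo j)).aemeasurable]
    simp_rw [lintegral_indicator_one (hAo _)]
    exact ne_top_of_le_ne_top (tsum_ofReal_exp_ne_top one_pos 2) (ENNReal.tsum_le_tsum hA)
  refine ⟨fun x => (F x).toReal, hFm.ennreal_toReal, fun x => ENNReal.toReal_nonneg,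
    integrable_toReal_of_lintegral_ne_top hFm.aemeasurable hFi, ?_⟩
  filter_upwards [ae_lt_top hFm hFi] with x hx B hB hxB
  have key : ∀ n : ℕ, (∀ j < n, m.real B ≤ Real.exp (-j) * ν.real B) → (n : ℝ) ≤ (F x).toReal := by
    intro n hn
    have : (n : ℝ≥0∞) ≤ F x := by
      calc (n : ℝ≥0∞) = ∑ j ∈ Finset.range n, (⋃₀ 𝓐 j).indicator 1 x := by
            rw [Finset.sum_congr rfl (g := fun _ => (1 : ℝ≥0∞)), Finset.sum_const]
            · simp
            · intro j hj
              rw [Set.indicator_of_mem, Pi.one_apply]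
              refine ⟨B, ⟨hB, ?_⟩, hxB⟩
              rw [← ofReal_measureReal, ← ofReal_measureReal, ← ENNReal.ofReal_mul (Real.exp_pos _).le]
              exact ENNReal.ofReal_le_ofReal (hn j (Finset.mem_range.1 hj))
        _ ≤ F x := ENNReal.sum_le_tsum _
    have h2 := ENNReal.toReal_mono hx.ne this
    simpa using h2
  have hpos : 0 < m.real B := by
    by_contra h0
    have h0 : m.real B = 0 := le_antisymm (not_lt.1 h0) measureReal_nonneg
    obtain ⟨n, hn⟩ := exists_nat_gt (F x).toReal
    refine absurd (key n fun j _ => ?_) (not_le.2 hn)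
    rw [h0]; positivity
  have hmν : m.real B ≤ ν.real B := ENNReal.toReal_mono (measure_ne_top _ _) (hle B)
  refine ⟨hpos, ?_⟩
  have hν : 0 < ν.real B := hpos.trans_le hmν
  rw [abs_sub_comm, abs_of_nonneg (sub_nonneg.2 (Real.log_le_log hpos hmν))]
  set s := Real.log (ν.real B) - Real.log (m.real B) with hs
  have hs0 : 0 ≤ s := sub_nonneg.2 (Real.log_le_log hpos hmν)
  refine (Nat.lt_floor_add_one s).le.trans ?_
  have := key (⌊s⌋₊ + 1) fun j hj => ?_
  · exact_mod_cast this
  · have hjs : (j : ℝ) ≤ s := (Nat.le_floor_iff hs0).1 (by omega)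
    rw [← Real.log_le_log_iff hpos (by positivity), Real.log_mul (Real.exp_pos _).ne' hν.ne',
      Real.log_exp]
    linarith

lemma abs_log_sub_log_le {q h t : ℝ} (hh : 0 < h) (ht : t ≤ 1) (hq : |q - h| ≤ h * t / 4) :
    |Real.log q - Real.log h| ≤ t / 2 := by
  obtain ⟨h1, h2⟩ := abs_le.1 hq
  have ht0 : 0 ≤ t := by nlinarith [abs_nonneg (q - h)]
  have hqp : 0 < q := by nlinarith
  rw [abs_le]
  have e1 := Real.log_le_sub_one_of_pos (div_pos hqp hh)
  have e2 := Real.log_le_sub_one_of_pos (div_pos hh hqp)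
  rw [Real.log_div hqp.ne' hh.ne'] at e1
  rw [Real.log_div hh.ne' hqp.ne'] at e2
  have e3 : q / h ≤ 1 + t / 4 := by rw [div_le_iff₀ hh]; linarith
  have e4 : h / q ≤ 1 + t / 2 := by rw [div_le_iff₀ hqp]; nlinarith
  constructor <;> linarith

/-- Ratios of two measures on small arcs approximate the density with an integrable error of small
integral. -/
lemma exists_arc_log_approx {m ν : Measure RP1} [IsProbabilityMeasure ν] [IsFiniteMeasure m]
    (hle : m ≤ ν) {h : RP1 → ℝ} (hh : h = fun x => (m.rnDeriv ν x).toReal) :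
    Measurable h ∧ Integrable (fun x => Real.log (h x)) m ∧
    ∀ ε > 0, ∃ δ > 0, ∃ W : RP1 → ℝ, Measurable W ∧ (∀ x, 0 ≤ W x) ∧ Integrable W m ∧
      ∫ x, W x ∂m ≤ ε ∧ ∀ᵐ x ∂m, ∀ B, IsArc B → x ∈ B → B ⊆ Metric.ball x δ → 0 < m.real B ∧
        |Real.log (m.real B) - Real.log (ν.real B) - Real.log (h x)| ≤ W x := by
  have hac : m ≪ ν := Measure.absolutelyContinuous_of_le hle
  have hhm : Measurable h := by rw [hh]; exact (Measure.measurable_rnDeriv m ν).ennreal_toReal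
  have hh0 : ∀ x, 0 ≤ h x := fun x => by rw [hh]; exact ENNReal.toReal_nonneg
  have hh1 : ∀ᵐ x ∂ν, h x ≤ 1 := by
    filter_upwards [Measure.rnDeriv_le_one_of_le hle] with x hx
    rw [hh]
    exact ENNReal.toReal_le_of_le_ofReal zero_le_one (by simpa using hx)
  have hhi : Integrable h ν := by rw [hh]; exact Measure.integrable_toReal_rnDeriv
  have hint : ∀ s, ∫ x in s, h x ∂ν = m.real s := fun s => by
    rw [hh]; exact Measure.setIntegral_toReal_rnDeriv hac s
  have hlogm : Measurable fun x => Real.log (h x) := Real.measurable_log.comp hhm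
  -- Against `m = h ν` the integrand becomes `h |log h|`, which is bounded because `0 ≤ h ≤ 1`.
  have hlog : Integrable (fun x => Real.log (h x)) m := by
    rw [← integrable_rnDeriv_smul_iff hac]
    refine Integrable.of_bound (C := 1) ?_ ?_
    · refine Measurable.aestronglyMeasurable ?_
      have := hhm.mul hlogm
      rw [hh] at this ⊢
      exact this
    · filter_upwards [hh1] with x hx
      have e : (m.rnDeriv ν x).toReal = h x := by rw [hh]
      rw [e, smul_eq_mul, mul_comm, Real.norm_eq_abs]
      rcases (hh0 x).eq_or_lt with h0 | h0
      · rw [← h0]; simp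
      · exact (Real.abs_log_mul_self_lt _ h0 hx).le
  refine ⟨hhm, hlog, fun ε hε => ?_⟩
  obtain ⟨M, hMm, hM0, hMi, hM⟩ := exists_arc_maximal hle
  set L : RP1 → ℝ := fun x => M x + |Real.log (h x)| with hL
  have hLm : Measurable L := hMm.add (measurable_norm.comp hlogm)
  have hLi : Integrable L m := hMi.add hlog.abs
  have hL0 : ∀ x, 0 ≤ L x := fun x => add_nonneg (hM0 x) (abs_nonneg _)
  obtain ⟨η, hη, hη'⟩ := exists_pos_setLIntegral_lt_of_measure_lt
    (μ := m) (f := fun x => ENNReal.ofReal (L x)) hLi.lintegral_lt_top.ne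
    (ε := ENNReal.ofReal (ε / 2)) (by simpa using hε)
  -- The error is small except on `N'`, where differentiation fails or the density is at most `κ`;
  -- there only the integrable bound `L` is available. `κ` is small enough for absolute continuity
  -- to make the integral of `L` over `N'` at most `ε / 2`. The precision `κ * t / 4` below is a
  -- relative precision `t / 4` wherever `h > κ`.
  obtain ⟨κ, hκ, hκη⟩ : ∃ κ : ℝ, 0 < κ ∧ ENNReal.ofReal (2 * κ) < η := by
    obtain ⟨a, ha, haη⟩ := ENNReal.lt_iff_exists_nnreal_btwn.1 hη
    refine ⟨a / 2, by simpa using ha, ?_⟩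
    rwa [show 2 * ((a : ℝ) / 2) = a by ring, ENNReal.ofReal_coe_nnreal]
  set t := min ε 1 with ht
  have ht0 : 0 < t := lt_min hε one_pos
  obtain ⟨δ, hδ, N, hNm, hN, hdiff⟩ := exists_arc_differentiation hhm hhi
    (ε := κ * t / 4) (by positivity)
  set N' := N ∪ {x | h x ≤ κ} with hN'
  have hN'm : MeasurableSet N' := hNm.union (measurableSet_le hhm measurable_const)
  have hκm : m {x | h x ≤ κ} ≤ ENNReal.ofReal κ := by
    rw [← ofReal_measureReal, ← hint]
    refine ENNReal.ofReal_le_ofReal ?_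
    calc ∫ x in {x | h x ≤ κ}, h x ∂ν ≤ ∫ x in {x | h x ≤ κ}, κ ∂ν :=
          setIntegral_mono_on hhi.integrableOn (integrable_const _).integrableOn
            (measurableSet_le hhm measurable_const) fun x hx => hx
      _ = ν.real {x | h x ≤ κ} * κ := by rw [setIntegral_const, smul_eq_mul]
      _ ≤ 1 * κ := by gcongr; exact measureReal_le_one
      _ = κ := one_mul κ
  have hmN' : m N' < η := by
    refine (measure_union_le _ _).trans_lt (lt_of_le_of_lt
      (add_le_add ((hle N).trans hN) hκm) ?_)
    rw [← ENNReal.ofReal_add (by positivity) hκ.le]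
    refine lt_of_le_of_lt (ENNReal.ofReal_le_ofReal ?_) hκη
    have : t ≤ 1 := min_le_right _ _
    nlinarith
  refine ⟨δ, hδ, fun x => N'.indicator L x + t / 2, (hLm.indicator hN'm).add_const _,
    fun x => add_nonneg (Set.indicator_nonneg (fun x _ => hL0 x) x) (by positivity),
    (hLi.indicator hN'm).add (integrable_const _), ?_, ?_⟩
  · rw [integral_add (hLi.indicator hN'm) (integrable_const _), integral_indicator hN'm,
      integral_const, smul_eq_mul]
    have h1 : ∫ x in N', L x ∂m ≤ ε / 2 := by
      rw [integral_eq_lintegral_of_nonneg_ae (ae_of_all _ hL0) hLm.aestronglyMeasurable]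
      exact ENNReal.toReal_le_of_le_ofReal (by positivity) (hη' N' hmN').le
    have h2 : m.real Set.univ ≤ 1 :=
      (ENNReal.toReal_mono (measure_ne_top _ _) (hle Set.univ)).trans (by simp)
    have : t ≤ ε := min_le_left _ _
    nlinarith
  · filter_upwards [hM] with x hx B hB hxB hBδ
    obtain ⟨hpos, hb⟩ := hx B hB hxB
    refine ⟨hpos, ?_⟩
    by_cases hxN : x ∈ N'
    · rw [Set.indicator_of_mem hxN, hL]
      have := abs_sub (Real.log (m.real B) - Real.log (ν.real B)) (Real.log (h x))
      simp only
      linarith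
    · rw [Set.indicator_of_notMem hxN, zero_add]
      rw [hN', Set.mem_union, not_or] at hxN
      have h1 := hdiff x hxN.1 B hB hxB hBδ
      rw [hint] at h1
      have hhx : κ < h x := not_le.1 hxN.2
      have hν : 0 < ν.real B := hpos.trans_le (ENNReal.toReal_mono (measure_ne_top _ _) (hle B))
      rw [← Real.log_div hpos.ne' hν.ne']
      refine abs_log_sub_log_le (hκ.trans hhx) (min_le_right _ _) ?_
      have h2 : m.real B / ν.real B - h x = (m.real B - h x * ν.real B) / ν.real B := by
        field_simp
      rw [h2, abs_div, abs_of_pos hν, div_le_iff₀ hν]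
      refine h1.trans ?_
      gcongr

end FurstenbergMeasure
end

open MeasureTheory Filter Topology
open scoped Matrix
open FurstenbergMeasure

set_option linter.unusedSectionVars false

noncomputable section

namespace FurstenbergMeasure

/-! ### The change of measure of small arcs under one step, and lower bounds for balls. -/

open scoped ENNReal

section

variable {μ : Measure SL2R} [IsProbabilityMeasure μ] {ν : Measure RP1}

/-- The part of a stationary measure that is contributed by the matrix `g`. -/
def branch (μ : Measure SL2R) (ν : Measure RP1) (g : SL2R) : Measure RP1 :=
  μ {g} • ν.map fun x => g • x

instance instIsFiniteMeasureBranch [IsFiniteMeasure ν] (g : SL2R) : IsFiniteMeasure (branch μ ν g) :=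
  ⟨by
    rw [branch, Measure.smul_apply, smul_eq_mul]
    exact ENNReal.mul_lt_top (measure_lt_top _ _) (measure_lt_top _ _)⟩

lemma branch_apply (g : SL2R) {E : Set RP1} (hE : MeasurableSet E) :
    branch μ ν g E = μ {g} * ν {x | g • x ∈ E} := by
  rw [branch, Measure.smul_apply, Measure.map_apply (measurable_const_smul g) hE]
  rfl

lemma branch_le [SFinite ν] (hν : IsStationaryMeasure μ ν) (g : SL2R) : branch μ ν g ≤ ν := by
  refine Measure.le_iff.2 fun E hE => ?_
  rw [branch_apply g hE]
  rw [hν.measure_eq hE]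
  calc μ {g} * ν {x | g • x ∈ E} = ∫⁻ g' in {g}, ν {x | g' • x ∈ E} ∂μ := by
        rw [lintegral_singleton, mul_comm]
    _ ≤ _ := setLIntegral_le_lintegral _ _

lemma measurableSet_zero_eq (g : SL2R) : MeasurableSet {X : ℕ → SL2R | X 0 = g} :=
  measurableSet_eq_fun (measurable_pi_apply 0) measurable_const

/-- On the event that the first matrix is `g`, the limit point is `g` applied to the limit point of
the shifted path, which is independent of the first matrix and has law `ν`. -/
lemma map_restrict_boundary {z : (ℕ → SL2R) → RP1} (hz : MeasurePreserving z (pathMeasure μ) ν)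
    (hz' : ∀ᵐ X ∂(pathMeasure μ), z X = X 0 • z (shift X)) (g : SL2R) :
    ((pathMeasure μ).restrict {X | X 0 = g}).map z = branch μ ν g := by
  ext E hE
  have hg : MeasurableSet {X : ℕ → SL2R | X 0 = g} := measurableSet_zero_eq g
  have hgE : MeasurableSet {x : RP1 | g • x ∈ E} := measurable_const_smul g hE
  rw [branch_apply g hE, Measure.map_apply hz.measurable hE, Measure.restrict_apply (hz.measurable hE)]
  have h1 : (z ⁻¹' E ∩ {X | X 0 = g} : Set (ℕ → SL2R)) =ᵐ[pathMeasure μ]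
      ((fun X : ℕ → SL2R => (X 0, shift X)) ⁻¹' ({g} ×ˢ (z ⁻¹' {x | g • x ∈ E})) : Set (ℕ → SL2R)) := by
    filter_upwards [hz'] with X hX
    refine propext ?_
    change (z X ∈ E ∧ X 0 = g) ↔ (X 0 = g ∧ g • z (shift X) ∈ E)
    rw [hX]
    constructor
    · rintro ⟨h1, h2⟩; exact ⟨h2, h2 ▸ h1⟩
    · rintro ⟨h1, h2⟩; exact ⟨h1 ▸ h2, h1⟩
  rw [measure_congr h1, (measurePreserving_zero_shift μ).measure_preimage
    ((measurableSet_singleton g).prod (hz.measurable hgE)).nullMeasurableSet, Measure.prod_prod,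
    hz.measure_preimage hgE.nullMeasurableSet]

/-- A function of the first step and of the limit point of a path. -/
def boundarySum (T : Finset SL2R) (z : (ℕ → SL2R) → RP1) (F : SL2R → RP1 → ℝ) (X : ℕ → SL2R) : ℝ :=
  ∑ g ∈ T, Set.indicator {X : ℕ → SL2R | X 0 = g} (fun X => F g (z X)) X

lemma boundarySum_eq {T : Finset SL2R} (z : (ℕ → SL2R) → RP1) (F : SL2R → RP1 → ℝ) {X : ℕ → SL2R}
    (hX : X 0 ∈ T) : boundarySum T z F X = F (X 0) (z X) := by
  classical
  simp [boundarySum, Set.indicator_apply, hX]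

lemma measurable_boundarySum {T : Finset SL2R} {z : (ℕ → SL2R) → RP1} (hz : Measurable z)
    {F : SL2R → RP1 → ℝ} (hF : ∀ g ∈ T, Measurable (F g)) : Measurable (boundarySum T z F) :=
  Finset.measurable_fun_sum T fun g hg => ((hF g hg).comp hz).indicator
    (measurableSet_zero_eq g)

lemma integrable_boundarySum {T : Finset SL2R} {z : (ℕ → SL2R) → RP1}
    (hz : MeasurePreserving z (pathMeasure μ) ν)
    (hz' : ∀ᵐ X ∂(pathMeasure μ), z X = X 0 • z (shift X)) {F : SL2R → RP1 → ℝ}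
    (hF : ∀ g ∈ T, Integrable (F g) (branch μ ν g)) :
    Integrable (boundarySum T z F) (pathMeasure μ) ∧
      ∫ X, boundarySum T z F X ∂(pathMeasure μ) = ∑ g ∈ T, ∫ x, F g x ∂(branch μ ν g) := by
  have hg (g : SL2R) : MeasurableSet {X : ℕ → SL2R | X 0 = g} :=
    measurableSet_zero_eq g
  have h1 : ∀ g ∈ T, Integrable (Set.indicator {X : ℕ → SL2R | X 0 = g} fun X => F g (z X))
      (pathMeasure μ) := fun g hgT => by
    rw [integrable_indicator_iff (hg g)]
    have := hF g hgT
    rw [← map_restrict_boundary hz hz' g] at this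
    exact this.comp_measurable hz.measurable
  refine ⟨integrable_finsetSum T h1, ?_⟩
  simp only [boundarySum]
  rw [integral_finsetSum T h1]
  refine Finset.sum_congr rfl fun g hgT => ?_
  have := hF g hgT
  rw [← map_restrict_boundary hz hz' g] at this ⊢
  rw [integral_indicator (hg g), integral_map hz.measurable.aemeasurable this.aestronglyMeasurable]

lemma exists_pos_le_of_finset {α : Type*} (T : Finset α) {d : α → ℝ} (hd : ∀ a ∈ T, 0 < d a) :
    ∃ δ > 0, ∀ a ∈ T, δ ≤ d a := by
  have h : ∀ᶠ δ in 𝓝[>] (0 : ℝ), ∀ a ∈ T, δ ≤ d a :=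
    (Finset.eventually_all T).2 fun a ha => Filter.mem_of_superset (Ioo_mem_nhdsGT (hd a ha))
      fun δ hδ => hδ.2.le
  obtain ⟨δ, h1, h2⟩ := (h.and self_mem_nhdsWithin).exists
  exact ⟨δ, h2, h1⟩

/-- The logarithmic change of the stationary measure of a small arc around the limit point under the
inverse of the first step is, up to a small error, an integrable function of the path. -/
lemma exists_arc_cocycle (hfin : μ.support.Finite) [IsProbabilityMeasure ν]
    (hν : IsStationaryMeasure μ ν) {z : (ℕ → SL2R) → RP1}
    (hz : MeasurePreserving z (pathMeasure μ) ν)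
    (hz' : ∀ᵐ X ∂(pathMeasure μ), z X = X 0 • z (shift X)) :
    ∃ ψ : (ℕ → SL2R) → ℝ, Measurable ψ ∧ Integrable ψ (pathMeasure μ) ∧
      ∀ ε > 0, ∃ δ > 0, ∃ W : (ℕ → SL2R) → ℝ, Measurable W ∧ (∀ X, 0 ≤ W X) ∧
        Integrable W (pathMeasure μ) ∧ ∫ X, W X ∂(pathMeasure μ) ≤ ε ∧
        ∀ᵐ X ∂(pathMeasure μ), ∀ B, IsArc B → z X ∈ B → B ⊆ Metric.ball (z X) δ →
          |Real.log (ν.real {x | X 0 • x ∈ B}) - Real.log (ν.real B) - ψ X| ≤ W X := by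
  obtain ⟨T, hT⟩ := finSupp_of_support_finite hfin
  have hX0 : ∀ᵐ X ∂(pathMeasure μ), X 0 ∈ T := by
    have h : ∀ᵐ g ∂μ, g ∈ T := by
      refine measure_mono_null (fun g hg => ?_) hT
      exact hg
    exact ((measurePreserving_zero_shift μ).quasiMeasurePreserving.ae
      (Measure.quasiMeasurePreserving_fst.ae h))
  set h : SL2R → RP1 → ℝ := fun g x => ((branch μ ν g).rnDeriv ν x).toReal with hh
  have key := fun g => exists_arc_log_approx (branch_le hν g) (h := h g) rfl
  -- `branch μ ν g B = μ {g} * ν (g⁻¹ B)`, so the logarithm of `ν (g⁻¹ B) / ν B` is the log ratio of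
  -- the branch to `ν`, close to the log density at the limit point, minus `log μ {g}`.
  have hψ := integrable_boundarySum (T := T) hz hz' (F := fun g x => Real.log (h g x) - Real.log (μ.real {g}))
    fun g _ => (key g).2.1.sub (integrable_const _)
  refine ⟨boundarySum T z fun g x => Real.log (h g x) - Real.log (μ.real {g}),
    measurable_boundarySum hz.measurable fun g _ =>
      (Real.measurable_log.comp (key g).1).sub_const _, hψ.1, fun ε hε => ?_⟩
  choose δ hδ W hWm hW0 hWi hWε hW using fun g => (key g).2.2 (ε / (T.card + 1)) (by positivity)
  obtain ⟨δ₀, hδ₀, hle⟩ := exists_pos_le_of_finset T fun g _ => hδ g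
  have hWi' := integrable_boundarySum (T := T) hz hz' fun g _ => hWi g
  refine ⟨δ₀, hδ₀, boundarySum T z W, measurable_boundarySum hz.measurable fun g _ => hWm g,
    fun X => Finset.sum_nonneg fun g _ => Set.indicator_nonneg (fun X _ => hW0 g _) X, hWi'.1, ?_, ?_⟩
  · rw [hWi'.2]
    refine (Finset.sum_le_sum fun g _ => hWε g).trans ?_
    rw [Finset.sum_const, nsmul_eq_mul, mul_div_assoc', div_le_iff₀ (by positivity)]
    nlinarith
  · have hae : ∀ g ∈ T, ∀ᵐ X ∂(pathMeasure μ), X 0 = g → ∀ B, IsArc B → z X ∈ B →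
        B ⊆ Metric.ball (z X) (δ g) → 0 < (branch μ ν g).real B ∧
        |Real.log ((branch μ ν g).real B) - Real.log (ν.real B) - Real.log (h g (z X))| ≤ W g (z X) := by
      intro g _
      have := hW g
      rw [← map_restrict_boundary hz hz' g] at this
      have h2 := ae_of_ae_map hz.measurable.aemeasurable this
      rw [ae_restrict_iff' (measurableSet_zero_eq g)] at h2
      filter_upwards [h2] with X hX hXg B hB hzB hBδ
      have := hX hXg B hB hzB hBδ
      rw [map_restrict_boundary hz hz' g] at this
      exact this
    filter_upwards [hX0, (ae_ball_iff T.countable_toSet).2 hae] with X hX hall B hB hzB hBδ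
    rw [boundarySum_eq z _ hX, boundarySum_eq z _ hX]
    obtain ⟨hpos, hb⟩ := hall (X 0) hX rfl B hB hzB
      (hBδ.trans (Metric.ball_subset_ball (hle _ hX)))
    have e : (branch μ ν (X 0)).real B = μ.real {X 0} * ν.real {x | X 0 • x ∈ B} := by
      rw [Measure.real, branch_apply _ hB.measurableSet, ENNReal.toReal_mul]
      rfl
    rw [e] at hpos hb
    have h1 : μ.real {X 0} ≠ 0 := fun h => by simp [h] at hpos
    have h2 : ν.real {x | X 0 • x ∈ B} ≠ 0 := fun h => by simp [h] at hpos
    rw [Real.log_mul h1 h2] at hb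
    convert! hb using 2
    ring

/-! ### Balls of polynomially small measure -/

lemma exists_angle (x : RP1) : ∃ θ : ℝ, |θ| ≤ 4 ∧ ∃ h : (![Real.cos θ, Real.sin θ] : Fin 2 → ℝ) ≠ 0,
    x = Projectivization.mk ℝ ![Real.cos θ, Real.sin θ] h := by
  set w : ℂ := ⟨x.rep 0, x.rep 1⟩ with hw
  refine ⟨w.arg, (Complex.abs_arg_le_pi w).trans Real.pi_le_four, ?_, ?_⟩
  · intro h
    have h0 := congrFun h 0
    have h1 := congrFun h 1
    simp only [Matrix.cons_val_zero, Matrix.cons_val_one, Pi.zero_apply] at h0 h1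
    have := Real.sin_sq_add_cos_sq w.arg
    rw [h0, h1] at this
    norm_num at this
  · conv_lhs => rw [← x.mk_rep]
    rw [mk_eq_mk_iff_cross]
    have h1 : ‖w‖ * Real.cos w.arg = x.rep 0 := Complex.norm_mul_cos_arg w
    have h2 : ‖w‖ * Real.sin w.arg = x.rep 1 := Complex.norm_mul_sin_arg w
    simp only [cross, Matrix.cons_val_zero, Matrix.cons_val_one]
    rw [← h1, ← h2]
    ring

/-- Angles in `[-4, 4]`, which contains `[-π, π]`, on a grid of step `1 / N`: there are `8 * N + 1 ≤
9 * N` of them. -/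
lemma exists_net (N : ℕ) (hN : 0 < N) : ∃ F : Finset RP1, F.card ≤ 9 * N ∧
    ∀ x, ∃ y ∈ F, dist x y ≤ 1 / N := by
  classical
  have hne (θ : ℝ) : (![Real.cos θ, Real.sin θ] : Fin 2 → ℝ) ≠ 0 := by
    intro h
    have h0 := congrFun h 0
    have h1 := congrFun h 1
    simp only [Matrix.cons_val_zero, Matrix.cons_val_one, Pi.zero_apply] at h0 h1
    have := Real.sin_sq_add_cos_sq θ
    rw [h0, h1] at this
    norm_num at this
  let f : ℤ → RP1 := fun j => Projectivization.mk ℝ _ (hne (j / N))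
  refine ⟨(Finset.Icc (-(4 * N) : ℤ) (4 * N)).image f, Finset.card_image_le.trans ?_, fun x => ?_⟩
  · rw [Int.card_Icc]
    omega
  · obtain ⟨θ, hθ, h, rfl⟩ := exists_angle x
    have hN' : (0 : ℝ) < N := by exact_mod_cast hN
    obtain ⟨h1, h2⟩ := abs_le.1 hθ
    have f1 := Int.floor_le (θ * N)
    have f2 := Int.lt_floor_add_one (θ * N)
    refine ⟨f ⌊θ * N⌋, Finset.mem_image_of_mem f (Finset.mem_Icc.2 ⟨?_, ?_⟩), ?_⟩
    · refine Int.le_floor.2 ?_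
      push_cast
      nlinarith
    · have : (⌊θ * N⌋ : ℝ) ≤ 4 * N := f1.trans (by nlinarith)
      exact_mod_cast this
    · have hs : ∀ t : ℝ, nsq ![Real.cos t, Real.sin t] = 1 := fun t => by
        simp [nsq]
      rw [dist_mk, hs, hs]
      have : cross ![Real.cos θ, Real.sin θ] ![Real.cos (⌊θ * N⌋ / N), Real.sin (⌊θ * N⌋ / N)] =
          Real.sin (⌊θ * N⌋ / N - θ) := by
        rw [Real.sin_sub]
        simp [cross]
        ring
      rw [this, Real.sqrt_one, mul_one, div_one]
      refine Real.abs_sin_le_abs.trans ?_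
      rw [abs_sub_comm, abs_le, le_div_iff₀ hN', neg_le_iff_add_nonneg]
      have e : (θ - ⌊θ * N⌋ / N) * N = θ * N - ⌊θ * N⌋ := by field_simp
      refine ⟨?_, by linarith⟩
      have : (⌊θ * N⌋ : ℝ) / N ≤ θ := by rwa [div_le_iff₀ hN']
      have : (0 : ℝ) ≤ 1 / N := by positivity
      linarith

lemma exists_nat_near {ρ : ℝ} (hρ : 0 < ρ) (hρ1 : ρ ≤ 1) :
    ∃ N : ℕ, 0 < N ∧ 3 / ρ ≤ N ∧ (N : ℝ) ≤ 4 / ρ := by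
  refine ⟨⌈3 / ρ⌉₊, Nat.ceil_pos.2 (by positivity), Nat.le_ceil _, ?_⟩
  have h1 := Nat.ceil_lt_add_one (a := 3 / ρ) (by positivity)
  have h2 : 1 ≤ 1 / ρ := by rw [le_div_iff₀ hρ]; linarith
  have : 3 / ρ + 1 / ρ = 4 / ρ := by ring
  linarith

lemma measure_biUnion_small_ball_le {F : Finset RP1} {N : ℕ} (hF : F.card ≤ 9 * N) {ρ : ℝ}
    (hρ : 0 < ρ) (hN2 : (N : ℝ) ≤ 4 / ρ) {c : RP1 → Set RP1} (hc : ∀ y ∈ F, ν (c y) ≤ ENNReal.ofReal (ρ ^ 2)) :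
    ν (⋃ y ∈ F, c y) ≤ ENNReal.ofReal (36 * ρ) := by
  refine (measure_biUnion_finset_le _ _).trans ((Finset.sum_le_sum hc).trans ?_)
  rw [Finset.sum_const, nsmul_eq_mul, ← ENNReal.ofReal_natCast, ← ENNReal.ofReal_mul (by positivity)]
  refine ENNReal.ofReal_le_ofReal ?_
  have h1 : (F.card : ℝ) ≤ 9 * (4 / ρ) := by
    have : (F.card : ℝ) ≤ 9 * N := by exact_mod_cast hF
    linarith
  calc (F.card : ℝ) * ρ ^ 2 ≤ 9 * (4 / ρ) * ρ ^ 2 := by gcongr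
    _ = 36 * ρ := by field_simp; ring

/-- Off a set of small measure, balls have at least quadratic measure. -/
lemma exists_small_ball_set [IsProbabilityMeasure ν] {ρ : ℝ} (hρ : 0 < ρ) (hρ1 : ρ ≤ 1) :
    ∃ U : Set RP1, MeasurableSet U ∧ ν U ≤ ENNReal.ofReal (36 * ρ) ∧
      ∀ x ∉ U, ρ ^ 2 ≤ ν.real (Metric.ball x ρ) := by
  classical
  obtain ⟨N, hN0, hN, hN2⟩ := exists_nat_near hρ hρ1
  obtain ⟨F, hF, hcov⟩ := exists_net N hN0
  -- The bad set consists of the balls around net points with measure below `ρ ^ 2`. There are `O(1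
  -- / ρ)` of them, so their total measure is `O(ρ)`; a point outside is near a net point whose ball
  -- is not light.
  obtain ⟨F', hF'⟩ : ∃ F', F' = F.filter fun y => ν.real (Metric.ball y (ρ / 2)) < ρ ^ 2 := ⟨_, rfl⟩
  have hmem : ∀ y, y ∈ F' ↔ y ∈ F ∧ ν.real (Metric.ball y (ρ / 2)) < ρ ^ 2 := fun y => by
    rw [hF', Finset.mem_filter]
  have hcard : F'.card ≤ 9 * N := by
    rw [hF']
    exact (Finset.card_filter_le _ _).trans hF
  clear hF'
  refine ⟨⋃ y ∈ F', Metric.ball y (ρ / 2),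
    Finset.measurableSet_biUnion _ fun y _ => Metric.isOpen_ball.measurableSet,
    measure_biUnion_small_ball_le hcard hρ hN2 fun y hy => ?_, fun x hx => ?_⟩
  · rw [← ofReal_measureReal]
    exact ENNReal.ofReal_le_ofReal ((hmem y).1 hy).2.le
  · obtain ⟨y, hy, hxy⟩ := hcov x
    have hxy' : dist x y < ρ / 2 := by
      have : 1 / (N : ℝ) ≤ ρ / 3 := by
        rw [div_le_iff₀ (lt_of_lt_of_le (by positivity) hN)]
        have : ρ / 3 * (3 / ρ) = 1 := by field_simp
        nlinarith
      linarith
    by_contra hlt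
    refine hx (Set.mem_iUnion₂.2 ⟨y, (hmem y).2 ⟨hy, lt_of_le_of_lt ?_ (not_le.1 hlt)⟩, hxy'⟩)
    refine measureReal_mono (fun w hw => ?_)
    have hw : dist w y < ρ / 2 := hw
    rw [Metric.mem_ball]
    have := dist_triangle_right w x y
    linarith

end

end FurstenbergMeasure
end

open MeasureTheory Filter Topology
open scoped Matrix
open FurstenbergMeasure

set_option linter.unusedSectionVars false

noncomputable section

namespace FurstenbergMeasure

open scoped ENNReal

/-! ### The local dimension of the stationary measure -/

section

variable {μ : Measure SL2R} [IsProbabilityMeasure μ] {ν : Measure RP1}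

lemma exists_le_mul_of_eventually {a b : ℕ → ℝ} (hb : ∀ k, 0 < b k) (ha : ∀ k, 0 ≤ a k) {c : ℝ}
    (hc : 0 < c) (h : ∀ᶠ k in atTop, a k ≤ c * b k) : ∃ C > 0, ∀ k, a k ≤ C * b k := by
  obtain ⟨K, hK⟩ := eventually_atTop.1 h
  have h0 : ∀ k, 0 ≤ a k / b k := fun k => div_nonneg (ha k) (hb k).le
  have hs : 0 ≤ ∑ k ∈ Finset.range K, a k / b k := Finset.sum_nonneg fun k _ => h0 k
  refine ⟨c + ∑ k ∈ Finset.range K, a k / b k, by positivity, fun k => ?_⟩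
  rcases lt_or_ge k K with hk | hk
  · rw [← div_le_iff₀ (hb k)]
    have := Finset.single_le_sum (f := fun k => a k / b k) (fun k _ => h0 k) (Finset.mem_range.2 hk)
    linarith
  · refine (hK k hk).trans (mul_le_mul_of_nonneg_right ?_ (hb k).le)
    linarith

lemma ae_boundary_eq {z : (ℕ → SL2R) → RP1}
    (hz' : ∀ᵐ X ∂(pathMeasure μ), z X = X 0 • z (shift X)) :
    ∀ᵐ X ∂(pathMeasure μ), ∀ n, z X = rightProd X n • z (shift^[n] X) := by
  have h : ∀ᵐ X ∂(pathMeasure μ), ∀ n, z (shift^[n] X) = (shift^[n] X) 0 • z (shift (shift^[n] X)) :=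
    ae_all_iff.2 fun n => ((measurePreserving_shift μ).iterate n).quasiMeasurePreserving.ae hz'
  filter_upwards [h] with X hX n
  induction n with
  | zero => simp [rightProd]
  | succ n ih =>
    rw [ih, rightProd, mul_smul, Function.iterate_succ_apply', hX n, shift_iterate, add_zero]

lemma stretch_sq_le_add (g : SL2R) (x y : RP1) :
    stretch g x ^ 2 ≤ stretch g y ^ 2 + 2 * fro g ^ 2 * dist x y := by
  rw [stretch_sq, stretch_sq, dist_eq_emb, Complex.dist_eq, fro_sq]
  have h1 := Complex.abs_re_le_norm (emb x - emb y)
  have h2 := Complex.abs_im_le_norm (emb x - emb y)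
  rw [Complex.sub_re] at h1
  rw [Complex.sub_im] at h2
  obtain ⟨h3, h4⟩ := abs_le.1 h1
  obtain ⟨h5, h6⟩ := abs_le.1 h2
  unfold stretchSq
  generalize ‖emb x - emb y‖ = D at *
  generalize (emb x).re = p at *
  generalize (emb y).re = q at *
  generalize (emb x).im = p' at *
  generalize (emb y).im = q' at *
  generalize g 0 0 = a
  generalize g 0 1 = b
  generalize g 1 0 = c
  generalize g 1 1 = d
  nlinarith [mul_nonneg (sq_nonneg a) (sub_nonneg.2 h4), mul_nonneg (sq_nonneg c) (sub_nonneg.2 h4),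
    mul_nonneg (sq_nonneg b) (sub_nonneg.2 h3), mul_nonneg (sq_nonneg d) (sub_nonneg.2 h3),
    mul_nonneg (sq_nonneg (a + b)) (sub_nonneg.2 h6), mul_nonneg (sq_nonneg (a - b)) (sub_nonneg.2 h5),
    mul_nonneg (sq_nonneg (c + d)) (sub_nonneg.2 h6), mul_nonneg (sq_nonneg (c - d)) (sub_nonneg.2 h5)]

/-- The inverse of `g` expands distances by at most `fro g ^ 2`; this keeps the preimages of a tiny
ball small. -/
lemma dist_le_dist_smul_mul (g : SL2R) (x y : RP1) : dist x y ≤ dist (g • x) (g • y) * fro g ^ 2 := by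
  have hx := stretch_pos g x
  have hy := stretch_pos g y
  have h : dist x y = dist (g • x) (g • y) * (stretch g x * stretch g y) := by
    rw [dist_smul_smul, div_mul_cancel₀ _ (mul_pos hx hy).ne']
  rw [h, sq]
  exact mul_le_mul_of_nonneg_left (mul_le_mul (stretch_le_fro _ _) (stretch_le_fro _ _) hy.le
    (fro_pos g).le) dist_nonneg

/-- Telescoping of the measures of the preimages of a small ball along a path. -/
lemma abs_log_sub_birkhoffSum_le {z : (ℕ → SL2R) → RP1} {ψ W : (ℕ → SL2R) → ℝ} {X : ℕ → SL2R} {δ r : ℝ}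
    (hzX : ∀ n, z X = rightProd X n • z (shift^[n] X))
    (hX : ∀ n, ∀ B, IsArc B → z (shift^[n] X) ∈ B → B ⊆ Metric.ball (z (shift^[n] X)) δ →
      |Real.log (ν.real {x | (shift^[n] X) 0 • x ∈ B}) - Real.log (ν.real B) - ψ (shift^[n] X)| ≤
        W (shift^[n] X)) (hr : 0 < r) (hr1 : r < 1) (n : ℕ)
    (hn : ∀ k < n, r * fro (rightProd X k) ^ 2 ≤ δ) :
    |Real.log (ν.real {x | rightProd X n • x ∈ Metric.ball (z X) r}) -
      Real.log (ν.real (Metric.ball (z X) r)) - birkhoffSum shift ψ n X| ≤ birkhoffSum shift W n X := by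
  induction n with
  | zero => simp [rightProd, Metric.ball]
  | succ n ih =>
    have h1 := ih fun k hk => hn k (by omega)
    -- The preimage of the ball under the first `n` factors is an arc around the limit point of the
    -- path shifted `n` times, and the hypothesis on `fro` keeps it inside the radius `δ` where the
    -- one-step estimate holds.
    have h2 := hX n _ ((isArc_ball (z X) hr hr1).preimage_smul (rightProd X n))
      (by rw [Set.mem_ofPred_eq, ← hzX n]; exact Metric.mem_ball_self hr) (fun y hy => by
        rw [Set.mem_ofPred_eq, Metric.mem_ball] at hy
        rw [Metric.mem_ball]
        refine (dist_le_dist_smul_mul (rightProd X n) _ _).trans_lt ?_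
        rw [← hzX n]
        exact (mul_lt_mul_of_pos_right hy (pow_pos (fro_pos _) 2)).trans_le (hn n (by omega)))
    have e : {x : RP1 | (shift^[n] X) 0 • x ∈ {x | rightProd X n • x ∈ Metric.ball (z X) r}} =
        {x | rightProd X (n + 1) • x ∈ Metric.ball (z X) r} := by
      ext x
      simp only [Set.mem_ofPred_eq, rightProd, mul_smul, shift_iterate, add_zero]
    rw [e] at h2
    rw [birkhoffSum_succ, birkhoffSum_succ]
    rw [abs_le] at *
    constructor <;> linarith [h1.1, h1.2, h2.1, h2.2]

/-- On so small a ball the stretch stays at least `A / 2`, by its Lipschitz bound, so `g` contracts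
distances to the centre by the factor `A ^ 2 / 2`. -/
lemma ball_subset_preimage_ball {g : SL2R} {x : RP1} {A ρ r F : ℝ} (hA : 0 < A)
    (hx : A ≤ stretch g x) (hF : fro g ^ 2 ≤ F) (h1 : 2 * F * ρ ≤ 3 / 4 * A ^ 2)
    (h2 : 2 * ρ ≤ r * A ^ 2) : Metric.ball x ρ ⊆ {y | g • y ∈ Metric.ball (g • x) r} := by
  intro y hy
  rw [Metric.mem_ball] at hy
  have hρ : 0 < ρ := dist_nonneg.trans_lt hy
  have hF0 : 0 ≤ F := (sq_nonneg _).trans hF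
  rw [Set.mem_ofPred_eq, Metric.mem_ball, dist_smul_smul, div_lt_iff₀ (mul_pos (stretch_pos _ _) (stretch_pos _ _))]
  have h3 := stretch_sq_le_add g x y
  rw [dist_comm] at h3
  have h4 : 2 * fro g ^ 2 * dist y x ≤ 2 * F * ρ := by gcongr
  have h5 : A ^ 2 ≤ stretch g x ^ 2 := by gcongr
  have h6 : A / 2 ≤ stretch g y := by
    refine le_of_sq_le_sq ?_ (stretch_pos g y).le
    nlinarith
  have hr : 0 < r := by
    by_contra h
    nlinarith [mul_nonneg (neg_nonneg.2 (not_lt.1 h)) (sq_nonneg A)]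
  have h7 : A / 2 * A ≤ stretch g y * stretch g x := mul_le_mul h6 hx hA.le (stretch_pos g y).le
  nlinarith

/-- Along a typical path the balls around the limit points have at least quadratic measure. -/
lemma ae_eventually_measure_ball_ge [IsProbabilityMeasure ν] {z : (ℕ → SL2R) → RP1}
    (hz : MeasurePreserving z (pathMeasure μ) ν) {c : ℝ} (hc : 0 < c) :
    ∀ᵐ X ∂(pathMeasure μ), ∀ᶠ n : ℕ in atTop,
      Real.exp (-(c * n)) ^ 2 ≤ ν.real (Metric.ball (z (shift^[n] X)) (Real.exp (-(c * n)))) := by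
  choose U hUm hU hUb using fun n : ℕ => exists_small_ball_set (ν := ν) (Real.exp_pos (-(c * n)))
    (Real.exp_le_one_iff.2 (by have : (0 : ℝ) ≤ c * n := by positivity
                               linarith))
  have hB : ∀ n, pathMeasure μ {X | z (shift^[n] X) ∈ U n} ≤
      ENNReal.ofReal (36 * Real.exp (-(c * n))) := fun n => by
    refine le_trans (le_of_eq ?_) (hU n)
    exact (hz.comp ((measurePreserving_shift μ).iterate n)).measure_preimage (hUm n).nullMeasurableSet
  have h0 := measure_limsup_atTop_eq_zero (ne_top_of_le_ne_top (tsum_ofReal_exp_ne_top hc 36)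
    (ENNReal.tsum_le_tsum hB))
  filter_upwards [measure_eq_zero_iff_ae_notMem.1 h0] with X hX
  rw [mem_limsup_iff_frequently_mem, not_frequently] at hX
  filter_upwards [hX] with n hn
  exact hUb n _ hn

lemma tendsto_exp_neg_mul_nat {c : ℝ} (hc : 0 < c) :
    Tendsto (fun n : ℕ => Real.exp (-(c * n))) atTop (𝓝 0) :=
  Real.tendsto_exp_neg_atTop_nhds_zero.comp
    (tendsto_natCast_atTop_atTop.const_mul_atTop hc)

/-- The measure of small balls around the limit point of a path. -/
lemma ae_eventually_log_measure_ball (hfin : μ.support.Finite) (hunb : IsUnbounded (generatedGroup μ))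
    (hirr : IsTotallyIrreducible (generatedGroup μ)) [IsProbabilityMeasure ν]
    (hν : IsStationaryMeasure μ ν) {z : (ℕ → SL2R) → RP1}
    (hz : MeasurePreserving z (pathMeasure μ) ν)
    (hz' : ∀ᵐ X ∂(pathMeasure μ), z X = X 0 • z (shift X)) (hχ : 0 < exponent μ ν) :
    ∃ H : ℝ, ∀ ε > 0, ∀ᵐ X ∂(pathMeasure μ), ∀ᶠ n : ℕ in atTop,
      |Real.log (ν.real (Metric.ball (z X) (Real.exp (-(n * (2 * exponent μ ν + 4 * ε)))))) + n * H| ≤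
        20 * ε * n := by
  obtain ⟨ψ, hψm, hψi, hψ⟩ := exists_arc_cocycle hfin hν hz hz'
  refine ⟨∫ X, ψ X ∂(pathMeasure μ), fun ε hε => ?_⟩
  obtain ⟨δ, hδ, W, hWm, hW0, hWi, hWε, hW⟩ := hψ ε hε
  set χ := exponent μ ν with hχdef
  set H := ∫ X, ψ X ∂(pathMeasure μ)
  have hW' : ∀ᵐ X ∂(pathMeasure μ), ∀ n, ∀ B, IsArc B → z (shift^[n] X) ∈ B →
      B ⊆ Metric.ball (z (shift^[n] X)) δ →
      |Real.log (ν.real {x | (shift^[n] X) 0 • x ∈ B}) - Real.log (ν.real B) - ψ (shift^[n] X)| ≤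
        W (shift^[n] X) :=
    ae_all_iff.2 fun n => ((measurePreserving_shift μ).iterate n).quasiMeasurePreserving.ae hW
  have hfro := ae_eventually_fro hfin hunb hirr hν hε (P := pathMeasure μ)
    (Z := fun n X => rightProd X n) fun n => measurePreserving_fst.comp (measurePreserving_rightProd n)
  have hstr := ae_eventually_stretch hfin hunb hirr hν hε (P := pathMeasure μ) (θ := ν)
    (Z := fun n X => (rightProd X n, z (shift^[n] X))) fun n =>
      ((MeasurePreserving.id _).prod hz).comp (measurePreserving_rightProd n)
  filter_upwards [hW', hfro, hstr, ae_boundary_eq hz', ae_eventually_measure_ball_ge hz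
    (show 0 < 8 * ε by positivity), ae_tendsto_birkhoffSum_div hψm hψi,
    ae_tendsto_birkhoffSum_div hWm hWi] with X hX hfX hsX hzX hbX hψX hWX
  -- The growth bound holds only from some time on, but the telescoping needs it for all `k < n`;
  -- the constant covers the initial times.
  obtain ⟨C, hC, hfC⟩ := exists_le_mul_of_eventually
    (a := fun k => fro (rightProd X k)) (b := fun k => Real.exp (k * (χ + ε)))
    (fun k => Real.exp_pos _) (fun k => (fro_pos _).le) two_pos
    (by filter_upwards [hfX] with k hk using hk.2.le)
  have t1 : ∀ᶠ n : ℕ in atTop, C ^ 2 * Real.exp (-(2 * ε * n)) ≤ δ := by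
    have := (tendsto_exp_neg_mul_nat (show 0 < 2 * ε by positivity)).const_mul (C ^ 2)
    rw [mul_zero] at this
    exact this.eventually (eventually_le_nhds hδ)
  have t2 : ∀ᶠ n : ℕ in atTop, Real.exp (-(4 * ε * n)) ≤ 3 / 32 :=
    (tendsto_exp_neg_mul_nat (show 0 < 4 * ε by positivity)).eventually
      (eventually_le_nhds (by norm_num))
  have t3 : ∀ᶠ n : ℕ in atTop, Real.exp (-(2 * ε * n)) ≤ 1 / 2 :=
    (tendsto_exp_neg_mul_nat (show 0 < 2 * ε by positivity)).eventually
      (eventually_le_nhds (by norm_num))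
  have t4 : ∀ᶠ n : ℕ in atTop, |birkhoffSum shift ψ n X / n - H| ≤ ε := by
    filter_upwards [Metric.tendsto_nhds.1 hψX ε hε] with n hn
    exact (Real.dist_eq _ _ ▸ hn).le
  have t5 : ∀ᶠ n : ℕ in atTop, birkhoffSum shift W n X / n ≤ 2 * ε := by
    filter_upwards [hWX.eventually (eventually_le_nhds (lt_of_le_of_lt hWε (by linarith : ε < 2 * ε)))] with n hn
    exact hn
  filter_upwards [t1, t2, t3, t4, t5, hfX, hsX, hbX, eventually_gt_atTop 0] with n h1 h2 h3 h4 h5 h6 h7 h8 h9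
  have hn : (0 : ℝ) < n := by exact_mod_cast h9
  -- The surplus `4 * ε` over twice the exponent beats the growth `2 * ε` of the squared norms, so
  -- all pullbacks up to time `n` stay below `δ`. The price is that the last pullback may have
  -- shrunk, but only subexponentially.
  set r := Real.exp (-(n * (2 * χ + 4 * ε))) with hr
  have hr1 : r < 1 := Real.exp_lt_one_iff.2 (by
    have : 0 < n * (2 * χ + 4 * ε) := by positivity
    linarith)
  have htel := abs_log_sub_birkhoffSum_le hzX hX (Real.exp_pos _) hr1 n fun k hk => by
    have hk' : (k : ℝ) ≤ n := by exact_mod_cast hk.le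
    calc r * fro (rightProd X k) ^ 2 ≤ r * (C * Real.exp (n * (χ + ε))) ^ 2 := by
          have := hfC k
          have h0 := fro_pos (rightProd X k)
          have hχε : 0 ≤ χ + ε := by positivity
          gcongr
          refine this.trans ?_
          gcongr
      _ = C ^ 2 * Real.exp (-(2 * ε * n)) := by
          rw [mul_pow, mul_left_comm, ← Real.exp_nat_mul, hr, ← Real.exp_add]
          congr 2
          push_cast
          ring
      _ ≤ δ := h1
  rw [← hr] at htel
  set A := Real.exp (n * (χ - ε)) with hA
  have hA2 : A ^ 2 = Real.exp (2 * n * (χ - ε)) := by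
    rw [hA, ← Real.exp_nat_mul]; congr 1; push_cast; ring
  -- The pullback at time `n` contains a ball of radius `exp (-8εn)`, whose measure is at least `exp
  -- (-16εn)`. Adding `ε` for the Birkhoff average of `ψ` and `2 * ε` for that of the error `W`
  -- stays within `20 * ε`.
  have hsub : Metric.ball (z (shift^[n] X)) (Real.exp (-(8 * ε * n))) ⊆
      {x | rightProd X n • x ∈ Metric.ball (z X) r} := by
    rw [hzX n]
    refine ball_subset_preimage_ball (F := 4 * Real.exp (2 * n * (χ + ε))) (Real.exp_pos _) h7.1.le ?_ ?_ ?_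
    · have h0 := fro_pos (rightProd X n)
      calc fro (rightProd X n) ^ 2 ≤ (2 * Real.exp (n * (χ + ε))) ^ 2 := by
            have := h6.2.le
            gcongr
        _ = 4 * Real.exp (2 * n * (χ + ε)) := by
            rw [mul_pow, ← Real.exp_nat_mul]
            norm_num
            ring_nf
    · have e : Real.exp (2 * n * (χ + ε)) * Real.exp (-(8 * ε * n)) = A ^ 2 * Real.exp (-(4 * ε * n)) := by
        rw [hA2, ← Real.exp_add, ← Real.exp_add]
        congr 1; ring
      have hA2' : 0 < A ^ 2 := by rw [hA2]; exact Real.exp_pos _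
      nlinarith
    · have e : r * A ^ 2 * Real.exp (-(2 * ε * n)) = Real.exp (-(8 * ε * n)) := by
        rw [hA2, hr, ← Real.exp_add, ← Real.exp_add]
        congr 1; ring
      rw [← e]
      have : 0 < r * A ^ 2 := by rw [hA2, hr]; positivity
      nlinarith
  have hlow : -(16 * ε * n) ≤ Real.log (ν.real {x | rightProd X n • x ∈ Metric.ball (z X) r}) := by
    have h10 := h8.trans (measureReal_mono hsub)
    have h11 := Real.log_le_log (by positivity) h10
    rw [Real.log_pow, Real.log_exp] at h11
    push_cast at h11
    linarith
  have hup : Real.log (ν.real {x | rightProd X n • x ∈ Metric.ball (z X) r}) ≤ 0 :=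
    Real.log_nonpos measureReal_nonneg measureReal_le_one
  rw [div_le_iff₀ hn] at h5
  have h4' : |birkhoffSum shift ψ n X - n * H| ≤ ε * n := by
    have e : birkhoffSum shift ψ n X - n * H = (birkhoffSum shift ψ n X / n - H) * n := by
      field_simp
    rw [e, abs_mul, abs_of_pos hn]
    gcongr
  rw [abs_le] at *
  have := mul_pos hε hn
  constructor <;> linarith [htel.1, htel.2, h4'.1, h4'.2]

end

end FurstenbergMeasure
end

open MeasureTheory Filter Topology
open scoped Matrix
open FurstenbergMeasure

set_option linter.unusedSectionVars false

noncomputable section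

namespace FurstenbergMeasure

/-! ### Exact dimensionality of the stationary measure. -/

open scoped ENNReal

/-- The sample points `n * (c + ε)` have bounded gaps, so monotonicity interpolates between them at
bounded cost; the relative error `O(ε)` disappears as `ε → 0`, for which arbitrarily small values of
`ε` suffice. -/
lemma tendsto_div_of_monotone {f : ℝ → ℝ} (hf : Monotone f) {H c K : ℝ} (hc : 0 < c) (hK : 0 ≤ K)
    (h : ∀ ε₀ > 0, ∃ ε, 0 < ε ∧ ε < ε₀ ∧ ∀ᶠ n : ℕ in atTop, |f (n * (c + ε)) - n * H| ≤ K * ε * n) :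
    Tendsto (fun t => f t / t) atTop (𝓝 (H / c)) := by
  refine Metric.tendsto_nhds.2 fun η hη => ?_
  set S := K / c + |H| / c ^ 2 + 1 with hS
  have hS0 : 0 < S := by positivity
  obtain ⟨ε, hε, hεη, hn⟩ := h (η / (2 * S)) (by positivity)
  have ha : 0 < c + ε := by positivity
  have hfl : Tendsto (fun t : ℝ => ⌊t / (c + ε)⌋₊) atTop atTop :=
    tendsto_nat_floor_atTop.comp (tendsto_id.atTop_div_const ha)
  filter_upwards [hfl.eventually hn, hfl.eventually ((tendsto_add_atTop_nat 1).eventually hn),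
    eventually_gt_atTop 0, eventually_gt_atTop (2 * (|H| + K * ε) / η)] with t h1 h2 ht ht2
  set n := ⌊t / (c + ε)⌋₊ with hn
  have f1 : (n : ℝ) ≤ t / (c + ε) := Nat.floor_le (by positivity)
  have f2 : t / (c + ε) < n + 1 := Nat.lt_floor_add_one _
  set s := t / (c + ε) with hs
  have hst : s * (c + ε) = t := by rw [hs]; field_simp
  have hs0 : 0 < s := by positivity
  have m1 : f (n * (c + ε)) ≤ f t := hf (by rw [← hst]; gcongr)
  have m2 : f t ≤ f ((n + 1 : ℕ) * (c + ε)) := hf (by rw [← hst]; push_cast; gcongr)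
  push_cast at h2 m2
  rw [abs_le] at h1 h2
  have hKε : 0 ≤ K * ε := by positivity
  have a1 := le_abs_self H
  have a2 := neg_abs_le H
  have hx0 : 0 ≤ s - n := by linarith
  have hx1 : s - n ≤ 1 := by linarith
  have b1 : f t - s * H ≤ |H| + K * ε * (s + 1) := by
    have : (1 - (s - n)) * H ≤ 1 * |H| := by
      nlinarith [mul_nonneg (sub_nonneg.2 hx1) (sub_nonneg.2 a1), mul_nonneg hx0 (abs_nonneg H)]
    nlinarith [mul_nonneg hKε hx0]
  have b2 : -(|H| + K * ε * (s + 1)) ≤ f t - s * H := by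
    have : (s - n) * H ≤ 1 * |H| := by
      nlinarith [mul_nonneg hx0 (sub_nonneg.2 a1), mul_nonneg (sub_nonneg.2 hx1) (abs_nonneg H)]
    nlinarith [mul_nonneg hKε hx0]
  have b3 : |f t - s * H| ≤ |H| + K * ε * (s + 1) := abs_le.2 ⟨b2, b1⟩
  have e : f t / t - H / c = (f t - s * H) / t - H * (ε / ((c + ε) * c)) := by
    rw [hs]; field_simp; ring
  rw [Real.dist_eq, e]
  have c1 : |(f t - s * H) / t| ≤ (|H| + K * ε) / t + K * ε / c := by
    rw [abs_div, abs_of_pos ht]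
    calc |f t - s * H| / t ≤ (|H| + K * ε * (s + 1)) / t := by gcongr
      _ = (|H| + K * ε) / t + K * ε / (c + ε) := by rw [← hst]; field_simp; ring
      _ ≤ _ := by gcongr; linarith
  have c2 : |H * (ε / ((c + ε) * c))| ≤ |H| * ε / c ^ 2 := by
    rw [abs_mul, abs_of_pos (by positivity : 0 < ε / ((c + ε) * c)), mul_div_assoc, sq]
    gcongr
    linarith
  have c3 : (|H| + K * ε) / t < η / 2 := by
    rw [div_lt_iff₀ hη] at ht2
    rw [div_lt_iff₀ ht]
    linarith
  have c4 : K * ε / c + |H| * ε / c ^ 2 ≤ η / 2 := by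
    have : K * ε / c + |H| * ε / c ^ 2 = ε * (S - 1) := by rw [hS]; field_simp; ring
    rw [this]
    rw [lt_div_iff₀ (by positivity)] at hεη
    nlinarith
  calc _ ≤ |(f t - s * H) / t| + |H * (ε / ((c + ε) * c))| := abs_sub _ _
    _ < η := by linarith

section

variable {μ : Measure SL2R} [IsProbabilityMeasure μ] {ν : Measure RP1}

lemma measurable_measureReal_ball [IsProbabilityMeasure ν] (r : ℝ) :
    Measurable fun x => ν.real (Metric.ball x r) := by
  have h : MeasurableSet {p : RP1 × RP1 | dist p.2 p.1 < r} :=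
    measurableSet_lt (measurable_snd.dist measurable_fst) measurable_const
  exact (measurable_measure_prodMk_left h).ennreal_toReal

/-- The logarithmic scale of the measure of balls around a point. -/
def logBall (ν : Measure RP1) (x : RP1) (t : ℝ) : ℝ := -Real.log (ν.real (Metric.ball x (Real.exp (-t))))

/-- Membership in the support keeps the ball measures positive; otherwise the convention `log 0 = 0`
would break monotonicity. -/
lemma monotone_logBall [IsProbabilityMeasure ν] {x : RP1} (hx : x ∈ ν.support) :
    Monotone (logBall ν x) := by
  intro s t hst
  refine neg_le_neg (Real.log_le_log ?_ (measureReal_mono (Metric.ball_subset_ball ?_)))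
  · exact ENNReal.toReal_pos ((Measure.mem_support_iff_forall x).1 hx _
      (Metric.ball_mem_nhds x (Real.exp_pos _))).ne' (measure_ne_top _ _)
  · exact Real.exp_le_exp.2 (by linarith)

/-- A stationary measure is exact dimensional, in terms of the sine distance. -/
lemma exists_tendsto_logBall (hfin : μ.support.Finite) (hunb : IsUnbounded (generatedGroup μ))
    (hirr : IsTotallyIrreducible (generatedGroup μ)) [IsProbabilityMeasure ν]
    (hν : IsStationaryMeasure μ ν) (hχ : 0 < exponent μ ν) :
    ∃ α : ℝ, ∀ᵐ x ∂ν, Tendsto (fun t => logBall ν x t / t) atTop (𝓝 α) := by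
  obtain ⟨z, hz, hz'⟩ := exists_boundaryMap hfin hunb hirr hν
  obtain ⟨H, hH⟩ := ae_eventually_log_measure_ball hfin hunb hirr hν hz hz' hχ
  have h1 : ∀ ε > 0, ∀ᵐ x ∂ν, ∀ᶠ n : ℕ in atTop,
      |logBall ν x (n * (2 * exponent μ ν + 4 * ε)) - n * H| ≤ 20 * ε * n := by
    intro ε hε
    have hm : MeasurableSet {x | ∀ᶠ n : ℕ in atTop,
        |logBall ν x (n * (2 * exponent μ ν + 4 * ε)) - n * H| ≤ 20 * ε * n} := by
      have e : {x | ∀ᶠ n : ℕ in atTop,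
          |logBall ν x (n * (2 * exponent μ ν + 4 * ε)) - n * H| ≤ 20 * ε * n} =
          ⋃ N : ℕ, ⋂ n : ℕ, ⋂ _ : N ≤ n,
            {x | |logBall ν x (n * (2 * exponent μ ν + 4 * ε)) - n * H| ≤ 20 * ε * n} := by
        ext x
        simp [eventually_atTop]
      rw [e]
      refine MeasurableSet.iUnion fun N => MeasurableSet.iInter fun n => MeasurableSet.iInter fun _ =>
        measurableSet_le ?_ measurable_const
      exact measurable_norm.comp (((Real.measurable_log.comp
        (measurable_measureReal_ball _)).neg).sub_const _)
    rw [← hz.map_eq, ae_map_iff hz.measurable.aemeasurable (by rw [hz.map_eq]; exact hm), hz.map_eq]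
    filter_upwards [hH ε hε] with X hX
    filter_upwards [hX] with n hn
    rw [logBall, ← abs_neg]
    convert! hn using 2
    ring
  have h2 : ∀ᵐ x ∂ν, ∀ j : ℕ, ∀ᶠ n : ℕ in atTop,
      |logBall ν x (n * (2 * exponent μ ν + 4 * (1 / ((j : ℝ) + 1)))) - n * H| ≤
        20 * (1 / ((j : ℝ) + 1)) * n := ae_all_iff.2 fun j => h1 _ (by positivity)
  refine ⟨H / (2 * exponent μ ν), ?_⟩
  filter_upwards [h2, Measure.support_mem_ae] with x hx hxs
  refine tendsto_div_of_monotone (monotone_logBall hxs) (K := 5) (by positivity) (by norm_num)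
    fun ε₀ hε₀ => ?_
  obtain ⟨j, hj⟩ := exists_nat_one_div_lt (show 0 < ε₀ / 4 by positivity)
  refine ⟨4 * (1 / ((j : ℝ) + 1)), by positivity, by linarith, ?_⟩
  filter_upwards [hx j] with n hn
  refine hn.trans (le_of_eq ?_)
  ring

lemma distRP1_eq (x y : RP1) : distRP1 x y = Real.arcsin (dist x y) / Real.pi := by
  have hx := nsq_pos x.rep_nonzero
  have hy := nsq_pos y.rep_nonzero
  have hd : ∀ v w : Fin 2 → ℝ, v ⬝ᵥ w = v 0 * w 0 + v 1 * w 1 := fun v w => by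
    simp [dotProduct, Fin.sum_univ_two]
  have hn : ∀ v : Fin 2 → ℝ, v ⬝ᵥ v = nsq v := fun v => by rw [hd, nsq]; ring
  have e : 1 - ((x.rep ⬝ᵥ y.rep) / (√(x.rep ⬝ᵥ x.rep) * √(y.rep ⬝ᵥ y.rep))) ^ 2 = dist x y ^ 2 := by
    rw [hn, hn, hd, div_pow, mul_pow, Real.sq_sqrt hx.le, Real.sq_sqrt hy.le, dist_eq_emb, emb, emb,
      dist_embVec_sq x.rep_nonzero y.rep_nonzero]
    have := (mul_pos hx hy).ne'
    field_simp
    simp only [nsq, cross]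
    ring
  rw [distRP1, e, Real.sqrt_sq dist_nonneg, abs_of_nonneg (Real.arcsin_nonneg.2 dist_nonneg)]
  ring

lemma setOf_distRP1_lt (x : RP1) {r : ℝ} (hr : 0 < r) (hr1 : r < 1 / 2) :
    {y | distRP1 x y < r} = Metric.ball x (Real.sin (Real.pi * r)) := by
  have hπ := Real.pi_pos
  ext y
  rw [Set.mem_ofPred_eq, distRP1_eq, div_lt_iff₀ hπ, Metric.mem_ball, dist_comm y x, mul_comm r]
  refine Real.arcsin_lt_iff_lt_sin ⟨by linarith [dist_nonneg (x := x) (y := y)], dist_le_one _ _⟩ ⟨?_, ?_⟩ <;>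
    nlinarith

/-- The metric of the statement is `arcsin / π` of the sine distance, so its `r`-balls are sine
balls of radius `sin (π r)`. The logarithms of these radii are asymptotically equal, so the local
dimension is the same. -/
lemma hasExactDim_of_tendsto [IsProbabilityMeasure ν] {α : ℝ}
    (h : ∀ᵐ x ∂ν, Tendsto (fun t => logBall ν x t / t) atTop (𝓝 α)) : HasExactDim ν α := by
  have hπ := Real.pi_pos
  have hlog : Tendsto (fun r : ℝ => Real.log r) (𝓝[>] 0) atBot := Real.tendsto_log_nhdsGT_zero
  have hsin : Tendsto (fun r : ℝ => Real.sin (Real.pi * r) / r) (𝓝[>] 0) (𝓝 Real.pi) := by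
    have : HasDerivAt (fun r : ℝ => Real.sin (Real.pi * r)) Real.pi 0 := by
      have h1 := ((hasDerivAt_id (0 : ℝ)).const_mul Real.pi).sin
      simpa using h1
    have h2 := this.tendsto_slope_zero_right
    simp only [zero_add, mul_zero, Real.sin_zero, sub_zero, smul_eq_mul] at h2
    refine h2.congr fun r => ?_
    rw [inv_mul_eq_div]
  have hrange : ∀ᶠ r : ℝ in 𝓝[>] 0, 0 < r ∧ r < 1 / 2 := Ioo_mem_nhdsGT (by norm_num)
  have hspos : ∀ᶠ r : ℝ in 𝓝[>] 0, 0 < Real.sin (Real.pi * r) := by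
    filter_upwards [hrange] with r hr
    exact Real.sin_pos_of_pos_of_lt_pi (by nlinarith) (by nlinarith)
  have hratio : Tendsto (fun r : ℝ => Real.log (Real.sin (Real.pi * r)) / Real.log r) (𝓝[>] 0) (𝓝 1) := by
    have h1 : Tendsto (fun r : ℝ => 1 + Real.log (Real.sin (Real.pi * r) / r) / Real.log r)
        (𝓝[>] 0) (𝓝 (1 + 0)) :=
      ((hsin.log hπ.ne').div_atBot hlog).const_add 1
    rw [add_zero] at h1
    refine h1.congr' ?_
    filter_upwards [hrange, hspos] with r hr hs
    have : Real.log r ≠ 0 := (Real.log_neg hr.1 (by linarith)).ne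
    rw [Real.log_div hs.ne' hr.1.ne']
    field_simp
    ring
  have hneg : Tendsto (fun r : ℝ => -Real.log (Real.sin (Real.pi * r))) (𝓝[>] 0) atTop := by
    refine tendsto_neg_atBot_atTop.comp (hlog.comp (tendsto_nhdsWithin_iff.2 ⟨?_, hspos⟩))
    have : Tendsto (fun r : ℝ => Real.sin (Real.pi * r)) (𝓝 0) (𝓝 (Real.sin (Real.pi * 0))) :=
      (Real.continuous_sin.comp (continuous_const.mul continuous_id)).tendsto 0
    rw [mul_zero, Real.sin_zero] at this
    exact this.mono_left nhdsWithin_le_nhds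
  filter_upwards [h] with x hx
  have h1 := (hx.comp hneg).mul hratio
  rw [mul_one] at h1
  refine h1.congr' ?_
  filter_upwards [hrange, hspos, hneg.eventually (eventually_gt_atTop 0)] with r hr hs hn
  rw [setOf_distRP1_lt x hr.1 hr.2, Function.comp_apply, logBall, neg_neg, Real.exp_log hs]
  have h1 : Real.log (Real.sin (Real.pi * r)) ≠ 0 := by
    intro h; rw [h] at hn; simp at hn
  have h2 : Real.log r ≠ 0 := (Real.log_neg hr.1 (by linarith)).ne
  field_simp

end

end FurstenbergMeasure
end

open MeasureTheory Filter Topology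
open scoped Matrix
open FurstenbergMeasure

set_option linter.unusedSectionVars false

noncomputable section

namespace FurstenbergMeasure

/-! ### The left-invariant Riemannian distance -/

variable {Q : QuadraticForm ℝ (Matrix (Fin 2) (Fin 2) ℝ)}

lemma continuous_quadraticForm (Q : QuadraticForm ℝ (Matrix (Fin 2) (Fin 2) ℝ)) :
    Continuous fun X : Matrix (Fin 2) (Fin 2) ℝ => Q X := by
  set B := QuadraticMap.associated (R := ℝ) Q
  let e : Fin 2 → Fin 2 → Matrix (Fin 2) (Fin 2) ℝ := fun i j => Matrix.single i j 1
  have hX : ∀ X : Matrix (Fin 2) (Fin 2) ℝ, X = ∑ i, ∑ j, X i j • e i j := fun X => by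
    conv_lhs => rw [Matrix.matrix_eq_sum_single X]
    simp [e]
  have h : ∀ X, Q X = ∑ i, ∑ j, X i j * ∑ k, ∑ l, X k l * B (e i j) (e k l) := fun X => by
    have h1 : Q X = B X X := (QuadraticMap.associated_eq_self_apply ℝ Q X).symm
    have h2 : ∀ Y, B Y X = ∑ k, ∑ l, X k l * B Y (e k l) := fun Y => by
      conv_lhs => rw [hX X]
      simp only [map_sum, map_smul, smul_eq_mul]
    have h3 : B X X = ∑ i, ∑ j, X i j * B (e i j) X := by
      have : ∀ Z, B.flip Z X = ∑ i, ∑ j, X i j * B.flip Z (e i j) := fun Z => by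
        conv_lhs => rw [hX X]
        simp only [map_sum, map_smul, smul_eq_mul]
      exact this X
    exact h1.trans (h3.trans (Finset.sum_congr rfl fun i _ => Finset.sum_congr rfl fun j _ =>
      congrArg (X i j * ·) (h2 _)))
  refine Continuous.congr ?_ fun X => (h X).symm
  have hc := fun i j => continuous_apply_apply (ρ := fun _ _ => ℝ) (i : Fin 2) (j : Fin 2)
  exact continuous_finsetSum _ fun i _ => continuous_finsetSum _ fun j _ => (hc i j).mul
    (continuous_finsetSum _ fun k _ => continuous_finsetSum _ fun l _ => (hc k l).mul continuous_const)

/-- A continuous form that is positive on nonzero trace-zero matrices is bounded below on their unit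
sphere, which is compact; homogeneity does the rest. -/
lemma exists_abs_entry_le (hQ : IsLieAlgebraInner Q) : ∃ K > 0, ∀ X : Matrix (Fin 2) (Fin 2) ℝ,
    X.trace = 0 → ∀ i j, |X i j| ≤ K * √(Q X) := by
  let L : ℝ × ℝ × ℝ → Matrix (Fin 2) (Fin 2) ℝ := fun p => !![p.1, p.2.1; p.2.2, -p.1]
  have hL : Continuous L := by
    refine continuous_matrix fun i j => ?_
    fin_cases i <;> fin_cases j <;> simp [L] <;> fun_prop
  have hne : (Metric.sphere (0 : ℝ × ℝ × ℝ) 1).Nonempty := ⟨(1, 0, 0), by simp⟩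
  obtain ⟨p₀, hp₀, hmin⟩ := (isCompact_sphere (0 : ℝ × ℝ × ℝ) 1).exists_isMinOn hne
    ((continuous_quadraticForm Q).comp hL).continuousOn
  have htr : ∀ p, (L p).trace = 0 := fun p => by simp [L, Matrix.trace_fin_two]
  have hc : 0 < Q (L p₀) := by
    refine hQ _ (htr _) fun h => ?_
    have h00 := congrFun (congrFun h 0) 0
    have h01 := congrFun (congrFun h 0) 1
    have h10 := congrFun (congrFun h 1) 0
    simp only [L, Matrix.of_apply, Matrix.cons_val', Matrix.cons_val_zero, Matrix.cons_val_one,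
      Matrix.zero_apply, Matrix.cons_val_fin_one] at h00 h01 h10
    have : p₀ = 0 := Prod.ext h00 (Prod.ext h01 h10)
    simp [this] at hp₀
  set c := Q (L p₀)
  have key : ∀ p, ‖p‖ ≤ (√c)⁻¹ * √(Q (L p)) := by
    intro p
    by_cases hp : p = 0
    · rw [hp, norm_zero]; positivity
    · have hn : 0 < ‖p‖ := norm_pos_iff.2 hp
      have hs : ‖p‖⁻¹ • p ∈ Metric.sphere (0 : ℝ × ℝ × ℝ) 1 := by
        rw [mem_sphere_zero_iff_norm, norm_smul, norm_inv, norm_norm, inv_mul_cancel₀ hn.ne']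
      have h1 : c ≤ Q (L (‖p‖⁻¹ • p)) := hmin hs
      have h2 : L (‖p‖⁻¹ • p) = ‖p‖⁻¹ • L p := by
        ext i j
        fin_cases i <;> fin_cases j <;> simp [L]
      rw [h2, QuadraticMap.map_smul, smul_eq_mul] at h1
      have h3 : ‖p‖ ^ 2 * c ≤ Q (L p) := by
        have := mul_le_mul_of_nonneg_left h1 (sq_nonneg ‖p‖)
        have e : ‖p‖ ^ 2 * (‖p‖⁻¹ * ‖p‖⁻¹ * Q (L p)) = Q (L p) := by field_simp
        rwa [e] at this
      rw [inv_mul_eq_div, le_div_iff₀ (Real.sqrt_pos.2 hc)]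
      refine Real.le_sqrt_of_sq_le ?_
      rwa [mul_pow, Real.sq_sqrt hc.le]
  refine ⟨(√c)⁻¹, by positivity, fun X hX i j => ?_⟩
  have hXL : X = L (X 0 0, X 0 1, X 1 0) := by
    rw [Matrix.trace_fin_two] at hX
    ext i j
    fin_cases i <;> fin_cases j <;> simp [L]
    linarith
  have h1 := key (X 0 0, X 0 1, X 1 0)
  rw [← hXL] at h1
  refine le_trans ?_ h1
  have e1 := norm_fst_le (X 0 0, X 0 1, X 1 0)
  have e2 := (norm_fst_le (X 0 1, X 1 0)).trans (norm_snd_le (X 0 0, X 0 1, X 1 0))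
  have e3 := (norm_snd_le (X 0 1, X 1 0)).trans (norm_snd_le (X 0 0, X 0 1, X 1 0))
  rw [Matrix.trace_fin_two] at hX
  simp only [Real.norm_eq_abs] at e1 e2 e3
  fin_cases i <;> fin_cases j
  · exact e1
  · exact e2
  · exact e3
  · have : X 1 1 = - X 0 0 := by linarith
    simp only [Fin.mk_one, this, abs_neg]
    exact e1

lemma IsC1Path.hasDerivWithinAt {γ : ℝ → SL2R} (hγ : IsC1Path γ) (i j : Fin 2) {t : ℝ}
    (ht : t ∈ Set.Icc (0 : ℝ) 1) :
    HasDerivWithinAt (fun s => γ s i j) (velocity γ t i j) (Set.Icc 0 1) t :=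
  ((hγ i j).differentiableOn one_ne_zero t ht).hasDerivWithinAt

lemma velocity_eq {γ : ℝ → SL2R} {V : Matrix (Fin 2) (Fin 2) ℝ} {t : ℝ} (ht : t ∈ Set.Icc (0 : ℝ) 1)
    (h : ∀ i j, HasDerivWithinAt (fun s => γ s i j) (V i j) (Set.Icc 0 1) t) : velocity γ t = V := by
  ext i j
  exact (h i j).derivWithin (uniqueDiffOn_Icc zero_lt_one t ht)

lemma IsC1Path.mul_left {γ : ℝ → SL2R} (hγ : IsC1Path γ) (g : SL2R) : IsC1Path fun t => g * γ t := by
  intro i j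
  simp_rw [mul_entry]
  exact (contDiffOn_const.mul (hγ 0 j)).add (contDiffOn_const.mul (hγ 1 j))

lemma IsC1Path.velocity_mul_left {γ : ℝ → SL2R} (hγ : IsC1Path γ) (g : SL2R) {t : ℝ}
    (ht : t ∈ Set.Icc (0 : ℝ) 1) :
    velocity (fun t => g * γ t) t = (g : Matrix (Fin 2) (Fin 2) ℝ) * velocity γ t := by
  refine velocity_eq ht fun i j => ?_
  simp_rw [mul_entry]
  rw [Matrix.mul_apply, Fin.sum_univ_two]
  exact ((hγ.hasDerivWithinAt 0 j ht).const_mul _).add ((hγ.hasDerivWithinAt 1 j ht).const_mul _)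

lemma IsC1Path.pathLength_mul_left {γ : ℝ → SL2R} (hγ : IsC1Path γ) (g : SL2R) :
    pathLength Q (fun t => g * γ t) = pathLength Q γ := by
  refine intervalIntegral.integral_congr fun t ht => ?_
  rw [Set.uIcc_of_le zero_le_one] at ht
  simp only
  rw [hγ.velocity_mul_left g ht, mul_inv_rev, Matrix.SpecialLinearGroup.coe_mul, Matrix.mul_assoc,
    ← Matrix.mul_assoc ((g⁻¹ : SL2R) : Matrix (Fin 2) (Fin 2) ℝ), ← Matrix.SpecialLinearGroup.coe_mul,
    inv_mul_cancel, Matrix.SpecialLinearGroup.coe_one, Matrix.one_mul]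

lemma pathLength_nonneg (γ : ℝ → SL2R) : 0 ≤ pathLength Q γ :=
  intervalIntegral.integral_nonneg zero_le_one fun _ _ => Real.sqrt_nonneg _

lemma riemDist_le_pathLength {γ : ℝ → SL2R} (hγ : IsC1Path γ) : riemDist Q (γ 0) (γ 1) ≤ pathLength Q γ :=
  csInf_le ⟨0, by rintro _ ⟨γ, -, -, -, rfl⟩; exact pathLength_nonneg γ⟩ ⟨γ, hγ, rfl, rfl, rfl⟩

lemma continuousOn_logVelocity {γ : ℝ → SL2R} (hγ : IsC1Path γ) :
    ContinuousOn (fun t => (((γ t)⁻¹ : SL2R) : Matrix (Fin 2) (Fin 2) ℝ) * velocity γ t) (Set.Icc 0 1) := by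
  have hv : ContinuousOn (velocity γ) (Set.Icc 0 1) :=
    continuousOn_pi.2 fun i => continuousOn_pi.2 fun j =>
      (hγ i j).continuousOn_derivWithin (uniqueDiffOn_Icc zero_lt_one) le_rfl
  have hg : ContinuousOn (fun t => (γ t : Matrix (Fin 2) (Fin 2) ℝ)) (Set.Icc 0 1) :=
    continuousOn_pi.2 fun i => continuousOn_pi.2 fun j => (hγ i j).continuousOn
  simp_rw [Matrix.SpecialLinearGroup.coe_inv]
  have hadj : Continuous fun A : Matrix (Fin 2) (Fin 2) ℝ => A.adjugate := Continuous.matrix_adjugate continuous_id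
  have hmul : Continuous fun p : Matrix (Fin 2) (Fin 2) ℝ × Matrix (Fin 2) (Fin 2) ℝ => p.1 * p.2 :=
    continuous_fst.matrix_mul continuous_snd
  exact hmul.comp_continuousOn ((hadj.comp_continuousOn hg).prodMk hv)

lemma row_form_le {p q r s m : ℝ} (hp : |p| ≤ m) (hq : |q| ≤ m) (hr : |r| ≤ m) (hs : |s| ≤ m) (u v : ℝ) :
    u * (u * p + v * r) + v * (u * q + v * s) ≤ 2 * m * (u ^ 2 + v ^ 2) := by
  rw [abs_le] at hp hq hr hs
  have h1 : 0 ≤ 2 * m - (q + r) := by linarith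
  have h2 : 0 ≤ 2 * m + (q + r) := by linarith
  nlinarith [mul_nonneg h1 (sq_nonneg (u + v)), mul_nonneg h2 (sq_nonneg (u - v)),
    mul_nonneg (sub_nonneg.2 hp.2) (sq_nonneg u), mul_nonneg (sub_nonneg.2 hs.2) (sq_nonneg v)]

/-- The norm of the end point of a path is controlled by its length. -/
lemma exists_fro_le_exp_pathLength (hQ : IsLieAlgebraInner Q) : ∃ K > 0, ∀ γ : ℝ → SL2R, IsC1Path γ → γ 0 = 1 →
    fro (γ 1) ^ 2 ≤ 2 * Real.exp (K * pathLength Q γ) := by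
  obtain ⟨K, hK, hKQ⟩ := exists_abs_entry_le hQ
  refine ⟨4 * K, by positivity, fun γ hγ h0 => ?_⟩
  have hpos : ∀ t, 0 < fro (γ t) ^ 2 := fun t => pow_pos (fro_pos _) 2
  set V := velocity γ with hV
  have hd : ∀ i j, ∀ t ∈ Set.Ioo (0 : ℝ) 1, HasDerivAt (fun s => γ s i j) (V t i j) t := fun i j t ht =>
    (hγ.hasDerivWithinAt i j (Set.Ioo_subset_Icc_self ht)).hasDerivAt (Icc_mem_nhds ht.1 ht.2)
  set X : ℝ → Matrix (Fin 2) (Fin 2) ℝ := fun t => (((γ t)⁻¹ : SL2R) : Matrix (Fin 2) (Fin 2) ℝ) * V t with hX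
  have hVX : ∀ t, V t = (γ t : Matrix (Fin 2) (Fin 2) ℝ) * X t := fun t => by
    rw [hX]
    simp only
    rw [← Matrix.mul_assoc, ← Matrix.SpecialLinearGroup.coe_mul, mul_inv_cancel,
      Matrix.SpecialLinearGroup.coe_one, Matrix.one_mul]
  have hXe : ∀ t i j, X t i j = (γ t)⁻¹ i 0 * V t 0 j + (γ t)⁻¹ i 1 * V t 1 j := fun t i j => by
    rw [hX]; simp only [Matrix.mul_apply, Fin.sum_univ_two]
  -- Differentiating `det γ = 1` shows that the logarithmic velocity lies in the Lie algebra, where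
  -- `Q` controls the entries.
  have htr : ∀ t ∈ Set.Ioo (0 : ℝ) 1, (X t).trace = 0 := by
    intro t ht
    have h1 : HasDerivAt (fun s => γ s 0 0 * γ s 1 1 - γ s 0 1 * γ s 1 0)
        ((V t 0 0 * γ t 1 1 + γ t 0 0 * V t 1 1) - (V t 0 1 * γ t 1 0 + γ t 0 1 * V t 1 0)) t :=
      ((hd 0 0 t ht).mul (hd 1 1 t ht)).sub ((hd 0 1 t ht).mul (hd 1 0 t ht))
    simp_rw [det_entries] at h1
    have h2 := h1.unique (hasDerivAt_const t (1 : ℝ))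
    obtain ⟨e1, e2, e3, e4⟩ := inv_entries (γ t)
    rw [Matrix.trace_fin_two, hXe, hXe, e1, e2, e3, e4]
    linarith
  have hφd : ∀ t ∈ Set.Ioo (0 : ℝ) 1, HasDerivWithinAt (fun s => Real.log (fro (γ s) ^ 2))
      ((2 * (γ t 0 0 * V t 0 0 + γ t 0 1 * V t 0 1 + γ t 1 0 * V t 1 0 + γ t 1 1 * V t 1 1)) /
        fro (γ t) ^ 2) (Set.Ioi t) t := by
    intro t ht
    have h1 : HasDerivAt (fun s => fro (γ s) ^ 2)
        (2 * (γ t 0 0 * V t 0 0 + γ t 0 1 * V t 0 1 + γ t 1 0 * V t 1 0 + γ t 1 1 * V t 1 1)) t := by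
      simp_rw [fro_sq]
      have := ((((hd 0 0 t ht).pow 2).add ((hd 0 1 t ht).pow 2)).add ((hd 1 0 t ht).pow 2)).add
        ((hd 1 1 t ht).pow 2)
      refine this.congr_deriv ?_
      push_cast
      ring
    exact (h1.log (hpos t).ne').hasDerivWithinAt
  have hcont : ContinuousOn (fun s => Real.log (fro (γ s) ^ 2)) (Set.Icc 0 1) := by
    refine ContinuousOn.log ?_ fun t _ => (hpos t).ne'
    simp_rw [fro_sq]
    have := fun i j => (hγ i j).continuousOn
    exact ((((this 0 0).pow 2).add ((this 0 1).pow 2)).add ((this 1 0).pow 2)).add ((this 1 1).pow 2)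
  have hint : IntegrableOn (fun t => 4 * K * √(Q (X t))) (Set.Icc 0 1) := by
    refine ContinuousOn.integrableOn_Icc (continuousOn_const.mul ?_)
    exact ((continuous_quadraticForm Q).comp_continuousOn (continuousOn_logVelocity hγ)).sqrt
  -- Gronwall's argument: the logarithmic derivative of `fro (γ t) ^ 2` is at most `4 * K` times the
  -- speed, so integration bounds its growth by the length.
  have hle : ∀ t ∈ Set.Ioo (0 : ℝ) 1,
      (2 * (γ t 0 0 * V t 0 0 + γ t 0 1 * V t 0 1 + γ t 1 0 * V t 1 0 + γ t 1 1 * V t 1 1)) /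
        fro (γ t) ^ 2 ≤ 4 * K * √(Q (X t)) := by
    intro t ht
    rw [div_le_iff₀ (hpos t), fro_sq]
    have hb := hKQ (X t) (htr t ht)
    have hVe : ∀ i j, V t i j = γ t i 0 * X t 0 j + γ t i 1 * X t 1 j := fun i j => by
      rw [hVX, Matrix.mul_apply, Fin.sum_univ_two]
    rw [hVe, hVe, hVe, hVe]
    have r0 := row_form_le (hb 0 0) (hb 0 1) (hb 1 0) (hb 1 1) (γ t 0 0) (γ t 0 1)
    have r1 := row_form_le (hb 0 0) (hb 0 1) (hb 1 0) (hb 1 1) (γ t 1 0) (γ t 1 1)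
    linarith
  have h1 := intervalIntegral.sub_le_integral_of_hasDeriv_right_of_le zero_le_one hcont hφd hint hle
  rw [intervalIntegral.integral_const_mul] at h1
  have h2 : fro (γ 0) ^ 2 = 2 := by rw [h0, fro_sq]; simp; norm_num
  simp only [h2] at h1
  have h3 : Real.log (fro (γ 1) ^ 2) ≤ Real.log (2 * Real.exp (4 * K * pathLength Q γ)) := by
    rw [Real.log_mul two_ne_zero (Real.exp_pos _).ne', Real.log_exp]
    have : pathLength Q γ = ∫ t in (0 : ℝ)..1, √(Q (X t)) := rfl
    rw [this]
    linarith
  exact (Real.log_le_log_iff (hpos 1) (by positivity)).1 h3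

/-- A matrix in Iwasawa coordinates: `(θ, s, y)` stands for the rotation by `θ` times the upper
triangular matrix with diagonal `exp s, exp (-s)` and corner `y`. -/
def iwasawaMatrix (q : ℝ × ℝ × ℝ) : Matrix (Fin 2) (Fin 2) ℝ :=
  !![Real.cos q.1 * Real.exp q.2.1, Real.cos q.1 * q.2.2 - Real.sin q.1 * Real.exp (-q.2.1);
    Real.sin q.1 * Real.exp q.2.1, Real.sin q.1 * q.2.2 + Real.cos q.1 * Real.exp (-q.2.1)]

lemma det_iwasawaMatrix (q : ℝ × ℝ × ℝ) : (iwasawaMatrix q).det = 1 := by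
  have h1 := Real.sin_sq_add_cos_sq q.1
  have h2 : Real.exp q.2.1 * Real.exp (-q.2.1) = 1 := by rw [← Real.exp_add]; simp
  rw [iwasawaMatrix, Matrix.det_fin_two_of]
  linear_combination (Real.exp q.2.1 * Real.exp (-q.2.1)) * h1 + h2

/-- The element of `SL₂(ℝ)` with the given Iwasawa coordinates. -/
def iwasawa (q : ℝ × ℝ × ℝ) : SL2R := ⟨iwasawaMatrix q, det_iwasawaMatrix q⟩

lemma continuous_iwasawaMatrix : Continuous iwasawaMatrix := by
  refine continuous_matrix fun i j => ?_
  fin_cases i <;> fin_cases j <;> simp [iwasawaMatrix] <;> fun_prop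

/-- The velocity at time `t` of the path of the elements with coordinates `t • q`. -/
def iwasawaVelocity (q : ℝ × ℝ × ℝ) (t : ℝ) : Matrix (Fin 2) (Fin 2) ℝ :=
  !![-Real.sin (t * q.1) * q.1 * Real.exp (t * q.2.1) + Real.cos (t * q.1) * (Real.exp (t * q.2.1) * q.2.1),
    (-Real.sin (t * q.1) * q.1 * (t * q.2.2) + Real.cos (t * q.1) * q.2.2) -
      (Real.cos (t * q.1) * q.1 * Real.exp (-(t * q.2.1)) +
        Real.sin (t * q.1) * (Real.exp (-(t * q.2.1)) * -q.2.1));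
    Real.cos (t * q.1) * q.1 * Real.exp (t * q.2.1) + Real.sin (t * q.1) * (Real.exp (t * q.2.1) * q.2.1),
    (Real.cos (t * q.1) * q.1 * (t * q.2.2) + Real.sin (t * q.1) * q.2.2) +
      (-Real.sin (t * q.1) * q.1 * Real.exp (-(t * q.2.1)) +
        Real.cos (t * q.1) * (Real.exp (-(t * q.2.1)) * -q.2.1))]

lemma continuous_iwasawaVelocity : Continuous fun p : (ℝ × ℝ × ℝ) × ℝ => iwasawaVelocity p.1 p.2 := by
  refine continuous_matrix fun i j => ?_
  fin_cases i <;> fin_cases j <;> simp [iwasawaVelocity] <;> fun_prop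

lemma isC1Path_iwasawa (q : ℝ × ℝ × ℝ) : IsC1Path fun t => iwasawa (t • q) := by
  intro i j
  refine ContDiff.contDiffOn ?_
  fin_cases i <;> fin_cases j <;> simp [iwasawa, iwasawaMatrix] <;> fun_prop

lemma velocity_iwasawa (q : ℝ × ℝ × ℝ) {t : ℝ} (ht : t ∈ Set.Icc (0 : ℝ) 1) :
    velocity (fun t => iwasawa (t • q)) t = iwasawaVelocity q t := by
  have hl (a : ℝ) : HasDerivAt (fun t : ℝ => t * a) a t := by
    simpa using (hasDerivAt_id t).mul_const a
  have hc := (hl q.1).cos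
  have hs := (hl q.1).sin
  have he := (hl q.2.1).exp
  have hn := (hl q.2.1).neg.exp
  have hy := hl q.2.2
  refine velocity_eq ht fun i j => HasDerivAt.hasDerivWithinAt ?_
  fin_cases i <;> fin_cases j
  · exact hc.mul he
  · exact (hc.mul hy).sub (hs.mul hn)
  · exact hs.mul he
  · exact (hs.mul hy).add (hc.mul hn)

/-- Polar coordinates of the first column. The coordinates exist for every element, so scaling them
joins it to `1` by a `C¹` path; continuity at `1` makes these paths short for elements near `1`. -/
lemma exists_iwasawa : ∃ f : SL2R → ℝ × ℝ × ℝ, (∀ a, iwasawa (f a) = a) ∧ f 1 = 0 ∧ ContinuousAt f 1 := by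
  let w : SL2R → ℂ := fun a => a 0 0 + a 1 0 * Complex.I
  have hre : ∀ a, (w a).re = a 0 0 := fun a => by simp [w]
  have him : ∀ a, (w a).im = a 1 0 := fun a => by simp [w]
  have hw : ∀ a, w a ≠ 0 := fun a h => by
    have h1 := det_entries a
    rw [← hre, ← him, h] at h1
    simp at h1
  have hw1 : w 1 = 1 := by simp [w]
  have hwc : Continuous w := by
    have h1 := continuous_entry 0 0
    have h2 := continuous_entry 1 0
    fun_prop
  refine ⟨fun a => ((w a).arg, Real.log ‖w a‖,
    a 0 1 * Real.cos (w a).arg + a 1 1 * Real.sin (w a).arg), fun a => ?_, by simp [hw1], ?_⟩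
  · have hn : 0 < ‖w a‖ := norm_pos_iff.2 (hw a)
    have hcos : Real.cos (w a).arg = a 0 0 / ‖w a‖ := by rw [Complex.cos_arg (hw a), hre]
    have hsin : Real.sin (w a).arg = a 1 0 / ‖w a‖ := by rw [Complex.sin_arg, him]
    have hsq : ‖w a‖ ^ 2 = a 0 0 ^ 2 + a 1 0 ^ 2 := by
      rw [Complex.sq_norm, Complex.normSq_apply, hre, him]; ring
    have hdet := det_entries a
    ext i j
    fin_cases i <;> fin_cases j <;>
      simp only [iwasawa, iwasawaMatrix, Fin.zero_eta, Fin.mk_one, Matrix.of_apply, Matrix.cons_val',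
        Matrix.cons_val_zero, Matrix.cons_val_one, Matrix.cons_val_fin_one, Real.exp_neg,
        Real.exp_log hn, hcos, hsin] <;> field_simp <;> rw [hsq]
    · linear_combination a 1 0 * hdet
    · linear_combination (-a 0 0) * hdet
  · have harg : ContinuousAt (fun a => (w a).arg) 1 := by
      refine ContinuousAt.comp (g := Complex.arg) ?_ hwc.continuousAt
      rw [hw1]
      exact Complex.continuousAt_arg (by simp)
    refine harg.prodMk (ContinuousAt.prodMk ?_ ?_)
    · exact hwc.norm.continuousAt.log (by rw [hw1]; simp)
    · exact ((continuous_entry 0 1).continuousAt.mul (Real.continuous_cos.continuousAt.comp harg)).add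
        ((continuous_entry 1 1).continuousAt.mul (Real.continuous_sin.continuousAt.comp harg))

lemma iwasawa_zero : iwasawa 0 = 1 := by
  ext i j
  fin_cases i <;> fin_cases j <;> simp [iwasawa, iwasawaMatrix]

lemma riemDist_mul_iwasawa_le (g : SL2R) (q : ℝ × ℝ × ℝ) : riemDist Q g (g * iwasawa q) ≤
    ∫ t in (0 : ℝ)..1, √(Q ((iwasawaMatrix (t • q)).adjugate * iwasawaVelocity q t)) := by
  have hp := isC1Path_iwasawa q
  have h := riemDist_le_pathLength (Q := Q) (hp.mul_left g)
  rw [hp.pathLength_mul_left g] at h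
  simp only [zero_smul, one_smul, iwasawa_zero, mul_one] at h
  refine h.trans (le_of_eq (intervalIntegral.integral_congr fun t ht => ?_))
  rw [Set.uIcc_of_le zero_le_one] at ht
  simp only [velocity_iwasawa q ht, Matrix.SpecialLinearGroup.coe_inv]
  rfl

lemma continuous_iwasawaLength (Q : QuadraticForm ℝ (Matrix (Fin 2) (Fin 2) ℝ)) :
    Continuous fun q : ℝ × ℝ × ℝ =>
      ∫ t in (0 : ℝ)..1, √(Q ((iwasawaMatrix (t • q)).adjugate * iwasawaVelocity q t)) := by
  refine intervalIntegral.continuous_parametric_intervalIntegral_of_continuous' ?_ 0 1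
  refine Real.continuous_sqrt.comp ((continuous_quadraticForm Q).comp ?_)
  refine Continuous.matrix_mul (Continuous.matrix_adjugate (continuous_iwasawaMatrix.comp ?_))
    continuous_iwasawaVelocity
  exact continuous_snd.smul continuous_fst

/-- The length of the Iwasawa path depends continuously on its end point and vanishes at `1`; left
invariance makes the bound uniform in `g`. -/
lemma eventually_riemDist_mul_lt (Q : QuadraticForm ℝ (Matrix (Fin 2) (Fin 2) ℝ)) {r : ℝ} (hr : 0 < r) :
    ∀ᶠ a in 𝓝 (1 : SL2R), ∀ g, riemDist Q g (g * a) < r := by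
  obtain ⟨f, hf, hf1, hfc⟩ := exists_iwasawa
  have h := ((continuous_iwasawaLength Q).continuousAt (x := f 1)).comp hfc
  have h0 : ∫ t in (0 : ℝ)..1, √(Q ((iwasawaMatrix (t • f 1)).adjugate * iwasawaVelocity (f 1) t)) = 0 := by
    have : ∀ t, iwasawaVelocity (f 1) t = 0 := fun t => by
      rw [hf1]
      ext i j
      fin_cases i <;> fin_cases j <;> simp [iwasawaVelocity]
    simp [this]
  have h1 : ∀ᶠ a in 𝓝 (1 : SL2R), (∫ t in (0 : ℝ)..1,
      √(Q ((iwasawaMatrix (t • f a)).adjugate * iwasawaVelocity (f a) t))) < r :=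
    h (Iio_mem_nhds (by rw [Function.comp_apply, h0]; exact hr))
  filter_upwards [h1] with a ha g
  refine lt_of_le_of_lt ?_ ha
  have := riemDist_mul_iwasawa_le (Q := Q) g (f a)
  rwa [hf] at this

/-- Bounded Riemannian distance means bounded norm of the quotient. -/
lemma exists_fro_le_of_riemDist_lt (hQ : IsLieAlgebraInner Q) (R : ℝ) :
    ∃ C > 0, ∀ g h, riemDist Q g h < R → fro (g⁻¹ * h) ≤ C := by
  obtain ⟨K, hK, hb⟩ := exists_fro_le_exp_pathLength hQ
  refine ⟨√(2 * Real.exp (K * R)), by positivity, fun g h hgh => ?_⟩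
  obtain ⟨f, hf, -, -⟩ := exists_iwasawa
  -- Without an admissible path the infimum would be `0` by convention and yield no path of length
  -- below `R`.
  have hne : {l : ℝ | ∃ γ : ℝ → SL2R, IsC1Path γ ∧ γ 0 = g ∧ γ 1 = h ∧ l = pathLength Q γ}.Nonempty :=
    ⟨_, _, (isC1Path_iwasawa (f (g⁻¹ * h))).mul_left g, by simp [iwasawa_zero], by simp [hf], rfl⟩
  obtain ⟨_, ⟨γ, hγ, h0, h1, rfl⟩, hl⟩ := exists_lt_of_csInf_lt hne hgh
  have := hb _ (hγ.mul_left g⁻¹) (by simp [h0])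
  rw [hγ.pathLength_mul_left, h1] at this
  refine Real.le_sqrt_of_sq_le (this.trans ?_)
  gcongr

end FurstenbergMeasure
end

open MeasureTheory Filter Topology
open scoped Matrix
open FurstenbergMeasure

set_option linter.unusedSectionVars false

noncomputable section

namespace FurstenbergMeasure

open scoped ENNReal

/-! ### Counting cells of a partition -/

lemma abs_entry_le_fro (g : SL2R) (i j : Fin 2) : |g i j| ≤ fro g := by
  refine abs_le_of_sq_le_sq ?_ (fro_pos g).le
  rw [fro_sq]
  fin_cases i <;> fin_cases j <;> simp <;> nlinarith [sq_nonneg (g 0 0), sq_nonneg (g 0 1), sq_nonneg (g 1 0), sq_nonneg (g 1 1)]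

lemma exists_entry_ball_subset {U : Set SL2R} (hU : U ∈ 𝓝 (1 : SL2R)) :
    ∃ δ > 0, ∀ a : SL2R, (∀ i j, |a i j - (1 : SL2R) i j| < δ) → a ∈ U := by
  obtain ⟨V, hV, hVU⟩ := (mem_nhds_induced
    (fun g : SL2R => (g : Matrix (Fin 2) (Fin 2) ℝ)) 1 U).1 hU
  have hV' : V ∈ @nhds (Fin 2 → Fin 2 → ℝ) _ (fun i j => (1 : SL2R) i j) := hV
  obtain ⟨δ, hδ, hball⟩ := Metric.mem_nhds_iff.1 hV'
  refine ⟨δ, hδ, fun a ha => hVU (hball ?_)⟩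
  exact (dist_pi_lt_iff hδ).2 fun i => (dist_pi_lt_iff hδ).2 fun j => ha i j

/-- Pigeonhole for the four entries on a grid of mesh `σ`: at most `2 * N + 1 ≤ 7 * (T / σ)` values
for each. -/
lemma card_le_of_separated {ι : Type*} {s : Finset ι} {b : ι → SL2R} {T σ : ℝ} (hσ : 0 < σ) (hT : σ ≤ T)
    (hb : ∀ i ∈ s, fro (b i) ≤ T)
    (hsep : ∀ i ∈ s, ∀ j ∈ s, (∀ k l, |b i k l - b j k l| < σ) → i = j) :
    (s.card : ℝ) ≤ (7 * (T / σ)) ^ 4 := by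
  obtain ⟨N, hN1, hN2⟩ : ∃ N : ℤ, T / σ + 1 ≤ N ∧ N ≤ T / σ + 2 :=
    ⟨⌈T / σ + 1⌉, Int.le_ceil _, by linarith [(Int.ceil_lt_add_one (T / σ + 1)).le]⟩
  have hTσ : 1 ≤ T / σ := by rwa [le_div_iff₀ hσ, one_mul]
  have hN0 : 0 ≤ N := by
    have : (0 : ℝ) ≤ N := by linarith
    exact_mod_cast this
  let f : ι → ℤ × ℤ × ℤ × ℤ := fun i =>
    (⌊b i 0 0 / σ⌋, ⌊b i 0 1 / σ⌋, ⌊b i 1 0 / σ⌋, ⌊b i 1 1 / σ⌋)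
  have hmem : ∀ i ∈ s, ∀ k l, ⌊b i k l / σ⌋ ∈ Finset.Icc (-N) N := by
    intro i hi k l
    have h1 := abs_le.1 ((abs_entry_le_fro (b i) k l).trans (hb i hi))
    have h2 : b i k l / σ ≤ T / σ := by gcongr; exact h1.2
    have h3 : -(T / σ) ≤ b i k l / σ := by rw [← neg_div]; gcongr; exact h1.1
    rw [Finset.mem_Icc]
    constructor
    · refine Int.le_floor.2 ?_
      push_cast
      linarith
    · have h4 : (⌊b i k l / σ⌋ : ℝ) ≤ N := (Int.floor_le _).trans (by linarith)
      exact_mod_cast h4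
  have hcard := Finset.card_le_card_of_injOn (s := s)
    (t := Finset.Icc (-N) N ×ˢ Finset.Icc (-N) N ×ˢ Finset.Icc (-N) N ×ˢ Finset.Icc (-N) N) f
    (fun i hi => by
      have := hmem i hi
      simp only [f, Finset.coe_product, Set.mem_prod, Finset.mem_coe]
      exact ⟨this 0 0, this 0 1, this 1 0, this 1 1⟩)
    (fun i hi j hj hij => hsep i hi j hj (by
      simp only [f, Prod.mk.injEq] at hij
      have key : ∀ k l, ⌊b i k l / σ⌋ = ⌊b j k l / σ⌋ → |b i k l - b j k l| < σ := by
        intro k l h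
        have := Int.abs_sub_lt_one_of_floor_eq_floor h
        rwa [← sub_div, abs_div, abs_of_pos hσ, div_lt_one hσ] at this
      intro k l
      fin_cases k <;> fin_cases l
      · exact key 0 0 hij.1
      · exact key 0 1 hij.2.1
      · exact key 1 0 hij.2.2.1
      · exact key 1 1 hij.2.2.2))
  have hI : ((Finset.Icc (-N) N).card : ℝ) = 2 * N + 1 := by
    rw [Int.card_Icc]
    have : ((N + 1 - -N).toNat : ℤ) = 2 * N + 1 := by omega
    exact_mod_cast this
  have h5 : (s.card : ℝ) ≤ (2 * N + 1) ^ 4 := by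
    calc (s.card : ℝ) ≤ ((Finset.Icc (-N) N ×ˢ Finset.Icc (-N) N ×ˢ Finset.Icc (-N) N ×ˢ
          Finset.Icc (-N) N).card : ℝ) := by exact_mod_cast hcard
      _ = (2 * N + 1) ^ 4 := by
          rw [Finset.card_product, Finset.card_product, Finset.card_product]
          push_cast
          rw [hI]
          ring
  refine h5.trans ?_
  have : (0 : ℝ) ≤ N := by exact_mod_cast hN0
  gcongr
  linarith

lemma eq_of_isPartition {α : Type*} {c : Set (Set α)} (hc : Setoid.IsPartition c) {D D' : Set α} (hD : D ∈ c)
    (hD' : D' ∈ c) {a : α} (ha : a ∈ D) (ha' : a ∈ D') : D = D' :=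
  (hc.2 a).unique ⟨hD, ha⟩ ⟨hD', ha'⟩

/-- The geometric properties of the first partition of a dyadic system. -/
lemma exists_cell_bounds {Q : QuadraticForm ℝ (Matrix (Fin 2) (Fin 2) ℝ)} (hQ : IsLieAlgebraInner Q)
    {𝒟 : ℕ → Set (Set SL2R)} (h𝒟 : IsDyadicSystem (riemDist Q) 𝒟) :
    Setoid.IsPartition (𝒟 1) ∧ (∀ D ∈ 𝒟 1, MeasurableSet D) ∧ ∃ K ≥ 1,
      (∀ D ∈ 𝒟 1, ∀ g ∈ D, ∀ h ∈ D, fro (g⁻¹ * h) ≤ K) ∧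
      ∀ (𝓖 : Finset (Set SL2R)) (g : SL2R) (T : ℝ), 1 ≤ T →
        (∀ D ∈ 𝓖, D ∈ 𝒟 1 ∧ ∃ h ∈ D, fro (g⁻¹ * h) ≤ T) → (𝓖.card : ℝ) ≤ K * T ^ 8 := by
  obtain ⟨M, hM, h⟩ := h𝒟
  obtain ⟨hpart, hmeas, -, -, hball⟩ := h 1 le_rfl
  obtain ⟨C, hC, hCb⟩ := exists_fro_le_of_riemDist_lt hQ ((M : ℝ) * (1 / 2 : ℝ) ^ 1)
  have hU := eventually_riemDist_mul_lt Q (r := 1 / (M : ℝ) * (1 / 2 : ℝ) ^ 1) (by positivity)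
  obtain ⟨δ, hδ, hδU⟩ := exists_entry_ball_subset hU
  have hsame : ∀ D ∈ 𝒟 1, ∀ g ∈ D, ∀ h ∈ D, fro (g⁻¹ * h) ≤ C ^ 2 := by
    intro D hD g hg h hh
    obtain ⟨-, k, hk⟩ := hball D hD
    have h1 := hCb k g (hk hg)
    have h2 := hCb k h (hk hh)
    calc fro (g⁻¹ * h) = fro ((k⁻¹ * g)⁻¹ * (k⁻¹ * h)) := by congr 1; group
      _ ≤ fro ((k⁻¹ * g)⁻¹) * fro (k⁻¹ * h) := fro_mul_le _ _
      _ ≤ C * C := by rw [fro_inv]; exact mul_le_mul h1 h2 (fro_pos _).le hC.le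
      _ = C ^ 2 := (sq C).symm
  -- The inner ball of a cell contains `k * a` for all `a` in a neighbourhood of `1` that is the
  -- same for all cells.
  have hcenter : ∀ D ∈ 𝒟 1, ∃ k ∈ D, ∀ a : SL2R, (∀ i j, |a i j - (1 : SL2R) i j| < δ) → k * a ∈ D := by
    intro D hD
    obtain ⟨⟨k, hk⟩, -⟩ := hball D hD
    refine ⟨k, ?_, fun a ha => hk (hδU a ha k)⟩
    have := hk (hδU 1 (by simpa using hδ) k)
    rwa [mul_one] at this
  choose! c hcD hc using hcenter
  have hC2 : 0 < C ^ 2 := by positivity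
  refine ⟨hpart, hmeas, 1 + C ^ 2 + (7 * (2 * (1 + C ^ 2) ^ 2 / min δ 1)) ^ 4, ?_, fun D hD g hg h hh => ?_,
    fun 𝓖 g T hT h𝓖 => ?_⟩
  · have : 0 ≤ (7 * (2 * (1 + C ^ 2) ^ 2 / min δ 1)) ^ 4 := by positivity
    change 1 ≤ 1 + C ^ 2 + (7 * (2 * (1 + C ^ 2) ^ 2 / min δ 1)) ^ 4
    linarith
  · have : 0 ≤ (7 * (2 * (1 + C ^ 2) ^ 2 / min δ 1)) ^ 4 := by positivity
    linarith [hsame D hD g hg h hh]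
  · set E := (1 + C ^ 2) * T with hE
    have hE1 : 1 ≤ E := by nlinarith
    set d := min δ 1 with hd
    have hd0 : 0 < d := lt_min hδ one_pos
    have hd1 : d ≤ 1 := min_le_right _ _
    have hdδ : d ≤ δ := min_le_left _ _
    have hσT : d / (2 * E) ≤ E := by
      rw [div_le_iff₀ (by positivity)]
      nlinarith
    have hb : ∀ D ∈ 𝓖, fro (g⁻¹ * c D) ≤ E := by
      intro D hD
      obtain ⟨hD1, h, hh, hhT⟩ := h𝓖 D hD
      calc fro (g⁻¹ * c D) = fro ((g⁻¹ * h) * (h⁻¹ * c D)) := by congr 1; group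
        _ ≤ fro (g⁻¹ * h) * fro (h⁻¹ * c D) := fro_mul_le _ _
        _ ≤ T * C ^ 2 := mul_le_mul hhT (hsame D hD1 h hh _ (hcD D hD1)) (fro_pos _).le (by linarith)
        _ ≤ E := by rw [hE]; nlinarith
    -- If two centres, seen from `g`, have entries closer than `d / (2 * E)`, then multiplication by
    -- `b⁻¹`, whose entries are at most `E`, leaves their quotient within `d` of `1`, so the cells
    -- coincide. The grid has ratio `2 * E ^ 2 / d`, whence the eighth power of `T`.
    have := card_le_of_separated (s := 𝓖) (b := fun D => g⁻¹ * c D) (T := E) (σ := d / (2 * E))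
      (by positivity) hσT hb fun D hD D' hD' hclose => ?_
    · refine this.trans ?_
      have e : (7 * (E / (d / (2 * E)))) ^ 4 = (7 * (2 * (1 + C ^ 2) ^ 2 / d)) ^ 4 * T ^ 8 := by
        rw [hE]; field_simp
      rw [e]
      have : 0 ≤ T ^ 8 := by positivity
      nlinarith
    · have hD1 := (h𝓖 D hD).1
      have hD1' := (h𝓖 D' hD').1
      refine eq_of_isPartition hpart hD1 hD1' (a := c D') ?_ (hcD D' hD1')
      have h1 := hc D hD1 ((c D)⁻¹ * c D') fun i j => ?_
      · rwa [mul_inv_cancel_left] at h1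
      · have e1 : (c D)⁻¹ * c D' = (g⁻¹ * c D)⁻¹ * (g⁻¹ * c D') := by group
        rw [e1]
        have hbD := hb D hD
        have hcl : ∀ k l, |(g⁻¹ * c D) k l - (g⁻¹ * c D') k l| < d / (2 * E) := hclose
        generalize g⁻¹ * c D = b at hcl hbD ⊢
        generalize g⁻¹ * c D' = b' at hcl ⊢
        have e2 : (1 : SL2R) i j = (b⁻¹ * b) i j := by rw [inv_mul_cancel]
        rw [e2, mul_entry b⁻¹ b' i j, mul_entry b⁻¹ b i j]
        have e3 : b⁻¹ i 0 * b' 0 j + b⁻¹ i 1 * b' 1 j - (b⁻¹ i 0 * b 0 j + b⁻¹ i 1 * b 1 j) =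
            b⁻¹ i 0 * (b' 0 j - b 0 j) + b⁻¹ i 1 * (b' 1 j - b 1 j) := by ring
        rw [e3]
        have f1 : ∀ k, |b⁻¹ i k * (b' k j - b k j)| < d / 2 := by
          intro k
          rw [abs_mul, abs_sub_comm]
          have g1 : |b⁻¹ i k| ≤ E := (abs_entry_le_fro _ _ _).trans (by rw [fro_inv]; exact hbD)
          have g2 : |b k j - b' k j| < d / (2 * E) := hcl k j
          calc |b⁻¹ i k| * |b k j - b' k j| ≤ E * |b k j - b' k j| := by gcongr
            _ < E * (d / (2 * E)) := by gcongr
            _ = d / 2 := by field_simp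
        calc _ ≤ |b⁻¹ i 0 * (b' 0 j - b 0 j)| + |b⁻¹ i 1 * (b' 1 j - b 1 j)| := abs_add_le _ _
          _ < δ := by linarith [f1 0, f1 1]

/-! ### Entropy estimates -/

/-- The entropy of a finitely supported measure as a finite sum. -/
lemma exists_entropy_eq_sum {η : Measure SL2R} [IsProbabilityMeasure η] {T : Finset SL2R}
    (hT : η (T : Set SL2R)ᶜ = 0) {𝒜 : Set (Set SL2R)} (hp : Setoid.IsPartition 𝒜)
    (hm : ∀ D ∈ 𝒜, MeasurableSet D) : ∃ 𝓕 : Finset (Set SL2R), (∀ D ∈ 𝓕, D ∈ 𝒜) ∧ 𝓕.card ≤ T.card ∧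
      ∑ D ∈ 𝓕, η.real D = 1 ∧
      entropy η 𝒜 = (∑ D ∈ 𝓕, -(η.real D * Real.log (η.real D))) / Real.log 2 := by
  classical
  choose cell hcell using fun g => (hp.2 g).exists
  have hsub : ∀ D ∈ T.image cell, D ∈ 𝒜 := fun D hD => by
    obtain ⟨g, -, rfl⟩ := Finset.mem_image.1 hD
    exact (hcell g).1
  refine ⟨T.image cell, hsub, Finset.card_image_le, ?_, ?_⟩
  · rw [← measureReal_biUnion_finset (fun D hD D' hD' hne => ?_) fun D hD => hm D (hsub D hD)]
    · rw [measureReal_def, (prob_compl_eq_zero_iff (Finset.measurableSet_biUnion _ fun D hD =>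
        hm D (hsub D hD))).1 (measure_mono_null (Set.compl_subset_compl.2 fun g hg => ?_) hT)]
      · rfl
      · exact Set.mem_iUnion₂.2 ⟨cell g, Finset.mem_image_of_mem cell hg, (hcell g).2⟩
    · exact Set.disjoint_left.2 fun g hg hg' => hne (eq_of_isPartition hp (hsub D hD) (hsub D' hD') hg hg')
  · rw [entropy, tsum_subtype 𝒜 fun D => η.real D * Real.logb 2 (η.real D),
      tsum_eq_sum (s := T.image cell) fun D hD => ?_, Finset.sum_neg_distrib, neg_div, Finset.sum_div]
    · congr 1
      refine Finset.sum_congr rfl fun D hD => ?_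
      rw [Set.indicator_of_mem (hsub D hD), Real.logb, mul_div_assoc]
    · by_cases hD𝒜 : D ∈ 𝒜
      · rw [Set.indicator_of_mem hD𝒜]
        have : η D = 0 := by
          refine measure_mono_null (t := (T : Set SL2R)ᶜ) (fun g hg hgT => hD ?_) hT
          exact Finset.mem_image.2 ⟨g, hgT, eq_of_isPartition hp (hcell g).1 hD𝒜 (hcell g).2 hg⟩
        simp [measureReal_def, this]
      · exact Set.indicator_of_notMem hD𝒜 _

/-- Jensen's bound for a subprobability, with an additive loss of `1`: apply `log u ≤ u - 1` to `u =
1 / (p * N)` in each term. -/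
lemma sum_neg_mul_log_le {ι : Type*} {s : Finset ι} {p : ι → ℝ} (hp : ∀ i ∈ s, 0 ≤ p i) {N : ℝ} (hN : 0 < N)
    (hs : s.card ≤ N) : ∑ i ∈ s, -(p i * Real.log (p i)) ≤ (∑ i ∈ s, p i) * Real.log N + 1 := by
  have h : ∀ i ∈ s, -(p i * Real.log (p i)) ≤ p i * Real.log N + 1 / N := by
    intro i hi
    rcases (hp i hi).eq_or_lt with h0 | h0
    · rw [← h0]; simp; positivity
    · have h1 := Real.log_le_sub_one_of_pos (show 0 < 1 / (p i * N) by positivity)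
      rw [one_div, Real.log_inv, Real.log_mul h0.ne' hN.ne'] at h1
      have h2 := mul_le_mul_of_nonneg_left h1 h0.le
      have h3 : p i * ((p i * N)⁻¹ - 1) = 1 / N - p i := by field_simp
      rw [h3] at h2
      linarith
  refine (Finset.sum_le_sum h).trans ?_
  rw [Finset.sum_add_distrib, Finset.sum_const, nsmul_eq_mul, ← Finset.sum_mul]
  gcongr
  rw [mul_one_div, div_le_one hN]
  exact hs

lemma le_sum_neg_mul_log {ι : Type*} {s : Finset ι} {p : ι → ℝ} (hp : ∀ i ∈ s, 0 ≤ p i)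
    (hs : ∑ i ∈ s, p i = 1) {q ε : ℝ} (hε : ε ≤ 1)
    (h : ∑ i ∈ s with q < p i, p i ≤ ε) : (1 - ε) * -Real.log q ≤ ∑ i ∈ s, -(p i * Real.log (p i)) := by
  have hp1 : ∀ i ∈ s, p i ≤ 1 := fun i hi => hs ▸ Finset.single_le_sum hp hi
  have h0 : ∀ i ∈ s, 0 ≤ -(p i * Real.log (p i)) := fun i hi => by
    have := Real.log_nonpos (hp i hi) (hp1 i hi)
    have := hp i hi
    nlinarith
  rcases le_or_gt (-Real.log q) 0 with hq | hq
  · exact (mul_nonpos_of_nonneg_of_nonpos (by linarith) hq).trans (Finset.sum_nonneg h0)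
  · calc (1 - ε) * -Real.log q ≤ (∑ i ∈ s with ¬ q < p i, p i) * -Real.log q := by
          refine mul_le_mul_of_nonneg_right ?_ hq.le
          have := Finset.sum_filter_add_sum_filter_not s (fun i => q < p i) p
          linarith
      _ = ∑ i ∈ s with ¬ q < p i, p i * -Real.log q := by rw [Finset.sum_mul]
      _ ≤ ∑ i ∈ s with ¬ q < p i, -(p i * Real.log (p i)) := by
          refine Finset.sum_le_sum fun i hi => ?_
          obtain ⟨hi, hqi⟩ := Finset.mem_filter.1 hi
          rcases (hp i hi).eq_or_lt with h0 | h0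
          · rw [← h0]; simp
          · have := Real.log_le_log h0 (not_lt.1 hqi)
            nlinarith
      _ ≤ ∑ i ∈ s, -(p i * Real.log (p i)) :=
          Finset.sum_le_sum_of_subset_of_nonneg (Finset.filter_subset _ _) fun i hi _ => h0 i hi

open Classical in
/-- A family of cells is counted by covering points of the projective line by balls. -/
lemma card_cells_le {ν : Measure RP1} [IsProbabilityMeasure ν] {𝓖 : Finset (Set SL2R)} {y : Set SL2R → RP1}
    {ρ N q : ℝ} (hN0 : 0 ≤ N) (hq : 0 < q) (hν : ∀ D ∈ 𝓖, q ≤ ν.real (Metric.ball (y D) (ρ / 2)))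
    (hN : ∀ D ∈ 𝓖, (({D' ∈ 𝓖 | dist (y D) (y D') < ρ}.card : ℕ) : ℝ) ≤ N) : (𝓖.card : ℝ) ≤ N / q := by
  -- In a maximal `ρ`-separated subfamily the balls of radius `ρ / 2` are disjoint with measure at
  -- least `q`, so it has at most `1 / q` members; by maximality each cell is within `ρ` of one of
  -- them.
  obtain ⟨𝓩, h𝓩, hmax⟩ := (𝓖.powerset.filter fun 𝓩 => ∀ D ∈ 𝓩, ∀ D' ∈ 𝓩, D ≠ D' →
    ρ ≤ dist (y D) (y D')).exists_max_image Finset.card ⟨∅, by simp⟩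
  simp only [Finset.mem_filter, Finset.mem_powerset] at h𝓩 hmax
  obtain ⟨h𝓩𝓖, hsep⟩ := h𝓩
  have hcov : 𝓖 ⊆ 𝓩.biUnion fun D => {D' ∈ 𝓖 | dist (y D) (y D') < ρ} := by
    intro D hD
    by_contra hcon
    have hfar : ∀ D' ∈ 𝓩, ρ ≤ dist (y D') (y D) := fun D' hD' => by
      by_contra hlt
      exact hcon (Finset.mem_biUnion.2 ⟨D', hD', Finset.mem_filter.2 ⟨hD, not_le.1 hlt⟩⟩)
    by_cases hD𝓩 : D ∈ 𝓩
    · have h1 := hfar D hD𝓩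
      rw [dist_self] at h1
      have h2 := hν D hD
      rw [Metric.ball_eq_empty.2 (by linarith), measureReal_empty] at h2
      linarith
    · have := hmax (insert D 𝓩) ⟨Finset.insert_subset hD h𝓩𝓖, fun A hA B hB hAB => ?_⟩
      · rw [Finset.card_insert_of_notMem hD𝓩] at this
        omega
      · rcases Finset.mem_insert.1 hA with rfl | hA' <;> rcases Finset.mem_insert.1 hB with rfl | hB'
        · exact absurd rfl hAB
        · rw [dist_comm]; exact hfar B hB'
        · exact hfar A hA'
        · exact hsep A hA' B hB' hAB
  have hcard𝓩 : (𝓩.card : ℝ) * q ≤ 1 := by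
    calc (𝓩.card : ℝ) * q = ∑ D ∈ 𝓩, q := by rw [Finset.sum_const, nsmul_eq_mul]
      _ ≤ ∑ D ∈ 𝓩, ν.real (Metric.ball (y D) (ρ / 2)) := Finset.sum_le_sum fun D hD => hν D (h𝓩𝓖 hD)
      _ = ν.real (⋃ D ∈ 𝓩, Metric.ball (y D) (ρ / 2)) := by
          refine (measureReal_biUnion_finset (fun D hD D' hD' hne => ?_) fun D _ =>
            Metric.isOpen_ball.measurableSet).symm
          exact Metric.ball_disjoint_ball (by linarith [hsep D hD D' hD' hne])
      _ ≤ 1 := measureReal_le_one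
  rw [le_div_iff₀ hq]
  calc (𝓖.card : ℝ) * q ≤ (𝓩.card * N) * q := by
        gcongr
        calc (𝓖.card : ℝ) ≤ ((𝓩.biUnion fun D => {D' ∈ 𝓖 | dist (y D) (y D') < ρ}).card : ℝ) := by
              exact_mod_cast Finset.card_le_card hcov
          _ ≤ ∑ D ∈ 𝓩, (({D' ∈ 𝓖 | dist (y D) (y D') < ρ}.card : ℕ) : ℝ) := by
              exact_mod_cast Finset.card_biUnion_le
          _ ≤ ∑ D ∈ 𝓩, N := Finset.sum_le_sum fun D hD => hN D (h𝓩𝓖 hD)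
          _ = 𝓩.card * N := by rw [Finset.sum_const, nsmul_eq_mul]
    _ = (𝓩.card * q) * N := by ring
    _ ≤ 1 * N := by gcongr
    _ = N := one_mul N

end FurstenbergMeasure
end

open MeasureTheory Filter Topology
open scoped Matrix
open FurstenbergMeasure

set_option linter.unusedSectionVars false

noncomputable section

namespace FurstenbergMeasure

open scoped ENNReal

/-! ### Geometry of typical pairs -/

lemma sqrt_nsq_add_le (v w : Fin 2 → ℝ) : √(nsq (v + w)) ≤ √(nsq v) + √(nsq w) := by
  rw [← norm_toLp, ← norm_toLp, ← norm_toLp]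
  exact norm_add_le (WithLp.toLp 2 v) (WithLp.toLp 2 w)

lemma sqrt_nsq_smul (a : ℝ) (v : Fin 2 → ℝ) : √(nsq (a • v)) = |a| * √(nsq v) := by
  rw [nsq_smul, Real.sqrt_mul (sq_nonneg a), Real.sqrt_sq_eq_abs]

/-- Decompose `w` along `v` and its perpendicular: the first component is stretched as `v` is, the
second has the sine of the angle as coefficient and is stretched by at most the norm. -/
lemma stretch_le_add (g : SL2R) (x y : RP1) : stretch g y ≤ stretch g x + fro g * dist x y := by
  have hv := nsq_pos x.rep_nonzero
  have hw := nsq_pos y.rep_nonzero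
  rw [dist_eq_cross, stretch, stretch, Real.sqrt_div (nsq_nonneg _), Real.sqrt_div (nsq_nonneg _)]
  generalize x.rep = v at *
  generalize y.rep = w at *
  let v' : Fin 2 → ℝ := ![-v 1, v 0]
  have hv' : nsq v' = nsq v := by simp [nsq, v']; ring
  have h1 : nsq v • w = (v 0 * w 0 + v 1 * w 1) • v + cross v w • v' := by
    ext i
    fin_cases i <;> simp [nsq, v', cross] <;> ring
  have h2 : nsq v • (g • w) = (v 0 * w 0 + v 1 * w 1) • (g • v) + cross v w • (g • v') := by
    rw [← smul_smul_vec, h1, smul_add, smul_smul_vec, smul_smul_vec]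
  have h3 : nsq v * √(nsq (g • w)) ≤ |v 0 * w 0 + v 1 * w 1| * √(nsq (g • v)) +
      |cross v w| * √(nsq (g • v')) := by
    have := sqrt_nsq_add_le ((v 0 * w 0 + v 1 * w 1) • (g • v)) (cross v w • (g • v'))
    rw [← h2, sqrt_nsq_smul, sqrt_nsq_smul, sqrt_nsq_smul, abs_of_pos hv] at this
    exact this
  have h4 : |v 0 * w 0 + v 1 * w 1| ≤ √(nsq v) * √(nsq w) := by
    rw [← Real.sqrt_mul hv.le]
    refine Real.abs_le_sqrt ?_
    simp only [nsq]
    nlinarith [sq_nonneg (v 0 * w 1 - v 1 * w 0)]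
  have h5 : √(nsq (g • v')) ≤ fro g * √(nsq v) := by
    rw [← Real.sqrt_sq (fro_pos g).le, ← Real.sqrt_mul (sq_nonneg _), ← hv']
    exact Real.sqrt_le_sqrt (nsq_smul_le g v')
  have hsv : 0 < √(nsq v) := Real.sqrt_pos.2 hv
  have hsw : 0 < √(nsq w) := Real.sqrt_pos.2 hw
  have hvv : nsq v = √(nsq v) * √(nsq v) := (Real.mul_self_sqrt hv.le).symm
  have h6 : √(nsq v) * √(nsq v) * √(nsq (g • w)) ≤
      √(nsq v) * √(nsq w) * √(nsq (g • v)) + |cross v w| * (fro g * √(nsq v)) := by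
    rw [← hvv]
    refine h3.trans ?_
    gcongr
  have e : √(nsq (g • v)) / √(nsq v) + fro g * (|cross v w| / (√(nsq v) * √(nsq w))) =
      (√(nsq v) * √(nsq w) * √(nsq (g • v)) + |cross v w| * (fro g * √(nsq v))) /
        (√(nsq v) * √(nsq v) * √(nsq w)) := by
    field_simp
  rw [e, div_le_div_iff₀ hsw (by positivity)]
  nlinarith

/-- Both points are images under `g`, of `x` and of `(g⁻¹ g') x'`, and `g` stretches these by at
least `A` and `A / K`. -/
lemma dist_smul_le_of_fro_le {g g' : SL2R} {x x' : RP1} {A K : ℝ} (hA : 0 < A) (hx : A ≤ stretch g x)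
    (hx' : A ≤ stretch g' x') (hK : fro (g⁻¹ * g') ≤ K) : dist (g • x) (g' • x') ≤ K / A ^ 2 := by
  have hK0 : 0 < K := (fro_pos _).trans_le hK
  have h1 : g' • x' = g • ((g⁻¹ * g') • x') := by rw [← mul_smul, mul_inv_cancel_left]
  have h2 : stretch g' x' = stretch g ((g⁻¹ * g') • x') * stretch (g⁻¹ * g') x' := by
    rw [← stretch_mul, mul_inv_cancel_left]
  rw [h1, dist_smul_smul]
  generalize (g⁻¹ * g') • x' = y at *
  have h3 : A ≤ stretch g y * K := by
    rw [h2] at hx'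
    exact hx'.trans (mul_le_mul_of_nonneg_left ((stretch_le_fro _ _).trans hK) (stretch_pos _ _).le)
  rw [div_le_div_iff₀ (mul_pos (stretch_pos _ _) (stretch_pos _ _)) (by positivity)]
  calc dist x y * A ^ 2 ≤ 1 * A ^ 2 := by gcongr; exact dist_le_one _ _
    _ = A * A := by ring
    _ ≤ stretch g x * (stretch g y * K) := mul_le_mul hx h3 hA.le (stretch_pos _ _).le
    _ = _ := by ring

/-- Near `g x` the matrix `g⁻¹` stretches by at most `1 / A + F * (2 / A ^ 2)`, and `g'` sends both
`x₁` and `x₂` there. So `g⁻¹ g'` stretches two lines at distance `c` only moderately, which bounds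
its norm by `fro_sq_mul_dist_sq_le`. -/
lemma fro_inv_mul_le_of_dist_le {g g' : SL2R} {x x₁ x₂ : RP1} {A F c : ℝ} (hA : 0 < A) (hc : 0 < c)
    (hx : A ≤ stretch g x) (hg : fro g ≤ F) (hg' : fro g' ≤ F) (h₁ : A ≤ stretch g' x₁)
    (h₂ : A ≤ stretch g' x₂) (h₁₂ : c ≤ dist x₁ x₂) (hd : dist (g • x) (g' • x₁) ≤ 1 / A ^ 2) :
    fro (g⁻¹ * g') ≤ 2 * ((1 / A + F * (2 / A ^ 2)) * F) / c := by
  have hF : 0 < F := (fro_pos g).trans_le hg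
  have hinv : stretch g⁻¹ (g • x) ≤ 1 / A := by
    rw [stretch_inv_smul, one_div]
    exact inv_anti₀ hA hx
  have key : ∀ x', A ≤ stretch g' x' → dist (g • x) (g' • x') ≤ 2 / A ^ 2 →
      stretch (g⁻¹ * g') x' ≤ (1 / A + F * (2 / A ^ 2)) * F := by
    intro x' _ hd'
    rw [stretch_mul]
    refine mul_le_mul ((stretch_le_add g⁻¹ (g • x) (g' • x')).trans (add_le_add hinv ?_))
      ((stretch_le_fro _ _).trans hg') (stretch_pos _ _).le (by positivity)
    rw [fro_inv]
    exact mul_le_mul hg hd' dist_nonneg hF.le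
  have hd2 : dist (g' • x₁) (g' • x₂) ≤ 1 / A ^ 2 := by
    rw [dist_smul_smul]
    refine div_le_div₀ zero_le_one (dist_le_one _ _) (by positivity) ?_
    rw [sq]
    exact mul_le_mul h₁ h₂ hA.le (stretch_pos _ _).le
  have e : 2 / A ^ 2 = 1 / A ^ 2 + 1 / A ^ 2 := by ring
  have hpos : 0 ≤ 1 / A ^ 2 := by positivity
  have k1 := key x₁ h₁ (by linarith)
  have k2 := key x₂ h₂ (by linarith [dist_triangle (g • x) (g' • x₁) (g' • x₂)])
  set S := (1 / A + F * (2 / A ^ 2)) * F with hS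
  have hS0 : 0 ≤ S := by positivity
  have h := fro_sq_mul_dist_sq_le (g⁻¹ * g') x₁ x₂
  have h' : (fro (g⁻¹ * g') * c) ^ 2 ≤ (2 * S) ^ 2 := by
    calc (fro (g⁻¹ * g') * c) ^ 2 = fro (g⁻¹ * g') ^ 2 * c ^ 2 := by ring
      _ ≤ fro (g⁻¹ * g') ^ 2 * dist x₁ x₂ ^ 2 := by gcongr
      _ ≤ 2 * (stretch (g⁻¹ * g') x₁ ^ 2 + stretch (g⁻¹ * g') x₂ ^ 2) := h
      _ ≤ 2 * (S ^ 2 + S ^ 2) := by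
          have s1 := stretch_pos (g⁻¹ * g') x₁
          have s2 := stretch_pos (g⁻¹ * g') x₂
          gcongr
      _ = (2 * S) ^ 2 := by ring
  rw [le_div_iff₀ hc]
  exact le_of_sq_le_sq h' (by positivity)

section

variable {μ : Measure SL2R} [IsProbabilityMeasure μ] {ν : Measure RP1}

lemma exists_card_support_le (h : FinSupp μ) :
    ∃ s : ℕ, 1 ≤ s ∧ ∀ n, ∃ T : Finset SL2R, convPow μ n (T : Set SL2R)ᶜ = 0 ∧ T.card ≤ s ^ n := by
  classical
  obtain ⟨T₁, hT₁⟩ := h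
  refine ⟨T₁.card + 1, by omega, fun n => ?_⟩
  induction n with
  | zero => exact ⟨{1}, by simp [convPow_zero], by simp⟩
  | succ n ih =>
    obtain ⟨T, hT, hcard⟩ := ih
    refine ⟨Finset.image₂ (· * ·) T T₁, ?_, ?_⟩
    · rw [convPow_succ, Measure.mconv, Measure.map_apply measurable_mul
        (Finset.measurableSet _).compl]
      refine measure_mono_null (t := (T : Set SL2R)ᶜ ×ˢ Set.univ ∪ Set.univ ×ˢ (T₁ : Set SL2R)ᶜ) ?_ ?_
      · rintro ⟨a, b⟩ hab
        by_contra hcon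
        simp only [Set.mem_union, Set.mem_prod, Set.mem_compl_iff, Set.mem_univ, and_true, true_and,
          not_or, not_not] at hcon
        exact hab (Finset.mem_image₂_of_mem hcon.1 hcon.2)
      · rw [measure_union_null_iff, Measure.prod_prod, Measure.prod_prod, hT, hT₁]
        simp
    · refine (Finset.card_image₂_le _ _ _).trans ?_
      rw [pow_succ]
      exact Nat.mul_le_mul hcard (by omega)

/-- The pairs of a matrix and a line which behave like typical pairs for `convPow μ n × ν`. -/
def typicalPairs (μ : Measure SL2R) (ν : Measure RP1) (α ε : ℝ) (n : ℕ) (t : ℝ) : Set (SL2R × RP1) :=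
  {p | fro p.1 ≤ 2 * Real.exp (n * (exponent μ ν + ε)) ∧
    Real.exp (n * (exponent μ ν - ε)) ≤ stretch p.1 p.2 ∧
    Real.exp (-((α + ε) * t)) ≤ ν.real (Metric.ball (p.1 • p.2) (Real.exp (-t))) ∧
    ν.real (Metric.ball (p.1 • p.2) (Real.exp (-t))) ≤ Real.exp (-((α - ε) * t))}

lemma measurableSet_typicalPairs [IsProbabilityMeasure ν] (α ε : ℝ) (n : ℕ) (t : ℝ) :
    MeasurableSet (typicalPairs μ ν α ε n t) := by
  have hb : Measurable fun p : SL2R × RP1 => ν.real (Metric.ball (p.1 • p.2) (Real.exp (-t))) :=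
    (measurable_measureReal_ball _).comp measurable_act
  exact (measurableSet_le (continuous_fro.measurable.comp measurable_fst) measurable_const).inter
    ((measurableSet_le measurable_const continuous_stretch.measurable).inter
      ((measurableSet_le measurable_const hb).inter (measurableSet_le hb measurable_const)))

lemma tendsto_measure_logBall [IsProbabilityMeasure ν] {α : ℝ}
    (hα : ∀ᵐ x ∂ν, Tendsto (fun t => logBall ν x t / t) atTop (𝓝 α)) {t : ℕ → ℝ}
    (ht : Tendsto t atTop atTop) {ε : ℝ} (hε : 0 < ε) :
    Tendsto (fun n => ν {x | ¬ (Real.exp (-((α + ε) * t n)) ≤ ν.real (Metric.ball x (Real.exp (-t n))) ∧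
      ν.real (Metric.ball x (Real.exp (-t n))) ≤ Real.exp (-((α - ε) * t n)))}) atTop (𝓝 0) := by
  have h1 := tendstoInMeasure_of_tendsto_ae (μ := ν) (f := fun n x => logBall ν x (t n) / t n)
    (g := fun _ => α) (fun n => by
      refine Measurable.aestronglyMeasurable ?_
      exact ((Real.measurable_log.comp (measurable_measureReal_ball _)).neg).div_const _)
    (by filter_upwards [hα] with x hx using hx.comp ht)
  have h2 := tendstoInMeasure_iff_dist.1 h1 ε hε
  refine tendsto_of_tendsto_of_tendsto_of_le_of_le' tendsto_const_nhds h2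
    (Eventually.of_forall fun _ => zero_le) ?_
  filter_upwards [ht.eventually (eventually_gt_atTop 0)] with n hn
  refine measure_mono_ae ?_
  filter_upwards [Measure.support_mem_ae] with x hx hbad
  by_contra hlt
  refine hbad ?_
  have hlt : dist (logBall ν x (t n) / t n) α < ε := not_le.1 hlt
  rw [Real.dist_eq, abs_lt, sub_lt_iff_lt_add', lt_sub_iff_add_lt', div_lt_iff₀ hn, lt_div_iff₀ hn] at hlt
  have hpos : 0 < ν.real (Metric.ball x (Real.exp (-t n))) :=
    ENNReal.toReal_pos ((Measure.mem_support_iff_forall x).1 hx _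
      (Metric.ball_mem_nhds x (Real.exp_pos _))).ne' (measure_ne_top _ _)
  rw [logBall] at hlt
  rw [← Real.le_log_iff_exp_le hpos, ← Real.log_le_iff_le_exp hpos]
  constructor <;> linarith [hlt.1, hlt.2]

/-- Large deviations control the stretch, and the norm through the two axes. Since `g x` is
distributed by `ν` when `(g, x)` has law `convPow μ n × ν`, almost everywhere convergence of local
dimensions controls the ball around it in measure. -/
lemma eventually_measure_typicalPairs (hfin : μ.support.Finite) (hunb : IsUnbounded (generatedGroup μ))
    (hirr : IsTotallyIrreducible (generatedGroup μ)) [IsProbabilityMeasure ν]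
    (hν : IsStationaryMeasure μ ν) {α : ℝ}
    (hα : ∀ᵐ x ∂ν, Tendsto (fun t => logBall ν x t / t) atTop (𝓝 α)) {t : ℕ → ℝ}
    (ht : Tendsto t atTop atTop) {ε δ : ℝ} (hε : 0 < ε) (hδ : 0 < δ) :
    ∀ᶠ n : ℕ in atTop, ((convPow μ n).prod ν).real (typicalPairs μ ν α ε n (t n))ᶜ ≤ δ := by
  obtain ⟨c, hc, C, hC, hLD⟩ := exists_largeDeviation hfin hunb hirr hν hε
  set χ := exponent μ ν
  have hst := continuous_stretch.measurable
  let A₁ : ℕ → Set (SL2R × RP1) := fun n => {p | stretch p.1 p.2 ≤ Real.exp (n * (χ - ε))}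
  let A₂ : Fin 2 → ℕ → Set (SL2R × RP1) := fun i n => {g | Real.exp (n * (χ + ε)) ≤ stretch g (axis i)} ×ˢ Set.univ
  let A₃ : ℕ → Set RP1 := fun n => {x | ¬ (Real.exp (-((α + ε) * t n)) ≤ ν.real (Metric.ball x (Real.exp (-t n))) ∧
      ν.real (Metric.ball x (Real.exp (-t n))) ≤ Real.exp (-((α - ε) * t n)))}
  have hA₁ : ∀ n, ((convPow μ n).prod ν) (A₁ n) ≤ ENNReal.ofReal (C * Real.exp (-(c * n))) := fun n => by
    rw [Measure.prod_apply_symm (measurableSet_le hst measurable_const)]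
    calc _ ≤ ∫⁻ _, ENNReal.ofReal (C * Real.exp (-(c * n))) ∂ν := by
          refine lintegral_mono fun x => ?_
          rw [← ofReal_measureReal]
          exact ENNReal.ofReal_le_ofReal (hLD n x).2
      _ = _ := by simp
  have hA₂ : ∀ i n, ((convPow μ n).prod ν) (A₂ i n) ≤ ENNReal.ofReal (C * Real.exp (-(c * n))) := fun i n => by
    rw [Measure.prod_prod, measure_univ, mul_one, ← ofReal_measureReal]
    exact ENNReal.ofReal_le_ofReal (hLD n _).1
  have hA₃m : ∀ n, MeasurableSet (A₃ n) := fun n => by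
    have hb := measurable_measureReal_ball (ν := ν) (Real.exp (-t n))
    exact ((measurableSet_le measurable_const hb).inter (measurableSet_le hb measurable_const)).compl
  have hA₃ : ∀ n, ((convPow μ n).prod ν) {p | p.1 • p.2 ∈ A₃ n} = ν (A₃ n) := fun n => by
    conv_rhs => rw [← hν.convPow n, Measure.map_apply measurable_act (hA₃m n)]
    rfl
  have hsub : ∀ n, (typicalPairs μ ν α ε n (t n))ᶜ ⊆ A₁ n ∪ A₂ 0 n ∪ A₂ 1 n ∪ {p | p.1 • p.2 ∈ A₃ n} := by
    rintro n ⟨g, x⟩ hp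
    by_contra hcon
    simp only [Set.mem_union, not_or, A₁, A₂, Set.mem_ofPred_eq, Set.mem_prod, Set.mem_univ, and_true, not_le,
      A₃, not_not] at hcon
    obtain ⟨⟨⟨h1, h2⟩, h3⟩, h4⟩ := hcon
    exact hp ⟨(fro_le_stretch_add g).trans (by linarith), h1.le, h4.1, h4.2⟩
  have hlim : Tendsto (fun n : ℕ => ENNReal.ofReal (C * Real.exp (-(c * n))) +
      ENNReal.ofReal (C * Real.exp (-(c * n))) + ENNReal.ofReal (C * Real.exp (-(c * n))) + ν (A₃ n))
      atTop (𝓝 0) := by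
    have h1 : Tendsto (fun n : ℕ => ENNReal.ofReal (C * Real.exp (-(c * n)))) atTop (𝓝 0) := by
      have := ENNReal.tendsto_ofReal ((tendsto_exp_neg_mul_nat hc).const_mul C)
      simpa using this
    have := ((h1.add h1).add h1).add (tendsto_measure_logBall hα ht hε)
    simp only [add_zero] at this
    exact this
  filter_upwards [hlim.eventually (eventually_le_nhds (b := ENNReal.ofReal δ) (by simpa using hδ))] with n hn
  refine ENNReal.toReal_le_of_le_ofReal hδ.le ((measure_mono (hsub n)).trans (le_trans ?_ hn))
  refine (measure_union_le _ _).trans (add_le_add ((measure_union_le _ _).trans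
    (add_le_add ((measure_union_le _ _).trans (add_le_add (hA₁ n) (hA₂ 0 n))) (hA₂ 1 n))) (hA₃ n).le)

lemma sum_measureReal_inter_prod_le {P : Measure (SL2R × RP1)} [IsFiniteMeasure P] {𝒜 : Set (Set SL2R)}
    (hp : Setoid.IsPartition 𝒜) (hm : ∀ D ∈ 𝒜, MeasurableSet D) {𝓕 : Finset (Set SL2R)} (h𝓕 : ∀ D ∈ 𝓕, D ∈ 𝒜)
    {B : Set (SL2R × RP1)} (hB : MeasurableSet B) : ∑ D ∈ 𝓕, P.real (B ∩ D ×ˢ Set.univ) ≤ P.real B := by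
  rw [← measureReal_biUnion_finset (fun D hD D' hD' hne => ?_) fun D hD =>
    hB.inter ((hm D (h𝓕 D hD)).prod MeasurableSet.univ)]
  · exact measureReal_mono (Set.iUnion₂_subset fun D _ => Set.inter_subset_left)
  · exact Set.disjoint_left.2 fun p hq hq' =>
      hne (eq_of_isPartition hp (h𝓕 D hD) (h𝓕 D' hD') hq.2.1 hq'.2.1)

/-- The typical part of a cell has the measure of a small ball. -/
lemma measureReal_typicalPairs_inter_le [IsProbabilityMeasure ν] (hν : IsStationaryMeasure μ ν) {α ε t K : ℝ} {n : ℕ} {D : Set SL2R}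
    (hD : ∀ g ∈ D, ∀ h ∈ D, fro (g⁻¹ * h) ≤ K)
    (ht : K / Real.exp (n * (exponent μ ν - ε)) ^ 2 < Real.exp (-t)) :
    ((convPow μ n).prod ν).real (typicalPairs μ ν α ε n t ∩ D ×ˢ Set.univ) ≤ Real.exp (-((α - ε) * t)) := by
  rcases (typicalPairs μ ν α ε n t ∩ D ×ˢ Set.univ).eq_empty_or_nonempty with h0 | ⟨⟨g, x⟩, hgx, hgD⟩
  · rw [h0, measureReal_empty]; positivity
  -- All typical pairs in the cell are mapped into one small ball around the image of one of them,
  -- and the action pushes the product measure to `ν`.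
  · have hsub : typicalPairs μ ν α ε n t ∩ D ×ˢ Set.univ ⊆
        (fun p : SL2R × RP1 => p.1 • p.2) ⁻¹' Metric.ball (g • x) (Real.exp (-t)) := by
      rintro ⟨g', x'⟩ ⟨hgx', hgD'⟩
      exact (dist_smul_le_of_fro_le (Real.exp_pos _) hgx'.2.1 hgx.2.1 (hD _ hgD'.1 _ hgD.1)).trans_lt ht
    refine (measureReal_mono hsub).trans (le_trans (le_of_eq ?_) hgx.2.2.2)
    rw [measureReal_def, measureReal_def]
    conv_rhs => rw [← hν.convPow n, Measure.map_apply measurable_act Metric.isOpen_ball.measurableSet]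

lemma measureReal_prod_univ [IsProbabilityMeasure ν] (n : ℕ) (D : Set SL2R) :
    ((convPow μ n).prod ν).real (D ×ˢ Set.univ) = (convPow μ n).real D := by
  rw [measureReal_def, Measure.prod_prod, measure_univ, mul_one, measureReal_def]

/-- The lower bound for the entropy at a given time. -/
lemma le_entropy_of_typicalPairs [IsProbabilityMeasure ν] (hν : IsStationaryMeasure μ ν)
    {𝒜 : Set (Set SL2R)} (hp : Setoid.IsPartition 𝒜) (hm : ∀ D ∈ 𝒜, MeasurableSet D) {K : ℝ}
    (hK : ∀ D ∈ 𝒜, ∀ g ∈ D, ∀ h ∈ D, fro (g⁻¹ * h) ≤ K) {α ε t : ℝ} {n : ℕ}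
    (ht : K / Real.exp (n * (exponent μ ν - ε)) ^ 2 < Real.exp (-t))
    (htyp : ((convPow μ n).prod ν).real (typicalPairs μ ν α ε n t)ᶜ ≤ ε) (hε : 2 * ε ≤ 1)
    {𝓕 : Finset (Set SL2R)} (h𝓕 : ∀ D ∈ 𝓕, D ∈ 𝒜) (hsum : ∑ D ∈ 𝓕, (convPow μ n).real D = 1) :
    (1 - 2 * ε) * ((α - ε) * t - Real.log 2) ≤
      ∑ D ∈ 𝓕, -((convPow μ n).real D * Real.log ((convPow μ n).real D)) := by
  set P := (convPow μ n).prod ν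
  set G := typicalPairs μ ν α ε n t
  have hGm : MeasurableSet G := measurableSet_typicalPairs α ε n t
  have h := le_sum_neg_mul_log (s := 𝓕) (p := fun D => (convPow μ n).real D)
    (fun D _ => measureReal_nonneg) hsum (q := 2 * Real.exp (-((α - ε) * t))) hε ?_
  · rw [Real.log_mul two_ne_zero (Real.exp_pos _).ne', Real.log_exp] at h
    convert! h using 2
    ring
  -- The typical part of a cell has at most half the threshold mass, so a heavier cell is at least
  -- half atypical; all such cells together have mass at most `2 * ε`.
  · have h1 : ∀ D ∈ 𝓕.filter fun D => 2 * Real.exp (-((α - ε) * t)) < (convPow μ n).real D,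
        (convPow μ n).real D ≤ 2 * P.real (Gᶜ ∩ D ×ˢ Set.univ) := by
      intro D hD
      obtain ⟨hD𝓕, hlt⟩ := Finset.mem_filter.1 hD
      have e1 := measureReal_typicalPairs_inter_le hν (α := α) (hK D (h𝓕 D hD𝓕)) ht
      have e2 : P.real (D ×ˢ Set.univ) ≤ P.real (G ∩ D ×ˢ Set.univ) + P.real (Gᶜ ∩ D ×ˢ Set.univ) := by
        refine le_trans (measureReal_mono (fun p hp => ?_)) (measureReal_union_le _ _)
        by_cases hpG : p ∈ G
        · exact Or.inl ⟨hpG, hp⟩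
        · exact Or.inr ⟨hpG, hp⟩
      rw [measureReal_prod_univ] at e2
      linarith
    refine (Finset.sum_le_sum h1).trans ?_
    rw [← Finset.mul_sum]
    have := sum_measureReal_inter_prod_le (P := P) hp hm
      (𝓕 := 𝓕.filter fun D => 2 * Real.exp (-((α - ε) * t)) < (convPow μ n).real D)
      (fun D hD => h𝓕 D (Finset.mem_filter.1 hD).1) hGm.compl
    linarith

end

end FurstenbergMeasure
end

open MeasureTheory Filter Topology
open scoped Matrix
open FurstenbergMeasure

set_option linter.unusedSectionVars false

noncomputable section

namespace FurstenbergMeasure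

/-! ### The upper bound for the entropy and its growth rate. -/

open scoped ENNReal

section

variable {μ : Measure SL2R} [IsProbabilityMeasure μ] {ν : Measure RP1}

/-- Fubini: over every matrix of the cell at least half of the lines are atypical. -/
lemma measureReal_le_two_mul_of_section_le [IsProbabilityMeasure ν] {η : Measure SL2R} [IsProbabilityMeasure η]
    {G : Set (SL2R × RP1)} (hG : MeasurableSet G) {D : Set SL2R} (hDm : MeasurableSet D)
    (hD : ∀ g ∈ D, ν.real {x | (g, x) ∈ G} ≤ 1 / 2) :
    η.real D ≤ 2 * (η.prod ν).real (Gᶜ ∩ D ×ˢ Set.univ) := by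
  have hm : MeasurableSet (Gᶜ ∩ D ×ˢ Set.univ) := hG.compl.inter (hDm.prod MeasurableSet.univ)
  have h1 : ENNReal.ofReal (1 / 2) * η D ≤ (η.prod ν) (Gᶜ ∩ D ×ˢ Set.univ) := by
    rw [Measure.prod_apply hm, ← setLIntegral_const, ← lintegral_indicator hDm]
    refine lintegral_mono fun g => ?_
    by_cases hg : g ∈ D
    · rw [Set.indicator_of_mem hg]
      have e : Prod.mk g ⁻¹' (Gᶜ ∩ D ×ˢ Set.univ) = {x | (g, x) ∈ G}ᶜ := by
        ext x; simp [hg]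
      have hs : MeasurableSet {x | (g, x) ∈ G} := measurable_prodMk_left hG
      rw [e, ← ofReal_measureReal, probReal_compl_eq_one_sub hs]
      exact ENNReal.ofReal_le_ofReal (by linarith [hD g hg])
    · rw [Set.indicator_of_notMem hg]
      exact zero_le
  have h2 := ENNReal.toReal_mono (measure_ne_top _ _) h1
  rw [ENNReal.toReal_mul, ENNReal.toReal_ofReal (by norm_num)] at h2
  simp only [measureReal_def]
  linarith

lemma typical_fro_bound {a b c : ℝ} (hc : 0 < c) (hab : a ≤ b) :
    2 * ((1 / Real.exp a + 2 * Real.exp b * (2 / Real.exp a ^ 2)) * (2 * Real.exp b)) / c ≤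
      20 / c * Real.exp (2 * (b - a)) := by
  have h1 : Real.exp b = Real.exp (b - a) * Real.exp a := by rw [← Real.exp_add]; congr 1; ring
  have h2 : Real.exp (2 * (b - a)) = Real.exp (b - a) ^ 2 := by
    rw [← Real.exp_nat_mul]; push_cast; rfl
  have h3 : 1 ≤ Real.exp (b - a) := Real.one_le_exp (by linarith)
  rw [h1, h2]
  have ha := Real.exp_pos a
  generalize Real.exp (b - a) = E at *
  generalize Real.exp a = A at *
  have e : 2 * ((1 / A + 2 * (E * A) * (2 / A ^ 2)) * (2 * (E * A))) = 4 * E + 16 * E ^ 2 := by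
    field_simp; ring
  rw [e, div_mul_eq_mul_div]
  refine div_le_div_of_nonneg_right ?_ hc.le
  nlinarith

/-- The upper bound for the entropy at a given time. -/
lemma entropy_le_of_typicalPairs [IsProbabilityMeasure ν]
    {𝒜 : Set (Set SL2R)} (hp : Setoid.IsPartition 𝒜) (hm : ∀ D ∈ 𝒜, MeasurableSet D) {K : ℝ} (hK1 : 1 ≤ K)
    (hK : ∀ (𝓖 : Finset (Set SL2R)) (g : SL2R) (T : ℝ), 1 ≤ T →
      (∀ D ∈ 𝓖, D ∈ 𝒜 ∧ ∃ h ∈ D, fro (g⁻¹ * h) ≤ T) → (𝓖.card : ℝ) ≤ K * T ^ 8) {c : ℝ} (hc : 0 < c)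
    (hc1 : c ≤ 1) (hcν : ∀ x, ν.real (Metric.closedBall x c) ≤ 1 / 2) {α ε t : ℝ} {n : ℕ} (hα : 0 ≤ α)
    (hε : 0 < ε) (ht0 : 0 ≤ t) (ht : 2 * Real.exp (-t) ≤ 1 / Real.exp (n * (exponent μ ν - ε)) ^ 2)
    (htyp : ((convPow μ n).prod ν).real (typicalPairs μ ν α ε n t)ᶜ ≤ ε)
    {𝓕 : Finset (Set SL2R)} (h𝓕 : ∀ D ∈ 𝓕, D ∈ 𝒜) {s : ℕ} (hs : 1 ≤ s) (hcard : 𝓕.card ≤ s ^ n)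
    (hsum : ∑ D ∈ 𝓕, (convPow μ n).real D = 1) :
    ∑ D ∈ 𝓕, -((convPow μ n).real D * Real.log ((convPow μ n).real D)) ≤
      (Real.log K + 8 * Real.log (20 / c) + 32 * ε * n + (α + ε) * t) + 2 * ε * (n * Real.log s) + 2 := by
  classical
  set P := (convPow μ n).prod ν
  obtain ⟨G, hG⟩ : ∃ G, G = typicalPairs μ ν α ε n t := ⟨_, rfl⟩
  rw [← hG] at htyp
  have hGm : MeasurableSet G := hG ▸ measurableSet_typicalPairs α ε n t
  obtain ⟨𝓖, h𝓖⟩ : ∃ 𝓖, 𝓖 = 𝓕.filter fun D => ∃ g ∈ D, 1 / 2 < ν.real {x | (g, x) ∈ G} := ⟨_, rfl⟩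
  -- A set of lines of measure above `1 / 2` does not fit in a closed ball of radius `c`, so a good
  -- cell contains a matrix with two typical lines at distance at least `c`.
  have hgood : ∀ D ∈ 𝓖, ∃ g ∈ D, ∃ x₁ x₂, (g, x₁) ∈ G ∧ (g, x₂) ∈ G ∧ c ≤ dist x₁ x₂ := by
    intro D hD
    rw [h𝓖, Finset.mem_filter] at hD
    obtain ⟨-, g, hgD, hg⟩ := hD
    obtain ⟨x₁, hx₁⟩ : {x | (g, x) ∈ G}.Nonempty := by
      by_contra hne
      rw [Set.not_nonempty_iff_eq_empty.1 hne, measureReal_empty] at hg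
      norm_num at hg
    obtain ⟨x₂, hx₂, hfar⟩ : ∃ x₂ ∈ {x | (g, x) ∈ G}, x₂ ∉ Metric.closedBall x₁ c := by
      by_contra! hcon
      exact absurd (hg.trans_le (measureReal_mono hcon)) (not_lt.2 (hcν x₁))
    rw [Metric.mem_closedBall, not_le, dist_comm] at hfar
    exact ⟨g, hgD, x₁, x₂, hx₁, hx₂, hfar.le⟩
  choose! g hgD x₁ x₂ hx₁ hx₂ hx₁₂ using hgood
  have h𝓖𝒜 : ∀ D ∈ 𝓖, D ∈ 𝒜 := fun D hD => h𝓕 D (Finset.filter_subset _ _ (h𝓖 ▸ hD))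
  set T := 20 / c * Real.exp (4 * ε * n) with hT
  have hc20 : 1 ≤ 20 / c := by rw [le_div_iff₀ hc]; linarith
  have hT1 : 1 ≤ T := one_le_mul_of_one_le_of_one_le hc20 (Real.one_le_exp (by positivity))
  have hclose : ∀ D ∈ 𝓖, ∀ D' ∈ 𝓖, dist (g D • x₁ D) (g D' • x₁ D') < 2 * Real.exp (-t) →
      fro ((g D)⁻¹ * g D') ≤ T := by
    intro D hD D' hD' hd
    have t1 := hx₁ D hD
    have t2 := hx₁ D' hD'
    have t3 := hx₂ D' hD'
    rw [hG] at t1 t2 t3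
    refine (fro_inv_mul_le_of_dist_le (Real.exp_pos _) hc t1.2.1 t1.1 t2.1 t2.2.1 t3.2.1 (hx₁₂ D' hD')
      (hd.le.trans ht)).trans ?_
    refine (typical_fro_bound hc (by gcongr; linarith)).trans (le_of_eq ?_)
    rw [hT]
    congr 2
    ring
  have hcount := card_cells_le (ν := ν) (𝓖 := 𝓖) (y := fun D => g D • x₁ D) (ρ := 2 * Real.exp (-t))
    (N := K * T ^ 8) (q := Real.exp (-((α + ε) * t))) (by positivity) (Real.exp_pos _)
    (fun D hD => by
      have := hx₁ D hD
      rw [hG] at this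
      rw [mul_div_cancel_left₀ _ two_ne_zero]
      exact this.2.2.1)
    fun D hD => hK _ (g D) T hT1 fun D' hD' => by
      obtain ⟨hD'1, hd⟩ := Finset.mem_filter.1 hD'
      exact ⟨h𝓖𝒜 D' hD'1, g D', hgD D' hD'1, hclose D hD D' hD'1 hd⟩
  have hTpos : 0 < T := by linarith
  have hlogN : Real.log (K * T ^ 8 / Real.exp (-((α + ε) * t))) =
      Real.log K + 8 * Real.log (20 / c) + 32 * ε * n + (α + ε) * t := by
    rw [Real.log_div (by positivity) (Real.exp_pos _).ne', Real.log_exp, Real.log_mul (by positivity) (by positivity),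
      Real.log_pow, hT, Real.log_mul (by positivity) (Real.exp_pos _).ne', Real.log_exp]
    push_cast
    ring
  have hlogN0 : 0 ≤ Real.log (K * T ^ 8 / Real.exp (-((α + ε) * t))) := by
    rw [hlogN]
    have := Real.log_nonneg hK1
    have := Real.log_nonneg hc20
    positivity
  -- The bad cells carry mass at most `2 * ε`, so the crude count `s ^ n` of cells limits their
  -- contribution to `2 * ε * n * log s + 1`.
  have hrest : ∑ D ∈ 𝓕 with ¬ ∃ g ∈ D, 1 / 2 < ν.real {x | (g, x) ∈ G}, (convPow μ n).real D ≤ 2 * ε := by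
    have h1 : ∀ D ∈ 𝓕.filter fun D => ¬ ∃ g ∈ D, 1 / 2 < ν.real {x | (g, x) ∈ G},
        (convPow μ n).real D ≤ 2 * P.real (Gᶜ ∩ D ×ˢ Set.univ) := by
      intro D hD
      obtain ⟨hD𝓕, hD2⟩ := Finset.mem_filter.1 hD
      push Not at hD2
      exact measureReal_le_two_mul_of_section_le hGm (hm D (h𝓕 D hD𝓕)) hD2
    refine (Finset.sum_le_sum h1).trans ?_
    rw [← Finset.mul_sum]
    have := sum_measureReal_inter_prod_le (P := P) hp hm
      (𝓕 := 𝓕.filter fun D => ¬ ∃ g ∈ D, 1 / 2 < ν.real {x | (g, x) ∈ G})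
      (fun D hD => h𝓕 D (Finset.mem_filter.1 hD).1) hGm.compl
    linarith
  have hsumG : ∑ D ∈ 𝓖, (convPow μ n).real D ≤ 1 := by
    rw [← hsum, h𝓖]
    exact Finset.sum_le_sum_of_subset_of_nonneg (Finset.filter_subset _ _) fun _ _ _ => measureReal_nonneg
  have e1 := sum_neg_mul_log_le (s := 𝓖) (p := fun D => (convPow μ n).real D) (fun D _ => measureReal_nonneg)
    (by positivity) hcount
  have e2 := sum_neg_mul_log_le (s := 𝓕.filter fun D => ¬ ∃ g ∈ D, 1 / 2 < ν.real {x | (g, x) ∈ G})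
    (p := fun D => (convPow μ n).real D) (fun D _ => measureReal_nonneg) (N := (s : ℝ) ^ n)
    (by positivity) (by exact_mod_cast (Finset.card_filter_le _ _).trans hcard)
  rw [Real.log_pow] at e2
  rw [← Finset.sum_filter_add_sum_filter_not 𝓕 (fun D => ∃ g ∈ D, 1 / 2 < ν.real {x | (g, x) ∈ G}), ← h𝓖, ← hlogN]
  have hs0 : 0 ≤ (n : ℝ) * Real.log s := mul_nonneg (Nat.cast_nonneg _) (Real.log_nonneg (by exact_mod_cast hs))
  have e3 := mul_le_mul_of_nonneg_right hsumG hlogN0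
  have e4 := mul_le_mul_of_nonneg_right hrest hs0
  linarith

lemma tendsto_div_natCast_of_bounds {E : ℕ → ℝ} {a b : ℝ → ℝ} {L ε₀ : ℝ} (hε₀ : 0 < ε₀)
    (ha : ContinuousAt a 0) (hb : ContinuousAt b 0) (ha0 : a 0 = L) (hb0 : b 0 = L)
    (h : ∀ ε, 0 < ε → ε < ε₀ → ∃ K, ∀ᶠ n : ℕ in atTop, a ε * n - K ≤ E n ∧ E n ≤ b ε * n + K) :
    Tendsto (fun n : ℕ => E n / n) atTop (𝓝 L) := by
  refine Metric.tendsto_nhds.2 fun η hη => ?_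
  have h1 : ∀ᶠ ε in 𝓝[>] (0 : ℝ), L - η / 2 < a ε :=
    (ha.eventually (lt_mem_nhds (by rw [ha0]; linarith))).filter_mono nhdsWithin_le_nhds
  have h2 : ∀ᶠ ε in 𝓝[>] (0 : ℝ), b ε < L + η / 2 :=
    (hb.eventually (gt_mem_nhds (by rw [hb0]; linarith))).filter_mono nhdsWithin_le_nhds
  obtain ⟨ε, h1, h2, h3⟩ := (h1.and (h2.and (Ioo_mem_nhdsGT hε₀ : ∀ᶠ ε in 𝓝[>] (0 : ℝ), ε ∈ Set.Ioo 0 ε₀))).exists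
  obtain ⟨K, hK⟩ := h ε h3.1 h3.2
  filter_upwards [hK, eventually_gt_atTop 0,
    tendsto_natCast_atTop_atTop.eventually (eventually_gt_atTop (2 * K / η))] with n hn hn0 hnK
  have hn0' : (0 : ℝ) < n := by exact_mod_cast hn0
  rw [div_lt_iff₀ hη] at hnK
  rw [Real.dist_eq, abs_lt, sub_lt_iff_lt_add', lt_sub_iff_add_lt', div_lt_iff₀ hn0', lt_div_iff₀ hn0']
  constructor <;> nlinarith [hn.1, hn.2]

/-- The growth rate of the entropy of the convolution powers. -/
lemma tendsto_entropy_div (hfin : μ.support.Finite) (hunb : IsUnbounded (generatedGroup μ))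
    (hirr : IsTotallyIrreducible (generatedGroup μ)) [IsProbabilityMeasure ν]
    (hν : IsStationaryMeasure μ ν) (hχ : 0 < exponent μ ν) {α : ℝ}
    (hα : ∀ᵐ x ∂ν, Tendsto (fun t => logBall ν x t / t) atTop (𝓝 α))
    {Q : QuadraticForm ℝ (Matrix (Fin 2) (Fin 2) ℝ)} (hQ : IsLieAlgebraInner Q)
    {𝒟 : ℕ → Set (Set SL2R)} (h𝒟 : IsDyadicSystem (riemDist Q) 𝒟) :
    Tendsto (fun n : ℕ => entropy (convPow μ n) (𝒟 1) * Real.log 2 / n) atTop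
      (𝓝 (2 * exponent μ ν * α)) := by
  have := hν.nullSingletonClass hfin hirr
  obtain ⟨hp, hm, K, hK1, hK, hKcount⟩ := exists_cell_bounds hQ h𝒟
  obtain ⟨c, hc, hc1, hcν⟩ : ∃ c > 0, c ≤ 1 ∧ ∀ x, ν.real (Metric.closedBall x c) ≤ 1 / 2 := by
    obtain ⟨c, hc, h⟩ := exists_forall_closedBall_le ν (ε := ENNReal.ofReal (1 / 2)) (by simp)
    refine ⟨min c 1, lt_min hc one_pos, min_le_right _ _, fun x => ?_⟩
    exact ENNReal.toReal_le_of_le_ofReal (by norm_num)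
      ((measure_mono (Metric.closedBall_subset_closedBall (min_le_left _ _))).trans (h x))
  obtain ⟨s, hs, hT⟩ := exists_card_support_le (finSupp_of_support_finite hfin)
  have hα0 : 0 ≤ α := by
    obtain ⟨x, hx⟩ := hα.exists
    refine ge_of_tendsto hx ?_
    filter_upwards [eventually_gt_atTop 0] with t ht
    exact div_nonneg (neg_nonneg.2 (Real.log_nonpos measureReal_nonneg measureReal_le_one)) ht.le
  set χ := exponent μ ν with hχd
  have hsum : ∀ n, ∃ 𝓕 : Finset (Set SL2R), 𝓕.card ≤ s ^ n ∧ (∀ D ∈ 𝓕, D ∈ 𝒟 1) ∧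
      ∑ D ∈ 𝓕, (convPow μ n).real D = 1 ∧ entropy (convPow μ n) (𝒟 1) =
        (∑ D ∈ 𝓕, -((convPow μ n).real D * Real.log ((convPow μ n).real D))) / Real.log 2 := fun n => by
    obtain ⟨T, hT1, hT2⟩ := hT n
    obtain ⟨𝓕, h1, h2, h3, h4⟩ := exists_entropy_eq_sum hT1 hp hm
    exact ⟨𝓕, h2.trans hT2, h1, h3, h4⟩
  have hlog2 : 0 < Real.log 2 := Real.log_pos one_lt_two
  refine tendsto_div_natCast_of_bounds (ε₀ := min χ (1 / 2))
    (a := fun ε => (1 - 2 * ε) * ((α - ε) * (2 * (χ - ε))))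
    (b := fun ε => 32 * ε + (α + ε) * (2 * (χ - ε)) + 2 * ε * Real.log s) (by positivity)
    (by fun_prop) (by fun_prop) (by ring) (by ring) fun ε hε hε0 => ?_
  have hεχ : ε < χ := hε0.trans_le (min_le_left _ _)
  have hε1 : 2 * ε ≤ 1 := by linarith [hε0.trans_le (min_le_right χ (1 / 2))]
  -- Both scales are `2 * (χ - ε) * n` up to a constant: `-log (2 * K)` makes the ball larger than
  -- the spread `K / A ^ 2` of a cell, and `log 2` makes twice its radius equal to `1 / A ^ 2`, the
  -- closeness needed to compare matrices.
  have hlin (b : ℝ) : Tendsto (fun n : ℕ => 2 * (χ - ε) * n + b) atTop atTop :=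
    tendsto_atTop_add_const_right _ _ (tendsto_natCast_atTop_atTop.const_mul_atTop (by linarith))
  have hA2 : ∀ n : ℕ, Real.exp (n * (χ - ε)) ^ 2 = Real.exp (2 * (χ - ε) * n) := fun n => by
    rw [← Real.exp_nat_mul]; congr 1; push_cast; ring
  refine ⟨|(1 - 2 * ε) * ((α - ε) * -Real.log (2 * K) - Real.log 2)| +
    |Real.log K + 8 * Real.log (20 / c) + (α + ε) * Real.log 2 + 2|, ?_⟩
  filter_upwards [eventually_measure_typicalPairs hfin hunb hirr hν hα (hlin (-Real.log (2 * K))) hε hε,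
    eventually_measure_typicalPairs hfin hunb hirr hν hα (hlin (Real.log 2)) hε hε] with n h1 h2
  obtain ⟨𝓕, hcard, h𝓕, hone, hent⟩ := hsum n
  rw [hent, div_mul_cancel₀ _ hlog2.ne']
  constructor
  · have h := le_entropy_of_typicalPairs hν hp hm hK (α := α) (ε := ε) ?_ h1 hε1 h𝓕 hone
    · refine le_trans ?_ h
      have e := le_abs_self (-((1 - 2 * ε) * ((α - ε) * -Real.log (2 * K) - Real.log 2)))
      rw [abs_neg] at e
      have e2 := abs_nonneg (Real.log K + 8 * Real.log (20 / c) + (α + ε) * Real.log 2 + 2)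
      linarith
    · rw [← hχd, hA2, neg_add, neg_neg, Real.exp_add, Real.exp_log (by positivity), Real.exp_neg,
        div_eq_mul_inv, mul_comm]
      have := Real.exp_pos (2 * (χ - ε) * n)
      gcongr
      linarith
  · have h := entropy_le_of_typicalPairs hp hm hK1 hKcount hc hc1 hcν hα0 hε ?_ ?_ h2 h𝓕 hs hcard hone
    · refine h.trans ?_
      have e := le_abs_self (Real.log K + 8 * Real.log (20 / c) + (α + ε) * Real.log 2 + 2)
      have e2 := abs_nonneg ((1 - 2 * ε) * ((α - ε) * -Real.log (2 * K) - Real.log 2))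
      linarith
    · have : 0 < χ - ε := by linarith
      positivity
    · rw [← hχd, hA2, neg_add, Real.exp_add, Real.exp_neg (Real.log 2), Real.exp_log two_pos, Real.exp_neg,
        one_div]
      linarith [inv_pos.2 (Real.exp_pos (2 * (χ - ε) * n))]

end

end FurstenbergMeasure
end

/-! ### The theorem. -/

open FurstenbergMeasure
theorem proposition3
    (Q : QuadraticForm ℝ (Matrix (Fin 2) (Fin 2) ℝ)) (hQ : IsLieAlgebraInner Q)
    (𝒟 : ℕ → Set (Set SL2R)) (h𝒟 : IsDyadicSystem (riemDist Q) 𝒟)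
    (μ : Measure SL2R) [IsProbabilityMeasure μ]
    (hfin : μ.support.Finite)
    (hunb : IsUnbounded (generatedGroup μ))
    (hirr : IsTotallyIrreducible (generatedGroup μ))
    (ν : Measure RP1) [IsProbabilityMeasure ν] (hν : IsStationaryMeasure μ ν) :
    ∃ χ α : ℝ, 0 < χ ∧ IsLyapunovExponent μ χ ∧ HasExactDim ν α ∧
      Tendsto (fun n : ℕ => 1 / (2 * χ * (n : ℝ)) * entropy (convPow μ n) (𝒟 1))
        atTop (𝓝 α) := by
  have hχ : 0 < exponent μ ν := by
    rw [exponent, integral_drift_one (finSupp_of_support_finite hfin)]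
    exact hν.integral_log_stretch_pos hfin hunb hirr
  obtain ⟨α, hα⟩ := exists_tendsto_logBall hfin hunb hirr hν hχ
  -- `exponent` uses natural logarithms; the factor `log 2` cancels against the one from the
  -- base-two entropy.
  refine ⟨exponent μ ν / Real.log 2, α, div_pos hχ (Real.log_pos one_lt_two),
    isLyapunovExponent_exponent hfin hunb hirr hν, hasExactDim_of_tendsto hα, ?_⟩
  have h := (tendsto_entropy_div hfin hunb hirr hν hχ hα hQ h𝒟).div_const (2 * exponent μ ν)
  rw [mul_div_cancel_left₀ _ (by positivity)] at h
  refine h.congr fun n => ?_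
  have := Real.log_pos one_lt_two
  rcases eq_or_ne n 0 with rfl | hn
  -- At `n = 0` both sides are `0` by division by zero.
  · simp
  · field_simp
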